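/- Let $K$ be a field of characteristic $0$ and let $\mathcal F=(\mathcal F_r)_{r\ge 0}$ be a deck: commutative $K$-algebras $\mathcal F_r$ of functions of $(u_1,\dots,u_r;v_1,\dots,v_r)$, stable under the integral linear substitutions $u_i\mapsto\sum_jP_{ij}u_j$, $v_i\mapsto\sum_jQ_{ij}v_j$ ($P,Q$ integral $r\times n$ matrices whose rows are parts of bases of $\mathbb Z^n$), for instance $\mathcal F_r=K(u_1,\dots,u_r,v_1,\dots,v_r)$. A bimould is a family $M=(M_r)_r\in\prod_r\mathcal F_r$; one writes $M(w_1\cdots w_r)$ with letters $w_i=\binom{u_i}{v_i}$ for $M_r$. $\mathsf{MU}$ (resp. $\mathsf{LU}$) is the set of bimoulds with $M(\varnothing)=1$ (resp. $0$); $\mathsf{leng}_k$ is the projection to the component of length $k$, and $\mathsf{der}(M)_r=rM_r$. For a factorization $\cdots\mathbf a\mathbf b\cdots$ of a word, $\lceil\mathbf b$ (resp. $\mathbf a\rceil$) is obtained by adding the sum of the upper entries of $\mathbf a$ (resp. $\mathbf b$) to the upper entry of the first letter of $\mathbf b$ (resp. the last letter of $\mathbf a$); $\mathbf a\rfloor$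 (resp. $\lfloor\mathbf b$) is obtained by subtracting the lower entry of the first letter of $\mathbf b$ (resp. the last letter of $\mathbf a$) from all lower entries of $\mathbf a$ (resp. $\mathbf b$). Put $\mathsf{mu}(A,B)(\mathbf w)=\sum_{\mathbf w=\mathbf a\mathbf b}A(\mathbf a)B(\mathbf b)$, with inverse $\mathsf{invmu}$ on $\mathsf{MU}$, $$\mathsf{arit}(B)(A)(\mathbf w)=\sum_{\mathbf w=\mathbf a\mathbf b\mathbf c,\ \mathbf c\ne\varnothing}A(\mathbf a\lceil\mathbf c)B(\mathbf b\rfloor)-\sum_{\mathbf w=\mathbf a\mathbf b\mathbf c,\ \mathbf a\neq\varnothing}A(\mathbf a\rceil\mathbf c)B(\lfloor\mathbf b),$$ $\mathsf{preari}(A,B)=\mathsf{arit}(B)(A)+\mathsf{mu}(A,B)$, $\mathsf{ari}(A,B)=\mathsf{preari}(A,B)-\mathsf{preari}(B,A)$, $\underline{\mathsf{ari}}(A)(B)=\mathsf{ari}(A,B)$. For $B\in\mathsf{MU}$ put $\mathsf{gari}(A,B)=\mathsf{mu}(\mathsf{garit}(B)(A),B)$ with $$\mathsf{garit}(B)(A)(\mathbf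 w)=\sum A(\lceil\mathbf b_1\rceil\cdots\lceil\mathbf b_s\rceil)\,B(\mathbf a_1\rfloor)\cdots B(\mathbf a_s\rfloor)\,\mathsf{invmu}(B)(\lfloor\mathbf c_1)\cdots\mathsf{invmu}(B)(\lfloor\mathbf c_s),$$ the sum being over all $s\ge 0$ and all $\mathbf w=\mathbf a_1\mathbf b_1\mathbf c_1\cdots\mathbf a_s\mathbf b_s\mathbf c_s$ with $\mathbf b_i\ne\varnothing$ and $\mathbf c_i\mathbf a_{i+1}\ne\varnothing$. For $S\in\mathsf{MU}$ let $\mathsf{ri}S\in\mathsf{MU}$ be the $\mathsf{gari}$-inverse of $S$, let $\mathsf{di}S\in\mathsf{LU}$ be the dilator, the unique element with $\mathsf{der}(S)=\mathsf{preari}(S,\mathsf{di}S)$, and let $\mathsf{adari}(S)(A)=\mathsf{gari}(\mathsf{preari}(S,A),\mathsf{ri}S)$ be the adjoint action of $S$ on $\mathsf{LU}$. **Theorem.** For every $S\in\mathsf{MU}$ the following identities of linear maps $\mathsf{LU}\to\mathsf{LU}$ hold: $$\mathsf{adari}(S)=\sum_{s=0}^{\infty}\sum_{r_1,\dots,r_s\ge1}\frac{1}{r_1(r_1+r_2)\cdots(r_1+\cdots+r_s)}\,\underline{\mathsf{ari}}(\mathsf{leng}_{r_1}(\mathsf{di}S))\circ\cdots\circ\underline{\mathsf{ari}}(\mathsf{leng}_{r_s}(\mathsf{di}S)),$$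 $$\mathsf{adari}(S)=\sum_{s=0}^{\infty}\sum_{r_1,\dots,r_s\ge1}\frac{(-1)^s}{r_1(r_1+r_2)\cdots(r_1+\cdots+r_s)}\,\underline{\mathsf{ari}}(\mathsf{leng}_{r_s}(\mathsf{di}\,\mathsf{ri}S))\circ\cdots\circ\underline{\mathsf{ari}}(\mathsf{leng}_{r_1}(\mathsf{di}\,\mathsf{ri}S)).$$ The $s=0$ terms are the identity, and the sums converge for the length filtration: applied to any element of $\mathsf{LU}$, only finitely many terms contribute to the component of any given length. -/

import Mathlib

namespace Flexion

noncomputable section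

/-! ### Words and flexions

A word is a finite sequence of letters `(uᵢ, vᵢ)` with `uᵢ` in an additive group `U` (upper layer)
and `vᵢ` in an additive group `V` (lower layer). -/

section Words

variable {U V : Type*}

/-- `D = [(a₁, b₁, c₁), …, (aₛ, bₛ, cₛ)]` is a decomposition `w = a₁ b₁ c₁ ⋯ aₛ bₛ cₛ` with
`bᵢ ≠ ∅` for all `i` and `cᵢ aᵢ₊₁ ≠ ∅` for `1 ≤ i < s`. -/
def IsDecomp (w : List (U × V)) (D : List (List (U × V) × List (U × V) × List (U × V))) : Prop :=
  (D.map fun t => t.1 ++ t.2.1 ++ t.2.2).flatten = w ∧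
  (∀ t ∈ D, t.2.1 ≠ []) ∧
  D.IsChain fun s t => s.2.2 ++ t.1 ≠ []

theorem finite_lists {α : Type*} {s : Set α} (hs : s.Finite) (N : ℕ) :
    {l : List α | l.length ≤ N ∧ ∀ x ∈ l, x ∈ s}.Finite := by
  induction N with
  | zero =>
    refine (Set.finite_singleton ([] : List α)).subset ?_
    rintro l ⟨h, -⟩
    simpa using h
  | succ N ih =>
    refine ((Set.finite_singleton ([] : List α)).union (hs.image2 List.cons ih)).subset ?_
    rintro l ⟨h, h'⟩
    cases l with
    | nil => simp
    | cons x l =>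
      right
      refine ⟨x, h' x (by simp), l, ⟨by simpa using h, fun y hy => h' y (by simp [hy])⟩, rfl⟩

theorem IsDecomp.length_le {w : List (U × V)}
    {D : List (List (U × V) × List (U × V) × List (U × V))} (h : IsDecomp w D) :
    D.length ≤ w.length := by
  obtain ⟨rfl, h2, -⟩ := h
  induction D with
  | nil => simp
  | cons t D ih =>
    have := ih (fun t ht => h2 t (by simp [ht]))
    have h3 : 0 < t.2.1.length := List.length_pos_iff.2 (h2 t (by simp))
    simp only [List.map_cons, List.flatten_cons, List.length_append, List.length_cons] at this ⊢
    omega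

theorem IsDecomp.sublist {w : List (U × V)}
    {D : List (List (U × V) × List (U × V) × List (U × V))} (h : IsDecomp w D)
    {t : List (U × V) × List (U × V) × List (U × V)} (ht : t ∈ D) :
    (t.1 ++ t.2.1 ++ t.2.2).Sublist w := by
  obtain ⟨rfl, -, -⟩ := h
  exact List.sublist_flatten_of_mem (List.mem_map_of_mem (f := fun t => t.1 ++ t.2.1 ++ t.2.2) ht)

theorem finite_isDecomp (w : List (U × V)) : {D | IsDecomp w D}.Finite := by
  have h0 : {l : List (U × V) | l.length ≤ w.length ∧ ∀ x ∈ l, x ∈ {x | x ∈ w}}.Finite :=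
    finite_lists (List.finite_toSet w) _
  refine (finite_lists (h0.prod (h0.prod h0)) w.length).subset ?_
  intro D hD
  refine ⟨hD.length_le, fun t ht => ?_⟩
  have key := hD.sublist ht
  have k1 := key.length_le
  simp only [List.length_append] at k1
  refine ⟨⟨by omega, fun x hx => key.subset (by simp [hx])⟩,
    ⟨by omega, fun x hx => key.subset (by simp [hx])⟩,
    ⟨by omega, fun x hx => key.subset (by simp [hx])⟩⟩

/-- The finite set of all decompositions of `w`. -/
def decomps (w : List (U × V)) : Finset (List (List (U × V) × List (U × V) × List (U × V))) :=
  (finite_isDecomp w).toFinset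

theorem mem_decomps {w : List (U × V)} {D : List (List (U × V) × List (U × V) × List (U × V))} :
    D ∈ decomps w ↔ IsDecomp w D := by
  simp [decomps]

variable [AddCommGroup U] [AddCommGroup V]

/-- The sum of the upper entries of a word. -/
def usum (b : List (U × V)) : U := (b.map Prod.fst).sum

/-- The flexion `⌈c` for a factor `b c`: `usum b` is added to the upper entry of the
first letter of `c`. -/
def ful (b : List (U × V)) : List (U × V) → List (U × V)
  | [] => []
  | x :: c => (usum b + x.1, x.2) :: c

/-- The flexion `a⌉` for a factor `a b`: `usum b` is added to the upper entry of the
last letter of `a`. -/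
def fur : List (U × V) → List (U × V) → List (U × V)
  | [], _ => []
  | [x], b => [(x.1 + usum b, x.2)]
  | x :: y :: a, b => x :: fur (y :: a) b

/-- The flexion `b⌋` for a factor `b c`: the lower entry of the first letter of `c` is
subtracted from all lower entries of `b`. -/
def flr (b : List (U × V)) : List (U × V) → List (U × V)
  | [] => b
  | y :: _ => b.map fun x => (x.1, x.2 - y.2)

/-- The flexion `⌊b` for a factor `a b`: the lower entry of the last letter of `a` is
subtracted from all lower entries of `b`. -/
def fll (a b : List (U × V)) : List (U × V) :=
  match a.getLast? with
  | none => b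
  | some y => b.map fun x => (x.1, x.2 - y.2)

variable {R : Type*} [CommRing R]

/-- `∑_{w = a b} X(a) Y(b)`. -/
def wmu (X Y : List (U × V) → R) (w : List (U × V)) : R :=
  ∑ i ∈ Finset.range (w.length + 1), X (w.take i) * Y (w.drop i)

/-- `∑_{w = a b c, c ≠ ∅} Z(a ⌈c) X(b⌋)`. -/
def wamit (X Z : List (U × V) → R) (w : List (U × V)) : R :=
  ∑ i ∈ Finset.range w.length, ∑ j ∈ Finset.range (w.length - i),
    let a := w.take i
    let b := (w.drop i).take j
    let c := w.drop (i + j)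
    Z (a ++ ful b c) * X (flr b c)

/-- `∑_{w = a b c, a ≠ ∅} Z(a⌉ c) X(⌊b)`. -/
def wanit (X Z : List (U × V) → R) (w : List (U × V)) : R :=
  ∑ i ∈ Finset.range w.length, ∑ j ∈ Finset.range (w.length - i),
    let a := w.take (i + 1)
    let b := (w.drop (i + 1)).take j
    let c := w.drop (i + 1 + j)
    Z (fur a b ++ c) * X (fll a b)

/-- The inverse for the product `wmu` of a function with value `1` on the empty word:
`N(∅) = 1` and `∑_{w = a b} N(a) X(b) = 0` for `w ≠ ∅`, solved recursively for `N(w)`. -/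
def winv (X : List (U × V) → R) (w : List (U × V)) : R :=
  if w = [] then 1 else
    - ∑ i : Fin w.length, winv X (w.take i) * X (w.drop i)
termination_by w.length
decreasing_by simp

/-- `∑ Z(⌈b₁⌉ ⋯ ⌈bₛ⌉) X(a₁⌋) ⋯ X(aₛ⌋) Y(⌊c₁) ⋯ Y(⌊cₛ)`, the sum being over all decompositions
`w = a₁ b₁ c₁ ⋯ aₛ bₛ cₛ`. -/
def wgaxit (X Y Z : List (U × V) → R) (w : List (U × V)) : R :=
  ∑ D ∈ decomps w,
    Z (D.map fun t => ful t.1 (fur t.2.1 t.2.2)).flatten *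
      (D.map fun t => X (flr t.1 t.2.1)).prod * (D.map fun t => Y (fll t.2.1 t.2.2)).prod

end Words

/-! ### Decks and bimoulds -/

/-- An integral matrix with a right inverse. Its rows are then part of a basis of `ℤⁿ`. -/
def IsSplit {r n : ℕ} (P : Matrix (Fin r) (Fin n) ℤ) : Prop :=
  ∃ P' : Matrix (Fin n) (Fin r) ℤ, P * P' = 1

/-- A deck over `K`: for every `r` a commutative `K`-algebra `F r` of "functions of
`(u₁, …, uᵣ; v₁, …, vᵣ)`", together with the substitutions
`uᵢ ↦ ∑ⱼ Pᵢⱼ uⱼ`, `vᵢ ↦ ∑ⱼ Qᵢⱼ vⱼ` for all pairs of integral matrices whose rows are parts of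
bases of `ℤⁿ`. -/
structure Deck (K : Type*) [Field K] where
  F : ℕ → Type*
  [commRing : ∀ r, CommRing (F r)]
  [algebra : ∀ r, Algebra K (F r)]
  subst : ∀ {r n : ℕ} (P Q : Matrix (Fin r) (Fin n) ℤ), IsSplit P → IsSplit Q → (F r →ₐ[K] F n)
  subst_one : ∀ (r : ℕ) (h h' : IsSplit (1 : Matrix (Fin r) (Fin r) ℤ)),
    subst 1 1 h h' = AlgHom.id K (F r)
  subst_mul : ∀ {r n m : ℕ} (P Q : Matrix (Fin r) (Fin n) ℤ) (P' Q' : Matrix (Fin n) (Fin m) ℤ)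
    (hP : IsSplit P) (hQ : IsSplit Q) (hP' : IsSplit P') (hQ' : IsSplit Q')
    (h : IsSplit (P * P')) (h' : IsSplit (Q * Q')),
    subst (P * P') (Q * Q') h h' = (subst P' Q' hP' hQ').comp (subst P Q hP hQ)

attribute [instance] Deck.commRing Deck.algebra

variable {K : Type*} [Field K]

/-- A bimould: one function of `(u₁, …, uᵣ; v₁, …, vᵣ)` for every length `r`. -/
abbrev Bimould (F : Deck K) : Type _ := ∀ r, F.F r

/-- Words whose letters are pairs of integral linear forms, in `u₁, …, uₙ` and in
`v₁, …, vₙ` respectively. -/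
abbrev Word (n : ℕ) : Type := List ((Fin n → ℤ) × (Fin n → ℤ))

/-- The coefficient matrix of the upper entries of a word. -/
def umat {n : ℕ} (w : Word n) : Matrix (Fin w.length) (Fin n) ℤ := Matrix.of fun i => (w.get i).1

/-- The coefficient matrix of the lower entries of a word. -/
def vmat {n : ℕ} (w : Word n) : Matrix (Fin w.length) (Fin n) ℤ := Matrix.of fun i => (w.get i).2

/-- The word `w₁ ⋯ wᵣ` in the variables `wᵢ = (uᵢ, vᵢ)`. -/
def gen (r : ℕ) : Word r := List.ofFn fun i => (Pi.single i 1, Pi.single i 1)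

section Operations

variable {F : Deck K}

open Classical in
/-- The value `M(w)` of a bimould at a word of linear forms, obtained by substitution. The default
value `0` is never used below: all words obtained from `gen r` by taking factors and
flexions consist of linear forms that are part of a basis (in either layer). -/
def Bimould.val (M : Bimould F) {n : ℕ} (w : Word n) : F.F n :=
  if h : IsSplit (umat w) ∧ IsSplit (vmat w) then F.subst (umat w) (vmat w) h.1 h.2 (M w.length)
  else 0

/-- The product of bimoulds. -/
def mu (A B : Bimould F) : Bimould F := fun r => wmu A.val B.val (gen r)

/-- `amit(B)(A)`. -/
def amit (B A : Bimould F) : Bimould F := fun r => wamit B.val A.val (gen r)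

/-- `anit(B)(A)`. -/
def anit (B A : Bimould F) : Bimould F := fun r => wanit B.val A.val (gen r)

/-- `arit(B)(A)`. -/
def arit (B A : Bimould F) : Bimould F := amit B A - anit B A

/-- The pre-Lie operation `preari`. -/
def preari (A B : Bimould F) : Bimould F := arit B A + mu A B

/-- The bracket `ari`. -/
def ari (A B : Bimould F) : Bimould F := preari A B - preari B A

/-- The `mu`-inverse of a bimould with value `1` at length `0`. -/
def invmu (B : Bimould F) : Bimould F := fun r => winv B.val (gen r)

/-- `gaxit(A, B)(C)`. -/
def gaxit (A B C : Bimould F) : Bimould F := fun r => wgaxit A.val B.val C.val (gen r)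

/-- `garit(B)(A) = gaxit(B, invmu B)(A)`. -/
def garit (B A : Bimould F) : Bimould F := gaxit B (invmu B) A

/-- The product `gari`. -/
def gari (A B : Bimould F) : Bimould F := mu (garit B A) B

/-- The derivation multiplying the component of length `r` by `r`. -/
def der (A : Bimould F) : Bimould F := fun r => r • A r

variable (F) in
/-- The unit bimould. -/
def unit : Bimould F := Pi.single 0 1

variable (F) in
/-- Bimoulds with value `1` at length `0`. -/
def MU : Set (Bimould F) := {S | S 0 = 1}

variable (F) in
/-- Bimoulds with value `0` at length `0`. -/
def LU : Submodule K (Bimould F) where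
  carrier := {A | A 0 = 0}
  zero_mem' := rfl
  add_mem' := fun {a b} (ha : a 0 = 0) (hb : b 0 = 0) => by simp [ha, hb]
  smul_mem' := fun c a (ha : a 0 = 0) => by simp [ha]

/-! Basic facts: linearity, locality in the length, values at length `0`. -/

theorem gen_length (r : ℕ) : (gen r).length = r := by simp [gen]

theorem isSplit_one (r : ℕ) : IsSplit (1 : Matrix (Fin r) (Fin r) ℤ) := ⟨1, by simp⟩

theorem val_congr {M N : Bimould F} {n : ℕ} (w : Word n) (h : M w.length = N w.length) :
    M.val w = N.val w := by
  simp only [Bimould.val, h]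

theorem val_add (M N : Bimould F) {n : ℕ} (w : Word n) : (M + N).val w = M.val w + N.val w := by
  unfold Bimould.val; split_ifs <;> simp

theorem val_smul (c : K) (M : Bimould F) {n : ℕ} (w : Word n) : (c • M).val w = c • M.val w := by
  unfold Bimould.val; split_ifs <;> simp

theorem val_eq_of_length (M : Bimould F) {r n : ℕ} (w : Word n) (hr : w.length = r)
    (P Q : Matrix (Fin r) (Fin n) ℤ) (hP : IsSplit P) (hQ : IsSplit Q)
    (h1 : ∀ i : Fin r, (w.get (i.cast hr.symm)).1 = P i)
    (h2 : ∀ i : Fin r, (w.get (i.cast hr.symm)).2 = Q i) :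
    M.val w = F.subst P Q hP hQ (M r) := by
  subst hr
  obtain rfl : umat w = P := by ext i j; exact congrFun (h1 i) j
  obtain rfl : vmat w = Q := by ext i j; exact congrFun (h2 i) j
  simp [Bimould.val, hP, hQ]

theorem val_gen (M : Bimould F) (r : ℕ) : M.val (gen r) = M r := by
  rw [val_eq_of_length M (gen r) (gen_length r) 1 1 (isSplit_one r) (isSplit_one r), F.subst_one]
  · rfl
  · intro i; ext j; simp [gen, Matrix.one_apply, Pi.single_apply, Fin.ext_iff, eq_comm (a := (j : ℕ))]; rfl
  · intro i; ext j; simp [gen, Matrix.one_apply, Pi.single_apply, Fin.ext_iff, eq_comm (a := (j : ℕ))]; rfl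

theorem isSplit_nil {n : ℕ} (P : Matrix (Fin 0) (Fin n) ℤ) : IsSplit P :=
  ⟨0, Subsingleton.elim _ _⟩

theorem val_nil_of_eq_one {M : Bimould F} (h : M 0 = 1) (n : ℕ) :
    M.val ([] : Word n) = 1 := by
  rw [val_eq_of_length M (r := 0) [] rfl (umat []) (vmat []) (isSplit_nil _) (isSplit_nil _)
    (fun i => i.elim0) (fun i => i.elim0), h, map_one]

theorem val_nil_of_eq_zero {M : Bimould F} (h : M 0 = 0) (n : ℕ) :
    M.val ([] : Word n) = 0 := by
  rw [val_eq_of_length M (r := 0) [] rfl (umat []) (vmat []) (isSplit_nil _) (isSplit_nil _)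
    (fun i => i.elim0) (fun i => i.elim0), h, map_zero]

theorem mu_add_left (A A' B : Bimould F) : mu (A + A') B = mu A B + mu A' B := by
  ext r; simp [mu, wmu, val_add, add_mul, Finset.sum_add_distrib]

theorem mu_smul_left (c : K) (A B : Bimould F) : mu (c • A) B = c • mu A B := by
  ext r; simp [mu, wmu, val_smul, Finset.smul_sum]

theorem mu_add_right (A B B' : Bimould F) : mu A (B + B') = mu A B + mu A B' := by
  ext r; simp [mu, wmu, val_add, mul_add, Finset.sum_add_distrib]

theorem mu_smul_right (c : K) (A B : Bimould F) : mu A (c • B) = c • mu A B := by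
  ext r; simp [mu, wmu, val_smul, Finset.smul_sum]

theorem arit_add_left (B B' A : Bimould F) : arit (B + B') A = arit B A + arit B' A := by
  ext r
  simp only [arit, amit, anit, wamit, wanit, val_add, mul_add, Finset.sum_add_distrib,
    Pi.add_apply, Pi.sub_apply]
  ring

theorem arit_smul_left (c : K) (B A : Bimould F) : arit (c • B) A = c • arit B A := by
  ext r; simp [arit, amit, anit, wamit, wanit, val_smul, Finset.smul_sum, smul_sub]

theorem arit_add_right (B A A' : Bimould F) : arit B (A + A') = arit B A + arit B A' := by
  ext r
  simp only [arit, amit, anit, wamit, wanit, val_add, add_mul, Finset.sum_add_distrib,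
    Pi.add_apply, Pi.sub_apply]
  ring

theorem arit_smul_right (c : K) (B A : Bimould F) : arit B (c • A) = c • arit B A := by
  ext r; simp [arit, amit, anit, wamit, wanit, val_smul, Finset.smul_sum, smul_sub]

theorem preari_add_right (A B B' : Bimould F) :
    preari A (B + B') = preari A B + preari A B' := by
  simp only [preari, arit_add_left, mu_add_right]; abel

theorem preari_smul_right (c : K) (A B : Bimould F) : preari A (c • B) = c • preari A B := by
  simp only [preari, arit_smul_left, mu_smul_right, smul_add]

theorem preari_add_left (A A' B : Bimould F) :
    preari (A + A') B = preari A B + preari A' B := by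
  simp only [preari, arit_add_right, mu_add_left]; abel

theorem preari_smul_left (c : K) (A B : Bimould F) : preari (c • A) B = c • preari A B := by
  simp only [preari, arit_smul_right, mu_smul_left, smul_add]

theorem garit_add (B A A' : Bimould F) : garit B (A + A') = garit B A + garit B A' := by
  ext r; simp [garit, gaxit, wgaxit, val_add, add_mul, Finset.sum_add_distrib]

theorem garit_smul (c : K) (B A : Bimould F) : garit B (c • A) = c • garit B A := by
  ext r; simp [garit, gaxit, wgaxit, val_smul, Finset.smul_sum]

theorem gari_add_left (A A' B : Bimould F) : gari (A + A') B = gari A B + gari A' B := by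
  simp only [gari, garit_add, mu_add_left]

theorem gari_smul_left (c : K) (A B : Bimould F) : gari (c • A) B = c • gari A B := by
  simp only [gari, garit_smul, mu_smul_left]

theorem arit_zero_length (B A : Bimould F) : arit B A 0 = 0 := by
  simp [arit, amit, anit, wamit, wanit, gen]

theorem mu_zero_length (A B : Bimould F) : mu A B 0 = A 0 * B 0 := by
  have h : ([] : Word 0) = gen 0 := by simp [gen]
  rw [← val_gen A 0, ← val_gen B 0, ← h]
  simp [mu, wmu, gen]

theorem garit_zero_length (B A : Bimould F) : garit B A 0 = A 0 := by
  have h : ([] : Word 0) = gen 0 := by simp [gen]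
  have h2 : decomps ([] : Word 0) = {[]} := by
    ext D
    rw [mem_decomps, Finset.mem_singleton]
    constructor
    · intro hD; simpa using hD.length_le
    · rintro rfl; simp [IsDecomp]
  rw [← val_gen A 0, garit, gaxit, ← h, wgaxit, h2]
  simp

theorem preari_mem_LU (A : Bimould F) {B : Bimould F} (hB : B ∈ LU F) : preari A B ∈ LU F := by
  change preari A B 0 = 0
  have hB' : B 0 = 0 := hB
  simp [preari, arit_zero_length, mu_zero_length, hB']

theorem gari_mem_LU {A : Bimould F} (hA : A ∈ LU F) (B : Bimould F) : gari A B ∈ LU F := by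
  change gari A B 0 = 0
  have hA' : A 0 = 0 := hA
  simp [gari, mu_zero_length, garit_zero_length, hA']

/-- A map on sequences whose value at `r` depends only on the entries before `r` has a unique
fixed point. -/
theorem existsUnique_fixed {X : ℕ → Type*} [∀ r, Zero (X r)] (Φ : (∀ r, X r) → ∀ r, X r)
    (h : ∀ D D' r, (∀ k < r, D k = D' k) → Φ D r = Φ D' r) : ∃! D, Φ D = D := by
  have step : ∀ n, ∃ D : ∀ r, X r, ∀ r < n, Φ D r = D r := by
    intro n
    induction n with
    | zero => exact ⟨fun _ => 0, by simp⟩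
    | succ n ih =>
      obtain ⟨D, hD⟩ := ih
      refine ⟨Φ D, fun r hr => h _ _ _ fun k hk => hD k (by omega)⟩
  choose D hD using step
  have uniq : ∀ (A B : ∀ r, X r) (n : ℕ), (∀ r < n, Φ A r = A r) → (∀ r < n, Φ B r = B r) →
      ∀ r < n, A r = B r := by
    intro A B n hA hB r
    induction r using Nat.strong_induction_on with
    | _ r ih =>
      intro hr
      rw [← hA r hr, ← hB r hr]
      exact h _ _ _ fun k hk => ih k hk (by omega)
  refine ⟨fun r => D (r + 1) r, ?_, ?_⟩
  · ext r
    rw [← hD (r + 1) r (by omega)]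
    refine h _ _ _ fun k hk => ?_
    exact uniq _ _ (k + 1) (hD _) (fun j hj => hD _ j (by omega)) k (by omega)
  · intro E hE
    ext r
    exact uniq _ _ (r + 1) (fun j _ => congrFun hE j) (hD _) r (by omega)

theorem ful_length {U V : Type*} [AddCommGroup U] [AddCommGroup V] (b c : List (U × V)) :
    (ful b c).length = c.length := by
  cases c <;> simp [ful]

theorem flr_length {U V : Type*} [AddCommGroup U] [AddCommGroup V] (b c : List (U × V)) :
    (flr b c).length = b.length := by
  cases c <;> simp [flr]

theorem fll_length {U V : Type*} [AddCommGroup U] [AddCommGroup V] (a b : List (U × V)) :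
    (fll a b).length = b.length := by
  unfold fll; split <;> simp

theorem arit_congr_left {D D' : Bimould F} (S : Bimould F) (r : ℕ) (h : ∀ k < r, D k = D' k) :
    arit D S r = arit D' S r := by
  simp only [arit, amit, anit, wamit, wanit, Pi.sub_apply, gen_length]
  congr 1 <;>
  · refine Finset.sum_congr rfl fun i hi => Finset.sum_congr rfl fun j hj => ?_
    simp only [Finset.mem_range] at hi hj
    congr 1
    refine val_congr _ (h _ ?_)
    simp only [flr_length, fll_length, List.length_take, List.length_drop, gen_length]
    omega

theorem mu_eq_first_add (A B : Bimould F) (r : ℕ) :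
    mu A B r = A.val ([] : Word r) * B r +
      ∑ i ∈ Finset.range r, A.val ((gen r).take (i + 1)) * B.val ((gen r).drop (i + 1)) := by
  rw [mu, wmu, Finset.sum_range_succ', add_comm, gen_length]
  simp [val_gen]

/-- Existence and uniqueness of the `gari`-dilator. -/
theorem existsUnique_dilator (S : MU F) :
    ∃! D : LU F, der (S : Bimould F) = preari (S : Bimould F) (D : Bimould F) := by
  obtain ⟨S, hS⟩ := S
  have hS' : S 0 = 1 := hS
  obtain ⟨D, hD, huniq⟩ := existsUnique_fixed (X := F.F) (fun D r => r • S r - arit D S r -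
    ∑ i ∈ Finset.range r, S.val ((gen r).take (i + 1)) * Bimould.val D ((gen r).drop (i + 1))) (by
      intro D D' r h
      rw [arit_congr_left S r h]
      congr 1
      refine Finset.sum_congr rfl fun i hi => ?_
      congr 1
      refine val_congr _ (h _ ?_)
      simp only [Finset.mem_range] at hi
      simp only [List.length_drop, gen_length]
      omega)
  have key : ∀ E : Bimould F, der S = preari S E ↔ (fun r => r • S r - arit E S r -
      ∑ i ∈ Finset.range r, S.val ((gen r).take (i + 1)) * Bimould.val E ((gen r).drop (i + 1)))
      = E := by
    intro E
    rw [funext_iff, funext_iff]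
    refine forall_congr' fun r => ?_
    simp only [der, preari, Pi.add_apply, mu_eq_first_add, val_nil_of_eq_one hS', one_mul]
    constructor
    · intro h; linear_combination h
    · intro h; linear_combination h
  refine ⟨⟨D, ?_⟩, (key D).2 hD, ?_⟩
  · change D 0 = 0
    rw [← hD]
    simp [arit_zero_length]
  · rintro ⟨E, hE⟩ h
    exact Subtype.ext (huniq E ((key E).1 h))

/-- The `gari`-dilator of `S`: the element `D` of `LU` with `der S = preari(S, D)`. -/
def di (S : MU F) : LU F := (existsUnique_dilator S).choose

theorem di_spec (S : MU F) : der S.1 = preari S.1 (di S).1 :=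
  (existsUnique_dilator S).choose_spec.1

theorem winv_congr {n : ℕ} {X Y : Word n → F.F n} (w : Word n)
    (h : ∀ v : Word n, v.length ≤ w.length → X v = Y v) : winv X w = winv Y w := by
  induction hn : w.length using Nat.strong_induction_on generalizing w with
  | _ m ih =>
    rw [winv, winv]
    split_ifs with h0
    · rfl
    · congr 1
      refine Finset.sum_congr rfl fun i _ => ?_
      have hi := i.2
      rw [h (w.drop i) (by simp)]
      congr 1
      refine ih (w.take i).length (by simp; omega) _ (fun v hv => h v ?_) rfl
      exact hv.trans (by simp)

theorem garit_congr_left {T T' : Bimould F} (S : Bimould F) (r : ℕ) (h : ∀ k < r, T k = T' k) :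
    garit T S r = garit T' S r := by
  have hinv : ∀ k < r, invmu T k = invmu T' k := by
    intro k hk
    refine winv_congr _ fun v hv => val_congr _ (h _ ?_)
    rw [gen_length] at hv
    omega
  simp only [garit, gaxit, wgaxit]
  refine Finset.sum_congr rfl fun D hD => ?_
  rw [mem_decomps] at hD
  have hlen : ∀ t ∈ D, t.1.length < r ∧ t.2.2.length < r := by
    intro t ht
    have h1 := (hD.sublist ht).length_le
    have h2 : 0 < t.2.1.length := List.length_pos_iff.2 (hD.2.1 t ht)
    simp only [List.length_append, gen_length] at h1
    omega
  have e1 : (D.map fun t => T.val (flr t.1 t.2.1)) = D.map fun t => T'.val (flr t.1 t.2.1) := by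
    refine List.map_congr_left fun t ht => val_congr _ (h _ ?_)
    rw [flr_length]; exact (hlen t ht).1
  have e2 : (D.map fun t => (invmu T).val (fll t.2.1 t.2.2)) =
      D.map fun t => (invmu T').val (fll t.2.1 t.2.2) := by
    refine List.map_congr_left fun t ht => val_congr _ (hinv _ ?_)
    rw [fll_length]; exact (hlen t ht).2
  rw [e1, e2]

/-- Existence and uniqueness of the `gari`-inverse, as a right inverse. -/
theorem existsUnique_gari_inverse (S : MU F) :
    ∃! T : MU F, gari (S : Bimould F) (T : Bimould F) = unit F := by
  obtain ⟨S, hS⟩ := S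
  have hS' : S 0 = 1 := hS
  obtain ⟨T, hT, huniq⟩ := existsUnique_fixed (X := F.F) (fun T r => unit F r -
    ∑ i ∈ Finset.range r,
      Bimould.val (garit T S) ((gen r).take (i + 1)) * Bimould.val T ((gen r).drop (i + 1))) (by
      intro T T' r h
      congr 1
      refine Finset.sum_congr rfl fun i hi => ?_
      simp only [Finset.mem_range] at hi
      congr 1
      · refine val_congr _ (garit_congr_left S _ fun k hk => h k ?_)
        simp only [List.length_take, gen_length] at hk
        omega
      · refine val_congr _ (h _ ?_)
        simp only [List.length_drop, gen_length]
        omega)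
  have key : ∀ E : Bimould F, gari S E = unit F ↔ (fun r => unit F r -
      ∑ i ∈ Finset.range r,
        Bimould.val (garit E S) ((gen r).take (i + 1)) * Bimould.val E ((gen r).drop (i + 1)))
      = E := by
    intro E
    have h0 : garit E S 0 = 1 := by rw [garit_zero_length, hS']
    rw [funext_iff, funext_iff]
    refine forall_congr' fun r => ?_
    simp only [gari, mu_eq_first_add, val_nil_of_eq_one h0, one_mul]
    constructor
    · intro h; linear_combination -h
    · intro h; linear_combination -h
  refine ⟨⟨T, ?_⟩, (key T).2 hT, ?_⟩
  · change T 0 = 1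
    rw [← hT]
    simp [unit]
  · rintro ⟨E, hE⟩ h
    exact Subtype.ext (huniq E ((key E).1 h))

/-- The `gari`-inverse of `S`. -/
def ri (S : MU F) : MU F := (existsUnique_gari_inverse S).choose

theorem ri_spec (S : MU F) : gari S.1 (ri S).1 = unit F :=
  (existsUnique_gari_inverse S).choose_spec.1

/-- The component of length `k` of an element of `LU`. -/
def leng (k : ℕ) (A : LU F) : LU F :=
  ⟨Pi.single k (A.1 k), by
    change (Pi.single k (A.1 k) : Bimould F) 0 = 0
    have hA : A.1 0 = 0 := A.2
    rcases Nat.eq_zero_or_pos k with rfl | hk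
    · simpa using hA
    · exact Pi.single_eq_of_ne hk.ne _⟩

/-- The operator `B ↦ ari(A, B)` on `LU`. -/
def uari (A : LU F) : Module.End K (LU F) where
  toFun B := ⟨ari A.1 B.1, sub_mem (preari_mem_LU _ B.2) (preari_mem_LU _ A.2)⟩
  map_add' B C := by
    ext1
    simp only [ari, Submodule.coe_add, preari_add_right, preari_add_left]
    abel
  map_smul' c B := by
    ext1
    simp only [ari, Submodule.coe_smul, preari_smul_right, preari_smul_left, smul_sub,
      RingHom.id_apply]

/-- The adjoint action of `S` on `LU`: `A ↦ gari(preari(S, A), ri S)`. This is the coefficient of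
`ε` in `gari(gari(S, 1 + ε A), ri S)`, because `gari(S, 1 + ε A) = S + ε preari(S, A)` modulo `ε²`
and `gari` is linear in its first argument. -/
def adari (S : MU F) : Module.End K (LU F) where
  toFun A := ⟨gari (preari S.1 A.1) (ri S).1, gari_mem_LU (preari_mem_LU _ A.2) _⟩
  map_add' A B := by
    ext1
    simp only [Submodule.coe_add, preari_add_right, gari_add_left]
  map_smul' c A := by
    ext1
    simp only [Submodule.coe_smul, preari_smul_right, gari_smul_left, RingHom.id_apply]

/-- `T = ∑ᵢ Tᵢ` as operators on `LU`, with respect to the length filtration: for every `A` in `LU`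
and every `n`, only finitely many `Tᵢ(A)` have a nonzero component of length `n`, and
these components add up to that of `T(A)`. -/
def HasOperatorSum {ι : Type*} (Ti : ι → Module.End K (LU F)) (T : Module.End K (LU F)) : Prop :=
  ∀ (A : LU F) (n : ℕ), (Function.support fun i => (Ti i A).1 n).Finite ∧
    ∑ᶠ i, (Ti i A).1 n = (T A).1 n

end Operations

/-- `1 / (r₁ (r₁ + r₂) ⋯ (r₁ + ⋯ + rₛ))`. -/
def coeff (K : Type*) [Field K] {s : ℕ} (r : Fin s → ℕ+) : K :=
  1 / ∏ j : Fin s, ∑ i ∈ Finset.Iic j, ((r i : ℕ) : K)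

/-! ### The deck of rational functions -/

section Rational

/-- The substitution `xᵢ ↦ ∑ⱼ Pᵢⱼ xⱼ`, `yᵢ ↦ ∑ⱼ Qᵢⱼ yⱼ` on polynomials in two layers of
variables. -/
def polySubst (K : Type*) [Field K] {r n : ℕ} (P Q : Matrix (Fin r) (Fin n) ℤ) :
    MvPolynomial (Fin r ⊕ Fin r) K →ₐ[K] MvPolynomial (Fin n ⊕ Fin n) K :=
  MvPolynomial.aeval (Sum.elim
    (fun i => ∑ j, (P i j : MvPolynomial (Fin n ⊕ Fin n) K) * MvPolynomial.X (Sum.inl j))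
    (fun i => ∑ j, (Q i j : MvPolynomial (Fin n ⊕ Fin n) K) * MvPolynomial.X (Sum.inr j)))

theorem polySubst_mul {r n m : ℕ} (P Q : Matrix (Fin r) (Fin n) ℤ)
    (P' Q' : Matrix (Fin n) (Fin m) ℤ) :
    polySubst K (P * P') (Q * Q') = (polySubst K P' Q').comp (polySubst K P Q) := by
  refine MvPolynomial.algHom_ext fun i => ?_
  rcases i with i | i <;>
  · simp only [polySubst, MvPolynomial.aeval_X, Sum.elim_inl, Sum.elim_inr, AlgHom.comp_apply,
      map_sum, map_mul, map_intCast, Matrix.mul_apply, Int.cast_sum, Int.cast_mul, Finset.sum_mul,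
      Finset.mul_sum]
    rw [Finset.sum_comm]
    simp only [mul_assoc]

theorem polySubst_one (r : ℕ) :
    polySubst K (1 : Matrix (Fin r) (Fin r) ℤ) 1 = AlgHom.id K _ := by
  refine MvPolynomial.algHom_ext fun i => ?_
  rcases i with i | i <;>
  simp [polySubst, Matrix.one_apply]

theorem polySubst_injective {r n : ℕ} {P Q : Matrix (Fin r) (Fin n) ℤ} (hP : IsSplit P)
    (hQ : IsSplit Q) : Function.Injective (polySubst K P Q) := by
  obtain ⟨P', hP'⟩ := hP
  obtain ⟨Q', hQ'⟩ := hQ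
  have h := polySubst_mul (K := K) P Q P' Q'
  rw [hP', hQ', polySubst_one] at h
  exact Function.LeftInverse.injective (g := polySubst K P' Q') fun x =>
    (DFunLike.congr_fun h x).symm

theorem ratSubst_injective {r n : ℕ} {P Q : Matrix (Fin r) (Fin n) ℤ} (hP : IsSplit P)
    (hQ : IsSplit Q) : Function.Injective
      ((IsScalarTower.toAlgHom K (MvPolynomial (Fin n ⊕ Fin n) K)
        (FractionRing (MvPolynomial (Fin n ⊕ Fin n) K))).comp (polySubst K P Q)) :=
  (IsFractionRing.injective (MvPolynomial (Fin n ⊕ Fin n) K)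
    (FractionRing (MvPolynomial (Fin n ⊕ Fin n) K))).comp (polySubst_injective hP hQ)

/-- The substitution on rational functions. -/
def ratSubst {r n : ℕ} (P Q : Matrix (Fin r) (Fin n) ℤ) (hP : IsSplit P) (hQ : IsSplit Q) :
    FractionRing (MvPolynomial (Fin r ⊕ Fin r) K) →ₐ[K]
      FractionRing (MvPolynomial (Fin n ⊕ Fin n) K) :=
  IsFractionRing.liftAlgHom (ratSubst_injective (K := K) hP hQ)

theorem ratSubst_algebraMap {r n : ℕ} (P Q : Matrix (Fin r) (Fin n) ℤ) (hP : IsSplit P)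
    (hQ : IsSplit Q) (x : MvPolynomial (Fin r ⊕ Fin r) K) :
    ratSubst (K := K) P Q hP hQ (algebraMap _ _ x) = algebraMap _ _ (polySubst K P Q x) := by
  rw [ratSubst, IsFractionRing.liftAlgHom_apply, IsFractionRing.lift_algebraMap]
  rfl

theorem ratAlgHom_ext {r : ℕ} {L : Type*} [Field L] [Algebra K L]
    {f g : FractionRing (MvPolynomial (Fin r ⊕ Fin r) K) →ₐ[K] L}
    (h : ∀ x : MvPolynomial (Fin r ⊕ Fin r) K, f (algebraMap _ _ x) = g (algebraMap _ _ x)) :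
    f = g := by
  refine AlgHom.coe_ringHom_injective ?_
  exact IsLocalization.ringHom_ext (nonZeroDivisors (MvPolynomial (Fin r ⊕ Fin r) K))
    (RingHom.ext h)

/-- The deck of rational functions: `F r = K(u₁, …, uᵣ, v₁, …, vᵣ)`. -/
def rationalDeck (K : Type*) [Field K] : Deck K where
  F r := FractionRing (MvPolynomial (Fin r ⊕ Fin r) K)
  subst P Q hP hQ := ratSubst P Q hP hQ
  subst_one r h h' := ratAlgHom_ext fun x => by
    rw [ratSubst_algebraMap, polySubst_one]; rfl
  subst_mul P Q P' Q' hP hQ hP' hQ' h h' := ratAlgHom_ext fun x => by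
    rw [ratSubst_algebraMap, polySubst_mul, AlgHom.comp_apply, AlgHom.comp_apply,
      ratSubst_algebraMap, ratSubst_algebraMap]

end Rational

end

end Flexion

/-! ### The ring of functions on words -/

namespace Flexion

noncomputable section

set_option linter.unusedSectionVars false

/-! Write `Y = ri S`, `E = di (ri S)`, `D = di S`, and let an index `r` denote the component of
length `r`. The theorem is about linear differential equations in which the length plays the role of
the exponent and `der` that of `t d/dt`. Two identities carry it. By `preari_preari_sub`, the
operators `rop A : X ↦ preari(X, A)` satisfy `rop(ari(D, A)) = [rop A, rop D]`. By `der_gari`, `der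
Y = preari(Y, E)` implies `der(gari(X, Y)) = gari(der X, Y) + preari(gari(X, Y), E)`; so the degree
parts `P m` of `X ↦ gari(X, Y)` satisfy `m P m = ∑ rop(E_r) P (m - r)`.

Let `C 0 = 1` and `m C m = -∑ ad(E_r) C (m - r)`. Unfolding this recursion gives the second series.
The operators `ρ m = rop(C m A)` satisfy `m ρ m = ∑ [rop(E_r), ρ (m - r)]`. Uniqueness of solutions
then gives `P ∘ rop A = rop(C A) ∘ P`, where `P`, `C` are the sums over all degrees. At `S`, where
`P S = gari(S, Y)` is the unit, this reads `adari(S)(A) = preari(1, C A) = C A`, the second formula.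

For the first formula, the same uniqueness gives `C ∘ ad A = ad(C A) ∘ C`, and applying `der` to
`gari(S, Y) = 1` gives `E = -C D`. Together they turn the recursion into `m C m = ∑ C (m - r)
ad(D_r)`, which unfolds to the first series. Only the right inverse property of `ri S` enters.

The two identities are proved for functions on words, a ring under the deconcatenation product.
There `arit(E)` is a derivation and `garit(Y)` a ring endomorphism. Both are local and therefore
determined by their values on the functions `dir v` (`eq_zero_of_dir`): `arit(E)` sends `dir v` to
its commutator with the translate `tau v E`, and `garit(Y)` conjugates it by `tau v Y`. Each
identity thus reduces to a short computation on `dir v`. Bimoulds are linked to such functions by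
naturality under substitutions, on words whose two layers are independent. -/

/-- Functions on words, a ring under the product dual to deconcatenation. -/
@[ext]
structure WordFun (U V R : Type*) where
  toFun : List (U × V) → R

namespace WordFun

variable {U V R : Type*} [AddCommGroup U] [AddCommGroup V] [CommRing R]

instance : CoeFun (WordFun U V R) fun _ => List (U × V) → R := ⟨toFun⟩

@[simp] theorem mk_apply (f : List (U × V) → R) (w : List (U × V)) : (⟨f⟩ : WordFun U V R) w = f w :=
  rfl

theorem toFun_injective : Function.Injective (toFun : WordFun U V R → List (U × V) → R) :=
  fun _ _ h => WordFun.ext h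

instance : Zero (WordFun U V R) := ⟨⟨0⟩⟩
instance : Add (WordFun U V R) := ⟨fun A B => ⟨fun w => A w + B w⟩⟩
instance : Neg (WordFun U V R) := ⟨fun A => ⟨fun w => -A w⟩⟩
instance : Sub (WordFun U V R) := ⟨fun A B => ⟨fun w => A w - B w⟩⟩
instance {S : Type*} [SMul S R] : SMul S (WordFun U V R) := ⟨fun c A => ⟨fun w => c • A w⟩⟩

instance : AddCommGroup (WordFun U V R) :=
  toFun_injective.addCommGroup _ rfl (fun _ _ => rfl) (fun _ => rfl) (fun _ _ => rfl)
    (fun _ _ => rfl) (fun _ _ => rfl)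

/-- The underlying function, as an additive map. -/
def toFunHom : WordFun U V R →+ (List (U × V) → R) where
  toFun := toFun
  map_zero' := rfl
  map_add' _ _ := rfl

instance : Module R (WordFun U V R) :=
  toFun_injective.module R toFunHom fun _ _ => rfl

@[simp] theorem add_apply (A B : WordFun U V R) (w : List (U × V)) : (A + B) w = A w + B w := rfl
@[simp] theorem sub_apply (A B : WordFun U V R) (w : List (U × V)) : (A - B) w = A w - B w := rfl
@[simp] theorem zero_apply (w : List (U × V)) : (0 : WordFun U V R) w = 0 := rfl
@[simp] theorem smul_apply (c : R) (A : WordFun U V R) (w : List (U × V)) :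
    (c • A) w = c * A w := rfl

theorem sum_apply {ι : Type*} (s : Finset ι) (f : ι → WordFun U V R) (w : List (U × V)) :
    (∑ i ∈ s, f i) w = ∑ i ∈ s, f i w := by
  have h := congrFun (map_sum (toFunHom (U := U) (V := V) (R := R)) f s) w
  rw [Finset.sum_apply] at h
  exact h

/-- The function `w ↦ A(x w)`. -/
def tail (x : U × V) (A : WordFun U V R) : WordFun U V R := ⟨fun w => A (x :: w)⟩

@[simp] theorem tail_apply (x : U × V) (A : WordFun U V R) (w : List (U × V)) :
    tail x A w = A (x :: w) := rfl

instance : Mul (WordFun U V R) := ⟨fun A B => ⟨wmu A B⟩⟩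

theorem mul_apply (A B : WordFun U V R) (w : List (U × V)) :
    (A * B) w = ∑ i ∈ Finset.range (w.length + 1), A (w.take i) * B (w.drop i) := rfl

theorem mul_nil (A B : WordFun U V R) : (A * B) [] = A [] * B [] := by
  simp [mul_apply]

theorem mul_cons (A B : WordFun U V R) (x : U × V) (w : List (U × V)) :
    (A * B) (x :: w) = A [] * B (x :: w) + (tail x A * B) w := by
  rw [mul_apply, Finset.sum_range_succ', add_comm]
  simp [mul_apply]

/-- `tail x` is a derivation twisted by the value at the empty word; this lets identities between
products be proved by removing first letters. -/
theorem tail_mul (A B : WordFun U V R) (x : U × V) :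
    tail x (A * B) = A [] • tail x B + tail x A * B := by
  ext w
  simp [mul_cons]

instance : One (WordFun U V R) := ⟨⟨fun w => if w.isEmpty then 1 else 0⟩⟩

@[simp] theorem one_nil : (1 : WordFun U V R) [] = 1 := rfl
@[simp] theorem one_cons (x : U × V) (w : List (U × V)) : (1 : WordFun U V R) (x :: w) = 0 := rfl
@[simp] theorem tail_one (x : U × V) : tail x (1 : WordFun U V R) = 0 := rfl

theorem add_mul' (A B C : WordFun U V R) : (A + B) * C = A * C + B * C := by
  ext w; simp [mul_apply, add_mul, Finset.sum_add_distrib]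

theorem mul_add' (A B C : WordFun U V R) : A * (B + C) = A * B + A * C := by
  ext w; simp [mul_apply, mul_add, Finset.sum_add_distrib]

theorem smul_mul' (c : R) (A B : WordFun U V R) : (c • A) * B = c • (A * B) := by
  ext w; simp [mul_apply, Finset.mul_sum, mul_assoc]

theorem mul_smul' (c : R) (A B : WordFun U V R) : A * (c • B) = c • (A * B) := by
  ext w; simp [mul_apply, Finset.mul_sum, mul_left_comm]

theorem zero_mul' (A : WordFun U V R) : 0 * A = 0 := by
  ext w; simp [mul_apply]

theorem mul_zero' (A : WordFun U V R) : A * 0 = 0 := by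
  ext w; simp [mul_apply]

theorem mul_assoc' (A B C : WordFun U V R) : A * B * C = A * (B * C) := by
  ext w
  induction w generalizing A with
  | nil => simp [mul_nil, mul_assoc]
  | cons x w ih =>
    rw [mul_cons, mul_cons, mul_cons, tail_mul, add_mul', smul_mul', add_apply, ih, mul_nil,
      smul_apply]
    ring

theorem one_mul' (A : WordFun U V R) : 1 * A = A := by
  ext w
  cases w with
  | nil => simp [mul_nil]
  | cons x w => simp [mul_cons, zero_mul']

theorem mul_one' (A : WordFun U V R) : A * 1 = A := by
  ext w
  induction w generalizing A with
  | nil => simp [mul_nil]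
  | cons x w ih => simp [mul_cons, ih]

instance : Ring (WordFun U V R) where
  left_distrib := mul_add'
  right_distrib := add_mul'
  zero_mul := zero_mul'
  mul_zero := mul_zero'
  mul_assoc := mul_assoc'
  one_mul := one_mul'
  mul_one := mul_one'
  zsmul := fun n A => n • A
  zsmul_zero' := zero_zsmul
  zsmul_succ' := fun n A => by rw [Nat.succ_eq_add_one, Nat.cast_add, Nat.cast_one, add_zsmul, one_zsmul]
  zsmul_neg' := fun n A => by rw [negSucc_zsmul, natCast_zsmul]
  neg_add_cancel := neg_add_cancel
  sub_eq_add_neg := sub_eq_add_neg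

instance : Algebra R (WordFun U V R) := Algebra.ofModule smul_mul' mul_smul'

/-- The derivation multiplying by the length. -/
def wder : WordFun U V R →ₗ[R] WordFun U V R where
  toFun A := ⟨fun w => (w.length : R) * A w⟩
  map_add' A B := by ext w; simp [mul_add]
  map_smul' c A := by ext w; simp [mul_left_comm]

@[simp] theorem wder_apply (A : WordFun U V R) (w : List (U × V)) :
    wder A w = (w.length : R) * A w := rfl

theorem wder_mul (A B : WordFun U V R) : wder (A * B) = wder A * B + A * wder B := by
  ext w
  simp only [wder_apply, add_apply, mul_apply, Finset.mul_sum]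
  rw [← Finset.sum_add_distrib]
  refine Finset.sum_congr rfl fun i hi => ?_
  have h : w.length = (w.take i).length + (w.drop i).length := by
    rw [← List.length_append, List.take_append_drop]
  rw [h, Nat.cast_add]
  ring

/-- Subtraction of `v` from all lower entries. -/
def lsub (v : V) (w : List (U × V)) : List (U × V) := w.map fun x => (x.1, x.2 - v)

@[simp] theorem lsub_nil (v : V) : lsub v ([] : List (U × V)) = [] := rfl
@[simp] theorem lsub_cons (v : V) (x : U × V) (w : List (U × V)) :
    lsub v (x :: w) = (x.1, x.2 - v) :: lsub v w := rfl

/-- The function `w ↦ A(w - v)`. -/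
def tau (v : V) : WordFun U V R →ₗ[R] WordFun U V R where
  toFun A := ⟨fun w => A (lsub v w)⟩
  map_add' _ _ := rfl
  map_smul' _ _ := rfl

@[simp] theorem tau_apply (v : V) (A : WordFun U V R) (w : List (U × V)) :
    tau v A w = A (lsub v w) := rfl

theorem tau_mul (v : V) (A B : WordFun U V R) : tau v (A * B) = tau v A * tau v B := by
  ext w
  simp [mul_apply, lsub, List.map_take, List.map_drop]

theorem tau_one (v : V) : tau v (1 : WordFun U V R) = 1 := by
  ext w
  cases w <;> simp

theorem tau_wder (v : V) (A : WordFun U V R) : tau v (wder A) = wder (tau v A) := by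
  ext w; simp [lsub]

open Classical in
/-- The indicator function of the one-letter words with lower entry `v`. -/
def dir (v : V) : WordFun U V R :=
  ⟨fun w => match w with
    | [x] => if x.2 = v then 1 else 0
    | _ => 0⟩

open Classical in
/-- The indicator function of a word. -/
def point (a : List (U × V)) : WordFun U V R := ⟨fun w => if w = a then 1 else 0⟩

theorem point_nil : point ([] : List (U × V)) = (1 : WordFun U V R) := by
  ext w
  cases w <;> simp [point]

/-- Indicators of words are products of indicators of letters, so a derivation is controlled on them
by its values on letters. -/
theorem point_cons (x : U × V) (a : List (U × V)) :
    point (x :: a) = (point [x] * point a : WordFun U V R) := by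
  ext w
  cases w with
  | nil => simp [mul_nil, point]
  | cons y w =>
    have h : tail y (point [x] : WordFun U V R) = (point [x] : WordFun U V R) [y] • 1 := by
      ext w
      cases w <;> simp [point, -ite_smul]
    rw [mul_cons, h, smul_mul_assoc, one_mul]
    by_cases hy : y = x
    · subst hy
      by_cases hw : w = a <;> simp [point, hw]
    · simp [point, hy]

theorem dir_mul_cons (v : V) (B : WordFun U V R) (x : U × V) (w : List (U × V)) :
    (dir v * B : WordFun U V R) (x :: w) = (dir v : WordFun U V R) [x] * B w := by
  have h : tail x (dir v : WordFun U V R) = (dir v : WordFun U V R) [x] • 1 := by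
    ext w
    cases w <;> simp [dir, -ite_smul]
  rw [mul_cons, h, smul_mul_assoc, one_mul]
  simp [dir, -ite_smul]

theorem dir_mul_nil (v : V) (B : WordFun U V R) : (dir v * B : WordFun U V R) [] = 0 := by
  simp [mul_nil, dir]

theorem wder_dir (v : V) : wder (dir v : WordFun U V R) = dir v := by
  ext w
  rcases w with _ | ⟨x, _ | ⟨y, w⟩⟩ <;> simp [dir]

end WordFun

end

end Flexion

/-! ### Derivations and substitutions that replace blocks of a word by single letters -/

namespace Flexion

noncomputable section

set_option linter.unusedSectionVars false

variable {U V R : Type*} [AddCommGroup U] [AddCommGroup V] [CommRing R]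

/-- All factorizations `w = a x c` with a distinguished letter `x`. -/
def splits {L : Type*} : List L → List (List L × L × List L)
  | [] => []
  | x :: w => ([], x, w) :: (splits w).map fun t => (x :: t.1, t.2.1, t.2.2)

/-- All factorizations `w = p q` with `p ≠ ∅`. -/
def cuts {L : Type*} : List L → List (List L × List L)
  | [] => []
  | x :: w => ([x], w) :: (cuts w).map fun t => (x :: t.1, t.2)

theorem eq_of_mem_splits {L : Type*} {w : List L} {t : List L × L × List L} (h : t ∈ splits w) :
    w = t.1 ++ t.2.1 :: t.2.2 := by
  induction w generalizing t with
  | nil => simp [splits] at h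
  | cons x w ih =>
    simp only [splits, List.mem_cons, List.mem_map] at h
    rcases h with rfl | ⟨t, ht, rfl⟩
    · rfl
    · simp [ih ht]

theorem eq_of_mem_cuts {L : Type*} {w : List L} {t : List L × List L} (h : t ∈ cuts w) :
    t.1 ≠ [] ∧ w = t.1 ++ t.2 := by
  induction w generalizing t with
  | nil => simp [cuts] at h
  | cons x w ih =>
    simp only [cuts, List.mem_cons, List.mem_map] at h
    rcases h with rfl | ⟨t, ht, rfl⟩
    · simp
    · simp [← (ih ht).2]

theorem length_of_mem_cuts {L : Type*} {w : List L} {t : List L × List L} (h : t ∈ cuts w) :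
    t.2.length < w.length := by
  obtain ⟨h1, h2⟩ := eq_of_mem_cuts h
  have := List.length_pos_iff.2 h1
  rw [h2, List.length_append]
  omega

theorem splits_map {L L' : Type*} (m : L → L') (w : List L) :
    splits (w.map m) = (splits w).map fun t => (t.1.map m, m t.2.1, t.2.2.map m) := by
  induction w with
  | nil => rfl
  | cons x w ih => simp [splits, ih, Function.comp_def]

theorem cuts_map {L L' : Type*} (m : L → L') (w : List L) :
    cuts (w.map m) = (cuts w).map fun t => (t.1.map m, t.2.map m) := by
  induction w with
  | nil => rfl
  | cons x w ih => simp [cuts, ih, Function.comp_def]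

theorem list_sum_eq_zero {α M : Type*} [AddMonoid M] {l : List α} {f : α → M}
    (h : ∀ t ∈ l, f t = 0) : (l.map f).sum = 0 :=
  List.sum_eq_zero fun x hx => by
    obtain ⟨t, ht, rfl⟩ := List.mem_map.1 hx
    exact h t ht

/-- Lists suit recursion on the word, index ranges suit the definitions of the flexion operations.
The default `x₀` is never read, since `i < w.length`. -/
theorem splits_sum_eq {L M : Type*} [AddCommMonoid M] (f : List L → L → List L → M) (w : List L)
    (x₀ : L) :
    ((splits w).map fun t => f t.1 t.2.1 t.2.2).sum =
      ∑ i ∈ Finset.range w.length, f (w.take i) (w.getD i x₀) (w.drop (i + 1)) := by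
  induction w generalizing f with
  | nil => simp [splits]
  | cons x w ih =>
    rw [List.length_cons, Finset.sum_range_succ', add_comm]
    simp [splits, Function.comp_def, ih fun a y c => f (x :: a) y c]

theorem cuts_sum_eq {L M : Type*} [AddCommMonoid M] (f : List L → List L → M) (w : List L) :
    ((cuts w).map fun t => f t.1 t.2).sum =
      ∑ i ∈ Finset.range w.length, f (w.take (i + 1)) (w.drop (i + 1)) := by
  induction w generalizing f with
  | nil => simp [cuts]
  | cons x w ih =>
    rw [List.length_cons, Finset.sum_range_succ', add_comm]
    simp [cuts, Function.comp_def, ih fun a c => f (x :: a) c]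

/-! ### Kernels -/

/-- A kernel assigns to every word a linear functional on the functions of one letter. -/
abbrev Kernel (U V R : Type*) [CommRing R] : Type _ := List (U × V) → (U × V → R) →ₗ[R] R

namespace WordFun

/-- The convolution `∑_{w = p q, p ≠ ∅} κ(p)(l ↦ G_l(q))`. -/
def conv (κ : Kernel U V R) (G : U × V → WordFun U V R) : WordFun U V R :=
  ⟨fun w => ((cuts w).map fun t => κ t.1 fun l => G l t.2).sum⟩

theorem conv_nil (κ : Kernel U V R) (G : U × V → WordFun U V R) : conv κ G [] = 0 := rfl

theorem conv_cons (κ : Kernel U V R) (G : U × V → WordFun U V R) (x : U × V)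
    (w : List (U × V)) :
    conv κ G (x :: w) = κ [x] (fun l => G l w) + conv (fun p => κ (x :: p)) G w := by
  simp [conv, cuts, Function.comp_def]

theorem conv_add (κ : Kernel U V R) (G H : U × V → WordFun U V R) :
    conv κ (fun l => G l + H l) = conv κ G + conv κ H := by
  ext w
  induction w generalizing κ with
  | nil => simp [conv_nil]
  | cons x w ih =>
    have h : (fun l => (G l + H l) w) = (fun l => G l w) + fun l => H l w := rfl
    rw [add_apply, conv_cons, conv_cons, conv_cons, ih, h, map_add, add_apply]
    ring

theorem conv_smul (κ : Kernel U V R) (c : R) (G : U × V → WordFun U V R) :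
    conv κ (fun l => c • G l) = c • conv κ G := by
  ext w
  induction w generalizing κ with
  | nil => simp [conv_nil]
  | cons x w ih =>
    have h : (fun l => (c • G l) w) = c • (fun l => G l w) := rfl
    rw [smul_apply, conv_cons, conv_cons, ih, h, map_smul, smul_apply, smul_eq_mul]
    ring

/-- For fixed `w` the product is a finite linear combination of the functions `l ↦ G l (w.take i)`,
so linearity of `f` suffices. -/
theorem functional_mul (f : (U × V → R) →ₗ[R] R) (G : U × V → WordFun U V R)
    (B : WordFun U V R) (w : List (U × V)) :
    f (fun l => (G l * B) w) = ((⟨fun w => f fun l => G l w⟩ : WordFun U V R) * B) w := by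
  have h : (fun l => (G l * B) w) = ∑ i ∈ Finset.range (w.length + 1),
      B (w.drop i) • fun l => G l (w.take i) := by
    ext l
    simp [mul_apply, Finset.sum_apply, mul_comm]
  rw [h, map_sum, mul_apply]
  exact Finset.sum_congr rfl fun i _ => by rw [map_smul, smul_eq_mul, mul_comm]

/-- The replaced block is a prefix, so `B` only meets a suffix. Arbitrary kernels are needed because
removing the first letter `x` turns `κ` into `p ↦ κ (x :: p)`. -/
theorem conv_mul (κ : Kernel U V R) (G : U × V → WordFun U V R) (B : WordFun U V R) :
    conv κ (fun l => G l * B) = conv κ G * B := by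
  ext w
  induction w generalizing κ with
  | nil => simp [conv_nil, mul_nil]
  | cons x w ih =>
    have h : tail x (conv κ G) = (⟨fun w => κ [x] fun l => G l w⟩ : WordFun U V R) +
        conv (fun p => κ (x :: p)) G := by
      ext w
      simp [conv_cons]
    rw [conv_cons, ih, mul_cons, h, add_mul, add_apply, functional_mul, conv_nil, zero_mul,
      zero_add]

/-- The kernel `p ↦ ∑_{p = a x c} A(a - v) B(c - v) f(u, v)`, where `u` is the sum of the upper
entries of `p` and `v` is the lower entry of `x`. -/
def ker (A B : WordFun U V R) : Kernel U V R := fun p =>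
  ((splits p).map fun t => (A (lsub t.2.1.2 t.1) * B (lsub t.2.1.2 t.2.2)) •
    (LinearMap.proj (usum p, t.2.1.2) : (U × V → R) →ₗ[R] R)).sum

theorem ker_apply (A B : WordFun U V R) (p : List (U × V)) (f : U × V → R) :
    ker A B p f = ((splits p).map fun t => A (lsub t.2.1.2 t.1) * B (lsub t.2.1.2 t.2.2) *
      f (usum p, t.2.1.2)).sum := by
  unfold ker
  generalize usum p = u
  induction splits p with
  | nil => rfl
  | cons t l ih => simp only [List.map_cons, List.sum_cons, LinearMap.add_apply, ih]; rfl

/-! ### The derivations `amit`, `anit` and the automorphism `gaxit` on words -/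

/-- The derivation with kernel `κ`. -/
def derivAux (κ : Kernel U V R) : List (U × V) → WordFun U V R → R
  | [], _ => 0
  | x :: w, Z => derivAux κ w (tail x Z) + conv κ (fun l => tail l Z) (x :: w)

/-- The derivation with kernel `κ`. -/
def deriv (κ : Kernel U V R) (Z : WordFun U V R) : WordFun U V R := ⟨fun w => derivAux κ w Z⟩

theorem deriv_nil (κ : Kernel U V R) (Z : WordFun U V R) : deriv κ Z [] = 0 := rfl

theorem deriv_cons (κ : Kernel U V R) (Z : WordFun U V R) (x : U × V) (w : List (U × V)) :
    deriv κ Z (x :: w) = deriv κ (tail x Z) w + conv κ (fun l => tail l Z) (x :: w) := rfl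

theorem deriv_add (κ : Kernel U V R) (Y Z : WordFun U V R) :
    deriv κ (Y + Z) = deriv κ Y + deriv κ Z := by
  ext w
  induction w generalizing Y Z with
  | nil => simp [deriv_nil]
  | cons x w ih =>
    have h (l : U × V) : tail l (Y + Z) = tail l Y + tail l Z := rfl
    simp only [h, deriv_cons, add_apply, ih, conv_add]
    ring

theorem deriv_smul (κ : Kernel U V R) (c : R) (Z : WordFun U V R) :
    deriv κ (c • Z) = c • deriv κ Z := by
  ext w
  induction w generalizing Z with
  | nil => simp [deriv_nil]
  | cons x w ih =>
    have h (l : U × V) : tail l (c • Z) = c • tail l Z := rfl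
    simp only [h, deriv_cons, smul_apply, ih, conv_smul]
    ring

/-- The replaced block becomes one letter, which falls entirely into the argument of `Y` or entirely
into that of `Z`. -/
theorem deriv_mul (κ : Kernel U V R) (Y Z : WordFun U V R) :
    deriv κ (Y * Z) = deriv κ Y * Z + Y * deriv κ Z := by
  ext w
  induction w generalizing Y with
  | nil => simp [deriv_nil, mul_nil]
  | cons x w ih =>
    have h : tail x (deriv κ Y) = deriv κ (tail x Y) + tail x (conv κ fun l => tail l Y) := by
      ext w; simp [deriv_cons]
    have h2 := mul_cons (conv κ fun l => tail l Y) Z x w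
    rw [conv_nil, zero_mul, zero_add] at h2
    simp only [deriv_cons, add_apply, tail_mul, deriv_add, deriv_smul, conv_add, conv_smul,
      conv_mul, ih, mul_cons, smul_apply, h, add_mul, h2, deriv_nil]
    ring

/-- Auxiliary function for `subst`. -/
def substAux (κ : Kernel U V R) : Kernel U V R → List (U × V) → WordFun U V R → R
  | _, [], _ => 0
  | κ', x :: w, Z => κ' [x] (fun l => if w.isEmpty then Z [l] else substAux κ κ w (tail l Z)) +
      substAux κ (fun p => κ' (x :: p)) w Z

/-- The substitution with kernel `κ`. -/
def subst (κ : Kernel U V R) (Z : WordFun U V R) : WordFun U V R :=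
  ⟨fun w => if w.isEmpty then Z [] else substAux κ κ w Z⟩

theorem subst_nil (κ : Kernel U V R) (Z : WordFun U V R) : subst κ Z [] = Z [] := rfl

/-- In `substAux κ κ'`, the kernel `κ'` belongs to the block being read, with its earlier letters
absorbed, and `κ` to all later blocks. The test for the empty word in the definition is needed
because `substAux` is `0` there while `subst` is not. -/
theorem substAux_eq (κ κ' : Kernel U V R) (w : List (U × V)) (Z : WordFun U V R) :
    substAux κ κ' w Z = conv κ' (fun l => subst κ (tail l Z)) w := by
  induction w generalizing κ' with
  | nil => rfl
  | cons x w ih =>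
    rw [substAux, conv_cons, ih]
    rfl

/-- Recursion by the first block. The convolution evaluates its argument only on proper suffixes, so
strong induction on the length applies. -/
theorem subst_eq (κ : Kernel U V R) (Z : WordFun U V R) :
    subst κ Z = Z [] • 1 + conv κ (fun l => subst κ (tail l Z)) := by
  ext w
  cases w with
  | nil => simp [subst_nil, conv_nil]
  | cons x w =>
    rw [add_apply, ← substAux_eq]
    simp [subst]

/-- Induction along the recursion `subst_eq`. -/
theorem conv_congr (κ : Kernel U V R) {G H : U × V → WordFun U V R} (w : List (U × V))
    (h : ∀ l, ∀ q : List (U × V), q.length < w.length → G l q = H l q) :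
    conv κ G w = conv κ H w := by
  simp only [conv, mk_apply]
  congr 1
  refine List.map_congr_left fun t ht => ?_
  congr 1
  ext l
  exact h l _ (length_of_mem_cuts ht)

theorem subst_add (κ : Kernel U V R) (Y Z : WordFun U V R) :
    subst κ (Y + Z) = subst κ Y + subst κ Z := by
  ext w
  induction hn : w.length using Nat.strong_induction_on generalizing w Y Z with
  | _ n ih =>
    have h (l : U × V) : tail l (Y + Z) = tail l Y + tail l Z := rfl
    rw [subst_eq, subst_eq κ Y, subst_eq κ Z]
    simp only [h, add_apply]
    rw [conv_congr κ (H := fun l => subst κ (tail l Y) + subst κ (tail l Z)) w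
      fun l q hq => ih _ (hn ▸ hq) _ _ q rfl, conv_add]
    simp only [smul_apply, add_apply]
    ring

theorem subst_smul (κ : Kernel U V R) (c : R) (Z : WordFun U V R) :
    subst κ (c • Z) = c • subst κ Z := by
  ext w
  induction hn : w.length using Nat.strong_induction_on generalizing w Z with
  | _ n ih =>
    have h (l : U × V) : tail l (c • Z) = c • tail l Z := rfl
    rw [subst_eq, subst_eq κ Z]
    simp only [h, add_apply, smul_apply]
    rw [conv_congr κ (H := fun l => c • subst κ (tail l Z)) w
      fun l q hq => ih _ (hn ▸ hq) _ q rfl, conv_smul]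
    simp only [smul_apply]
    ring

/-- Each block becomes a single letter, so cutting the new word in two amounts to cutting the
sequence of blocks in two. -/
theorem subst_mul (κ : Kernel U V R) (Y Z : WordFun U V R) :
    subst κ (Y * Z) = subst κ Y * subst κ Z := by
  ext w
  induction hn : w.length using Nat.strong_induction_on generalizing w Y with
  | _ n ih =>
    rw [subst_eq, subst_eq κ Y, add_mul, ← conv_mul]
    simp only [tail_mul, add_apply, subst_add, subst_smul]
    rw [conv_add, conv_smul, add_apply, conv_congr κ (H := fun l => subst κ (tail l Y) * subst κ Z) w
      fun l q hq => ih _ (hn ▸ hq) _ q rfl, smul_mul_assoc, one_mul, subst_eq κ Z]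
    simp only [smul_apply, add_apply, mul_nil]
    ring

theorem subst_one (κ : Kernel U V R) : subst κ 1 = 1 := by
  rw [subst_eq]
  have h : conv κ (fun l : U × V => subst κ (tail l 1)) = 0 := by
    have h0 : subst κ (0 : WordFun U V R) = 0 := by
      simpa using subst_smul κ (0 : R) 0
    simp only [tail_one, h0]
    simpa using conv_smul κ (0 : R) fun _ : U × V => 0
  rw [h]
  simp

/-! ### Values on one-letter functions -/

/-- The function `1` vanishes on nonempty suffixes, so the block must be the whole word. -/
theorem conv_one (κ : Kernel U V R) (f : U × V → R) (x : U × V) (w : List (U × V)) :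
    conv κ (fun l => f l • 1) (x :: w) = κ (x :: w) f := by
  induction w generalizing κ x with
  | nil => simp [conv_cons, conv_nil]
  | cons y w ih =>
    rw [conv_cons, ih]
    have : (fun l => (f l • (1 : WordFun U V R)) (y :: w)) = 0 := by ext; simp
    rw [this]
    simp

theorem tail_dir (v : V) (l : U × V) :
    tail l (dir v : WordFun U V R) = (dir v : WordFun U V R) [l] • 1 := by
  ext w
  cases w <;> simp [dir, -ite_smul]

/-- The upper entry of the merged letter is invisible to `dir v`, so the sum over distinguished
letters is a sum over the cuts in front of a letter with lower entry `v`: a triple product. An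
indicator of a single letter would also constrain the sum of the upper entries. -/
theorem ker_dir (A B : WordFun U V R) (v : V) (w : List (U × V)) :
    ker A B w (fun l => (dir v : WordFun U V R) [l]) = (tau v A * dir v * tau v B : WordFun U V R) w := by
  rw [ker_apply, mul_assoc, mul_apply, Finset.sum_range_succ, List.drop_length, dir_mul_nil,
    mul_zero, add_zero, splits_sum_eq (fun a x c => A (lsub x.2 a) * B (lsub x.2 c) *
      (dir v : WordFun U V R) [(usum w, x.2)]) w 0]
  refine Finset.sum_congr rfl fun i hi => ?_
  have hi' : i < w.length := Finset.mem_range.1 hi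
  rw [List.drop_eq_getElem_cons hi', dir_mul_cons, List.getD_eq_getElem _ _ hi']
  by_cases h : w[i].2 = v
  · simp [dir, h]
  · simp [dir, h]

theorem subst_dir (A B : WordFun U V R) (v : V) :
    subst (ker A B) (dir v) = tau v A * dir v * tau v B := by
  ext w
  rw [← ker_dir, subst_eq]
  simp only [tail_dir, subst_smul, subst_one]
  cases w with
  | nil => simp [conv_nil, ker, splits, dir]
  | cons x w =>
    rw [add_apply, conv_one]
    simp [dir]

theorem deriv_one (κ : Kernel U V R) : deriv κ 1 = 0 := by
  have h := deriv_mul κ 1 1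
  simpa using h

theorem deriv_dir (A B : WordFun U V R) (v : V) :
    deriv (ker A B) (dir v) = tau v A * dir v * tau v B := by
  ext w
  rw [← ker_dir]
  cases w with
  | nil => simp [deriv_nil, ker, splits]
  | cons x w =>
    rw [deriv_cons]
    simp only [tail_dir, deriv_smul, deriv_one]
    rw [conv_one]
    simp

end WordFun

end

end Flexion

/-! ### Naturality under maps of letters, and local operators -/

namespace Flexion

noncomputable section

set_option linter.unusedSectionVars false

variable {U V R : Type*} [AddCommGroup U] [AddCommGroup V] [CommRing R]

theorem usum_nil : usum ([] : List (U × V)) = 0 := rfl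

theorem usum_cons (x : U × V) (w : List (U × V)) : usum (x :: w) = x.1 + usum w := by
  simp [usum]

theorem usum_append (a b : List (U × V)) : usum (a ++ b) = usum a + usum b := by
  simp [usum]

/-- A predicate on words which is stable under taking factors and under flexions. -/
structure FlexClosed (G : List (U × V) → Prop) : Prop where
  left : ∀ a b, G (a ++ b) → G a
  right : ∀ a b, G (a ++ b) → G b
  merge : ∀ s a x c q, G (s ++ (a ++ x :: c ++ q)) → G (s ++ (usum (a ++ x :: c), x.2) :: q)
  lsub_left : ∀ a x c, G (a ++ x :: c) → G (WordFun.lsub x.2 a)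
  lsub_right : ∀ a x c, G (a ++ x :: c) → G (WordFun.lsub x.2 c)

theorem flexClosed_true : FlexClosed fun _ : List (U × V) => True where
  left _ _ _ := trivial
  right _ _ _ := trivial
  merge _ _ _ _ _ _ := trivial
  lsub_left _ _ _ _ := trivial
  lsub_right _ _ _ _ := trivial

/-- The affine map on letters with linear parts `g`, `h` and translation `v₀` of the lower
entries. -/
def letterMap {U' V' : Type*} [AddCommGroup U'] [AddCommGroup V'] (g : U →+ U') (h : V →+ V')
    (v₀ : V') (x : U × V) : U' × V' := (g x.1, h x.2 + v₀)

section Naturality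

variable {U' V' R' : Type*} [AddCommGroup U'] [AddCommGroup V'] [CommRing R']
  {g : U →+ U'} {h : V →+ V'} {v₀ : V'} {φ : R →+* R'} {G : List (U × V) → Prop}

theorem usum_letterMap (w : List (U × V)) : usum (w.map (letterMap g h v₀)) = g (usum w) := by
  induction w with
  | nil => simp [usum_nil]
  | cons x w ih => simp [usum_cons, ih, letterMap]

namespace WordFun

/-- Flexions subtract lower entries, so the translation `v₀` cancels. Hence the functions `A`, `B`
of the kernel are compared without translation in what follows. -/
theorem lsub_letterMap (v : V) (w : List (U × V)) :
    lsub (h v + v₀) (w.map (letterMap g h v₀)) = (lsub v w).map (letterMap g h 0) := by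
  simp [lsub, letterMap]

theorem mul_natural {A B : WordFun U V R} {A' B' : WordFun U' V' R'} (m : U × V → U' × V')
    (hl : ∀ a b, G (a ++ b) → G a) (hr : ∀ a b, G (a ++ b) → G b)
    (hA : ∀ w, G w → φ (A w) = A' (w.map m)) (hB : ∀ w, G w → φ (B w) = B' (w.map m))
    (w : List (U × V)) (hw : G w) : φ ((A * B) w) = (A' * B') (w.map m) := by
  simp only [mul_apply, map_sum, map_mul, List.length_map, ← List.map_take, ← List.map_drop]
  refine Finset.sum_congr rfl fun i _ => ?_
  rw [← List.take_append_drop i w] at hw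
  rw [hA _ (hl _ _ hw), hB _ (hr _ _ hw)]

theorem conv_natural {A B : WordFun U V R} {A' B' : WordFun U' V' R'}
    {M : U × V → WordFun U V R} {M' : U' × V' → WordFun U' V' R'} (hG : FlexClosed G)
    (hA : ∀ w, G w → φ (A w) = A' (w.map (letterMap g h 0)))
    (hB : ∀ w, G w → φ (B w) = B' (w.map (letterMap g h 0)))
    (w : List (U × V)) (hw : G w)
    (hM : ∀ a x c q, w = a ++ x :: c ++ q → φ (M (usum (a ++ x :: c), x.2) q) =
      M' (letterMap g h v₀ (usum (a ++ x :: c), x.2)) (q.map (letterMap g h v₀))) :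
    φ (conv (ker A B) M w) = conv (ker A' B') M' (w.map (letterMap g h v₀)) := by
  simp only [conv, mk_apply, map_list_sum, cuts_map, List.map_map]
  congr 1
  refine List.map_congr_left fun t ht => ?_
  obtain ⟨-, ht⟩ := eq_of_mem_cuts ht
  simp only [Function.comp_apply, ker_apply, splits_map, List.map_map, map_list_sum]
  congr 1
  refine List.map_congr_left fun s hs => ?_
  replace hs := eq_of_mem_splits hs
  have hG' : G (s.1 ++ s.2.1 :: s.2.2) := hG.left _ t.2 (by rw [← hs, ← ht]; exact hw)
  simp only [Function.comp_apply, map_mul, hA _ (hG.lsub_left _ _ _ hG'),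
    hB _ (hG.lsub_right _ _ _ hG')]
  have e := hM s.1 s.2.1 s.2.2 t.2 (by rw [← hs, ← ht])
  rw [← hs] at e
  rw [e, ← lsub_letterMap (v₀ := v₀), ← lsub_letterMap (v₀ := v₀), usum_letterMap]
  rfl

/-- The function `w ↦ A(s w)`. -/
def tails (s : List (U × V)) (A : WordFun U V R) : WordFun U V R := ⟨fun w => A (s ++ w)⟩

theorem tail_tails (s : List (U × V)) (l : U × V) (A : WordFun U V R) :
    tail l (tails s A) = tails (s ++ [l]) A := by
  ext w; simp [tails]

variable {A B Z : WordFun U V R} {A' B' Z' : WordFun U' V' R'}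

theorem deriv_natural (hG : FlexClosed G)
    (hA : ∀ w, G w → φ (A w) = A' (w.map (letterMap g h 0)))
    (hB : ∀ w, G w → φ (B w) = B' (w.map (letterMap g h 0)))
    (hZ : ∀ w, G w → φ (Z w) = Z' (w.map (letterMap g h v₀)))
    (w : List (U × V)) (hw : G w) :
    φ (deriv (ker A B) Z w) = deriv (ker A' B') Z' (w.map (letterMap g h v₀)) := by
  -- The hypothesis on `Z` holds only on words satisfying `G`, so the letters removed by `tail` are
  -- remembered as a prefix `s` and `G` is required of the whole word.
  suffices H : ∀ s, G (s ++ w) → φ (deriv (ker A B) (tails s Z) w) =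
      deriv (ker A' B') (tails (s.map (letterMap g h v₀)) Z') (w.map (letterMap g h v₀)) from
    H [] hw
  clear hw
  induction w with
  | nil => intro s _; simp [deriv_nil]
  | cons x w ih =>
    intro s hs
    have e1 : φ (conv (ker A B) (fun l => tails (s ++ [l]) Z) (x :: w)) =
        conv (ker A' B') (fun l => tails (s.map (letterMap g h v₀) ++ [l]) Z')
          ((x :: w).map (letterMap g h v₀)) := by
      refine conv_natural hG hA hB _ (hG.right _ _ hs) fun a y c q hq => ?_
      have := hZ _ (hG.merge s a y c q (hq ▸ hs))
      simpa [tails] using this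
    simp only [List.map_cons] at e1 ⊢
    rw [deriv_cons, deriv_cons, map_add]
    simp only [tail_tails]
    rw [e1, ih (s ++ [x]) (by simpa using hs)]
    simp

theorem subst_natural (hG : FlexClosed G)
    (hA : ∀ w, G w → φ (A w) = A' (w.map (letterMap g h 0)))
    (hB : ∀ w, G w → φ (B w) = B' (w.map (letterMap g h 0)))
    (hZ : ∀ w, G w → φ (Z w) = Z' (w.map (letterMap g h v₀)))
    (w : List (U × V)) (hw : G w) :
    φ (subst (ker A B) Z w) = subst (ker A' B') Z' (w.map (letterMap g h v₀)) := by
  suffices H : ∀ s, G (s ++ w) → φ (subst (ker A B) (tails s Z) w) =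
      subst (ker A' B') (tails (s.map (letterMap g h v₀)) Z') (w.map (letterMap g h v₀)) from
    H [] hw
  clear hw
  induction hn : w.length using Nat.strong_induction_on generalizing w with
  | _ n ih =>
    intro s hs
    have e1 : φ (conv (ker A B) (fun l => subst (ker A B) (tails (s ++ [l]) Z)) w) =
        conv (ker A' B') (fun l => subst (ker A' B') (tails (s.map (letterMap g h v₀) ++ [l]) Z'))
          (w.map (letterMap g h v₀)) := by
      refine conv_natural hG hA hB _ (hG.right _ _ hs) fun a y c q hq => ?_
      have hlen : q.length < n := by rw [← hn, hq]; simp; omega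
      have := ih _ hlen q rfl (s ++ [(usum (a ++ y :: c), y.2)])
        (by simpa using hG.merge s a y c q (hq ▸ hs))
      simpa using this
    rw [subst_eq, subst_eq (ker A' B')]
    simp only [tail_tails, add_apply, smul_apply, map_add, map_mul, e1]
    congr 1
    cases w with
    | nil => simpa [tails] using hZ s (by simpa using hs)
    | cons x w => simp

theorem winv_natural {X : List (U × V) → R} {X' : List (U' × V') → R'} (m : U × V → U' × V')
    (hl : ∀ a b, G (a ++ b) → G a) (hr : ∀ a b, G (a ++ b) → G b)
    (hX : ∀ w, G w → φ (X w) = X' (w.map m)) (w : List (U × V)) (hw : G w) :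
    φ (winv X w) = winv X' (w.map m) := by
  induction hn : w.length using Nat.strong_induction_on generalizing w with
  | _ n ih =>
    rw [winv, winv]
    simp only [List.map_eq_nil_iff]
    split_ifs with h0
    · simp
    · have key (i : ℕ) (hi : i < w.length) : φ (winv X (w.take i) * X (w.drop i)) =
          winv X' ((w.map m).take i) * X' ((w.map m).drop i) := by
        have hw' := hw
        rw [← List.take_append_drop i w] at hw'
        rw [map_mul, hX _ (hr _ _ hw'), ih _ (by simp; omega) _ (hl _ _ hw') rfl,
          List.map_take, List.map_drop]
      rw [map_neg, map_sum]
      congr 1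
      exact Fintype.sum_equiv (finCongr (List.length_map m).symm) _ _ fun i => key i i.2

end WordFun

end Naturality

namespace WordFun

theorem lsub_eq_map (v : V) (w : List (U × V)) :
    lsub v w = w.map (letterMap (AddMonoidHom.id U) (AddMonoidHom.id V) (-v)) :=
  List.map_congr_left fun x _ => by rw [letterMap, ← sub_eq_add_neg]; rfl

theorem map_letterMap_id (w : List (U × V)) :
    w.map (letterMap (AddMonoidHom.id U) (AddMonoidHom.id V) 0) = w := by
  conv_rhs => rw [← List.map_id w]
  exact List.map_congr_left fun x _ => by rw [letterMap, add_zero]; rfl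

/-- This is naturality for identity linear parts and the translation by `-v`. -/
theorem deriv_tau (A B Z : WordFun U V R) (v : V) :
    deriv (ker A B) (tau v Z) = tau v (deriv (ker A B) Z) := by
  ext w
  have := deriv_natural (φ := RingHom.id R) (g := AddMonoidHom.id U) (h := AddMonoidHom.id V)
    (v₀ := -v) (A := A) (B := B) (Z := tau v Z) (A' := A) (B' := B) (Z' := Z) flexClosed_true
    (fun w _ => by rw [map_letterMap_id]; rfl) (fun w _ => by rw [map_letterMap_id]; rfl)
    (fun w _ => by rw [← lsub_eq_map]; rfl) w trivial
  rw [RingHom.id_apply] at this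
  rw [this, tau_apply, lsub_eq_map]

/-! ### Local operators -/

/-- The value of `T Z` at `w` depends only on the values of `Z` at finitely many words, with the
same sum of upper entries as `w`. -/
def IsLocal (T : WordFun U V R → WordFun U V R) : Prop :=
  ∀ w, ∃ s : Set (List (U × V)), s.Finite ∧ (∀ a ∈ s, usum a = usum w) ∧
    ∀ Y Z : WordFun U V R, (∀ a ∈ s, Y a = Z a) → T Y w = T Z w

theorem IsLocal.comp {S T : WordFun U V R → WordFun U V R} (hS : IsLocal S) (hT : IsLocal T) :
    IsLocal fun Z => S (T Z) := by
  intro w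
  obtain ⟨s, hs, hu, h⟩ := hS w
  choose t ht hv h' using hT
  refine ⟨⋃ a ∈ s, t a, hs.biUnion fun a _ => ht a, ?_, fun Y Z hYZ => h _ _ fun a ha => ?_⟩
  · intro b hb
    obtain ⟨a, ha, hb⟩ := Set.mem_iUnion₂.1 hb
    rw [hv a b hb, hu a ha]
  · exact h' a _ _ fun b hb => hYZ b (Set.mem_biUnion ha hb)

theorem IsLocal.sub {S T : WordFun U V R → WordFun U V R} (hS : IsLocal S) (hT : IsLocal T) :
    IsLocal fun Z => S Z - T Z := by
  intro w
  obtain ⟨s, hs, hu, h⟩ := hS w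
  obtain ⟨t, ht, hv, h'⟩ := hT w
  refine ⟨s ∪ t, hs.union ht, ?_, fun Y Z hYZ => ?_⟩
  · rintro a (ha | ha)
    exacts [hu a ha, hv a ha]
  · rw [sub_apply, sub_apply, h Y Z fun a ha => hYZ a (Or.inl ha),
      h' Y Z fun a ha => hYZ a (Or.inr ha)]

theorem isLocal_wder : IsLocal (wder : WordFun U V R →ₗ[R] WordFun U V R) := fun w =>
  ⟨{w}, Set.finite_singleton w, by simp, fun Y Z h => by simp [h w rfl]⟩

/-- Agreement is required only at the letters that `ker` produces, whose upper entry is the sum over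
the block. This is what preserves the sum of upper entries in the locality statements. -/
theorem conv_ker_congr {A B : WordFun U V R} {M M' : U × V → WordFun U V R} (w : List (U × V))
    (h : ∀ t ∈ cuts w, ∀ s ∈ splits t.1, M (usum t.1, s.2.1.2) t.2 = M' (usum t.1, s.2.1.2) t.2) :
    conv (ker A B) M w = conv (ker A B) M' w := by
  simp only [conv, mk_apply, ker_apply]
  congr 1
  refine List.map_congr_left fun t ht => ?_
  congr 1
  exact List.map_congr_left fun s hs => by rw [h t ht s hs]

/-- The words obtained from `w = a x c q` by replacing `a x c` by the letter formed with the sum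
of the upper entries and the lower entry of `x`, and `q` by a word in `s q`. -/
def mergeSet (s : List (U × V) → Set (List (U × V))) (w : List (U × V)) : Set (List (U × V)) :=
  ⋃ t ∈ {t | t ∈ cuts w}, ⋃ r ∈ {r | r ∈ splits t.1},
    (fun q => (usum t.1, r.2.1.2) :: q) '' s t.2

theorem finite_mergeSet {s : List (U × V) → Set (List (U × V))} {w : List (U × V)}
    (h : ∀ q, q.length < w.length → (s q).Finite) : (mergeSet s w).Finite :=
  (List.finite_toSet _).biUnion fun _ ht => (List.finite_toSet _).biUnion fun _ _ =>
    (h _ (length_of_mem_cuts ht)).image _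

theorem usum_of_mem_mergeSet {s : List (U × V) → Set (List (U × V))} {w : List (U × V)}
    (h : ∀ q, q.length < w.length → ∀ a ∈ s q, usum a = usum q) {a : List (U × V)}
    (ha : a ∈ mergeSet s w) : usum a = usum w := by
  simp only [mergeSet, Set.mem_iUnion, Set.mem_image, Set.mem_ofPred_eq] at ha
  obtain ⟨t, ht, r, -, q, hq, rfl⟩ := ha
  rw [usum_cons, h _ (length_of_mem_cuts ht) q hq, (eq_of_mem_cuts ht).2, usum_append]

theorem cons_mem_mergeSet {s : List (U × V) → Set (List (U × V))} {w : List (U × V)}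
    {t : List (U × V) × List (U × V)} {r : List (U × V) × (U × V) × List (U × V)}
    (ht : t ∈ cuts w) (hr : r ∈ splits t.1) {q : List (U × V)} (hq : q ∈ s t.2) :
    (usum t.1, r.2.1.2) :: q ∈ mergeSet s w := by
  simp only [mergeSet, Set.mem_iUnion, Set.mem_image, Set.mem_ofPred_eq]
  exact ⟨t, ht, r, hr, q, hq, rfl⟩

theorem isLocal_deriv (A B : WordFun U V R) : IsLocal (deriv (ker A B)) := by
  intro w
  induction w with
  | nil => exact ⟨∅, Set.finite_empty, by simp, fun _ _ _ => rfl⟩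
  | cons x w ih =>
    obtain ⟨s, hs, hu, h⟩ := ih
    refine ⟨List.cons x '' s ∪ mergeSet (fun q => {q}) (x :: w), (hs.image _).union
      (finite_mergeSet fun q _ => Set.finite_singleton q), ?_, fun Y Z hYZ => ?_⟩
    · rintro a (⟨a, ha, rfl⟩ | ha)
      · rw [usum_cons, usum_cons, hu a ha]
      · exact usum_of_mem_mergeSet (fun q _ a ha => by rw [ha]) ha
    · rw [deriv_cons, deriv_cons,
        h (tail x Y) (tail x Z) fun a ha => hYZ _ (Or.inl ⟨a, ha, rfl⟩)]
      congr 1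
      exact conv_ker_congr _ fun t ht r hr =>
        hYZ _ (Or.inr (cons_mem_mergeSet ht hr rfl))

theorem isLocal_subst (A B : WordFun U V R) : IsLocal (subst (ker A B)) := by
  suffices H : ∀ n, ∀ w : List (U × V), w.length < n → ∃ s : Set (List (U × V)), s.Finite ∧
      (∀ a ∈ s, usum a = usum w) ∧ ∀ Y Z : WordFun U V R, (∀ a ∈ s, Y a = Z a) →
        subst (ker A B) Y w = subst (ker A B) Z w from
    fun w => H (w.length + 1) w (Nat.lt_succ_self _)
  intro n
  induction n with
  | zero => intro w hw; omega
  | succ n ih =>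
    intro w hw
    have hlt (q : List (U × V)) (hq : q.length < w.length) : q.length < n := by omega
    choose! s hs hu h using ih
    by_cases h0 : w = []
    · subst h0
      exact ⟨{[]}, Set.finite_singleton _, by simp, fun Y Z hYZ => hYZ _ rfl⟩
    refine ⟨mergeSet s w, finite_mergeSet fun q hq => hs q (hlt q hq), fun a ha =>
      usum_of_mem_mergeSet (fun q hq => hu q (hlt q hq)) ha, fun Y Z hYZ => ?_⟩
    rw [subst_eq, subst_eq _ Z, add_apply, add_apply]
    congr 1
    · obtain ⟨x, w, rfl⟩ := List.exists_cons_of_ne_nil h0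
      simp
    · refine conv_ker_congr _ fun t ht r hr => ?_
      exact h _ (hlt _ (length_of_mem_cuts ht)) _ _ fun a ha => hYZ _ (cons_mem_mergeSet ht hr ha)

/-- Once the sum of the upper entries is fixed, a one-letter word is determined by its lower entry.
-/
theorem point_singleton_eq (l : U × V) (w : List (U × V)) (h : usum w = l.1) :
    (point [l] : WordFun U V R) w = (dir l.2 : WordFun U V R) w := by
  rcases w with _ | ⟨x, _ | ⟨y, w⟩⟩
  · simp [point, dir]
  · have h1 : x.1 = l.1 := by simpa [usum] using h
    have h2 : x = l ↔ x.2 = l.2 := ⟨fun h => by rw [h], fun h => Prod.ext h1 h⟩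
    by_cases h3 : x.2 = l.2
    · simp [point, dir, h2.2 h3]
    · simp [point, dir, h3, h2]
  · simp [point, dir]

theorem point_singleton_eq_zero (l : U × V) (w : List (U × V)) (h : usum w ≠ l.1) :
    (point [l] : WordFun U V R) w = 0 := by
  have : w ≠ [l] := by
    rintro rfl
    simp [usum] at h
  simp [point, this]

theorem mul_vanish {G : List (U × V) → Prop} (hl : ∀ a b, G (a ++ b) → G a)
    {A : WordFun U V R} (hA : ∀ w, G w → A w = 0) (B : WordFun U V R) (w : List (U × V))
    (hw : G w) : (A * B) w = 0 := by
  rw [mul_apply]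
  refine Finset.sum_eq_zero fun i _ => ?_
  rw [← List.take_append_drop i w] at hw
  rw [hA _ (hl _ _ hw), zero_mul]

theorem vanish_mul {G : List (U × V) → Prop} (hr : ∀ a b, G (a ++ b) → G b)
    {B : WordFun U V R} (hB : ∀ w, G w → B w = 0) (A : WordFun U V R) (w : List (U × V))
    (hw : G w) : (A * B) w = 0 := by
  rw [mul_apply]
  refine Finset.sum_eq_zero fun i _ => ?_
  rw [← List.take_append_drop i w] at hw
  rw [hB _ (hr _ _ hw), mul_zero]

/-- A local operator which is a derivation over `T` and vanishes on the functions `dir v`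
vanishes. -/
theorem eq_zero_of_dir {G : List (U × V) → Prop} (hl : ∀ a b, G (a ++ b) → G a)
    (hr : ∀ a b, G (a ++ b) → G b) (T : WordFun U V R → WordFun U V R)
    (D : WordFun U V R →ₗ[R] WordFun U V R) (hloc : IsLocal D)
    (hmul : ∀ Y Z, D (Y * Z) = D Y * T Z + T Y * D Z) (hone : D 1 = 0)
    (hdir : ∀ v w, G w → D (dir v) w = 0) (Z : WordFun U V R) (w : List (U × V)) (hw : G w) :
    D Z w = 0 := by
  classical
  -- Locality lets `D` see only words with the upper sum of `w`. Among these, `point [l]` is either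
  -- `dir l.2` or zero.
  have hletter (l : U × V) (w : List (U × V)) (hw : G w) : D (point [l]) w = 0 := by
    obtain ⟨s, -, hu, h⟩ := hloc w
    by_cases hlw : usum w = l.1
    · rw [← hdir l.2 w hw]
      exact h _ _ fun a ha => point_singleton_eq l a ((hu a ha).trans hlw)
    · have := h (point [l]) 0 fun a ha => point_singleton_eq_zero l a (by rwa [hu a ha])
      rw [this, map_zero, zero_apply]
  have hpoint (a : List (U × V)) : ∀ w, G w → D (point a) w = 0 := by
    induction a with
    | nil => intro w _; rw [point_nil, hone, zero_apply]
    | cons l a ih =>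
      intro w hw
      rw [point_cons, hmul, add_apply, mul_vanish hl (hletter l) _ w hw,
        vanish_mul hr ih _ w hw, add_zero]
  obtain ⟨s, hs, -, h⟩ := hloc w
  -- By finiteness of the locality set, `Z` may be replaced by a finite combination of indicators of
  -- words.
  have key := h Z (∑ a ∈ hs.toFinset, Z a • point a) fun b hb => by
    rw [sum_apply, Finset.sum_eq_single b]
    · simp [point]
    · intro a _ hab
      simp [point, Ne.symm hab]
    · intro hb'
      exact absurd (hs.mem_toFinset.2 hb) hb'
  rw [key, map_sum, sum_apply]
  exact Finset.sum_eq_zero fun a _ => by rw [map_smul, smul_apply, hpoint a w hw, mul_zero]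

end WordFun

end

end Flexion

/-! ### The commutator of two `arit` operators, the differential equation for `garit`, leading terms
-/

namespace Flexion

noncomputable section

set_option linter.unusedSectionVars false

variable {U V R : Type*} [AddCommGroup U] [AddCommGroup V] [CommRing R]

namespace WordFun

/-- The derivation `deriv κ` as a linear map. -/
def derivLin (κ : Kernel U V R) : WordFun U V R →ₗ[R] WordFun U V R where
  toFun := deriv κ
  map_add' := deriv_add κ
  map_smul' := deriv_smul κ

/-- The derivation `arit(E)` on functions of words. -/
def warit (E : WordFun U V R) : WordFun U V R →ₗ[R] WordFun U V R :=
  derivLin (ker E 1) - derivLin (ker 1 E)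

/-- The substitution with kernel `κ` as a linear map. -/
def substLin (κ : Kernel U V R) : WordFun U V R →ₗ[R] WordFun U V R where
  toFun := subst κ
  map_add' := subst_add κ
  map_smul' := subst_smul κ

theorem warit_apply (E Z : WordFun U V R) :
    warit E Z = deriv (ker E 1) Z - deriv (ker 1 E) Z := rfl

theorem warit_mul (E Y Z : WordFun U V R) : warit E (Y * Z) = warit E Y * Z + Y * warit E Z := by
  simp only [warit_apply, deriv_mul]
  noncomm_ring

theorem warit_dir (E : WordFun U V R) (v : V) :
    warit E (dir v) = tau v E * dir v - dir v * tau v E := by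
  simp only [warit_apply, deriv_dir, tau_one, mul_one, one_mul]

theorem warit_tau (E Z : WordFun U V R) (v : V) : warit E (tau v Z) = tau v (warit E Z) := by
  simp only [warit_apply, deriv_tau, map_sub]

theorem warit_one (E : WordFun U V R) : warit E 1 = 0 := by
  simp only [warit_apply, deriv_one, sub_zero]

theorem isLocal_warit (E : WordFun U V R) : IsLocal (warit E) :=
  (isLocal_deriv _ _).sub (isLocal_deriv _ _)

theorem wder_one : wder (1 : WordFun U V R) = 0 := by
  ext w; cases w <;> simp

/-- The bracket `ari` on functions of words. -/
def wari (A B : WordFun U V R) : WordFun U V R :=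
  warit B A + A * B - (warit A B + B * A)

/-- The difference of the two sides is a local derivation. On `dir v` it vanishes by a computation
with commutators, because `warit` commutes with `tau v`. -/
theorem warit_commutator (A D Z : WordFun U V R) :
    warit A (warit D Z) - warit D (warit A Z) = warit (wari D A) Z := by
  set Δ : WordFun U V R →ₗ[R] WordFun U V R :=
    warit A ∘ₗ warit D - warit D ∘ₗ warit A - warit (wari D A) with hΔ
  have hΔ' (Z : WordFun U V R) :
      Δ Z = warit A (warit D Z) - warit D (warit A Z) - warit (wari D A) Z := rfl
  have key : ∀ w : List (U × V), True → Δ Z w = 0 := by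
    intro w hw
    refine eq_zero_of_dir (G := fun _ => True) (fun _ _ _ => trivial) (fun _ _ _ => trivial) id Δ
      ?_ ?_ ?_ ?_ Z w hw
    · exact (((isLocal_warit A).comp (isLocal_warit D)).sub
        ((isLocal_warit D).comp (isLocal_warit A))).sub (isLocal_warit _)
    · intro Y Z
      simp only [hΔ', warit_mul, map_add, id]
      noncomm_ring
    · simp [hΔ', warit_one]
    · intro v w _
      have : Δ (dir v) = 0 := by
        simp only [hΔ', warit_dir, map_sub, warit_mul, warit_tau, wari, map_add, tau_mul]
        noncomm_ring
      rw [this, zero_apply]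
  have : Δ Z = 0 := by ext w; exact key w trivial
  rwa [hΔ', sub_eq_zero] at this

theorem derivation_inv {D : WordFun U V R → WordFun U V R}
    (hD : ∀ Y Z, D (Y * Z) = D Y * Z + Y * D Z) (h1 : D 1 = 0) {y z : WordFun U V R}
    (h : y * z = 1) (h' : z * y = 1) : D z = -(z * D y * z) := by
  have e := hD z y
  rw [h', h1] at e
  calc D z = D z * (y * z) := by rw [h, mul_one]
    _ = (D z * y + z * D y) * z - z * D y * z := by noncomm_ring
    _ = -(z * D y * z) := by rw [← e]; simp

theorem ker_vanish {G : List (U × V) → Prop} (hG : FlexClosed G) {A B : WordFun U V R}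
    (h : (∀ w, G w → A w = 0) ∨ ∀ w, G w → B w = 0) (w : List (U × V)) (hw : G w)
    (f : U × V → R) : ker A B w f = 0 := by
  rw [ker_apply]
  refine list_sum_eq_zero fun t ht => ?_
  rw [eq_of_mem_splits ht] at hw
  rcases h with h | h
  · rw [h _ (hG.lsub_left _ _ _ hw)]; ring
  · rw [h _ (hG.lsub_right _ _ _ hw)]; ring

/-- The operator `wder ∘ T - T ∘ wder - warit E ∘ T`, with `T` the substitution, is a derivation
over `T`, so it suffices to test it on `dir v`. The equation for `Y` is assumed only on words
satisfying `G`, hence so is the conclusion. -/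
theorem wder_subst {G : List (U × V) → Prop} (hG : FlexClosed G) {Y Y' E : WordFun U V R}
    (h : Y * Y' = 1) (h' : Y' * Y = 1) (hE : ∀ w, G w → wder Y w = (warit E Y + Y * E) w)
    (Z : WordFun U V R) (w : List (U × V)) (hw : G w) :
    wder (subst (ker Y Y') Z) w =
      (subst (ker Y Y') (wder Z) + warit E (subst (ker Y Y') Z)) w := by
  set T := substLin (ker Y Y') with hT
  have hT' (Z : WordFun U V R) : subst (ker Y Y') Z = T Z := rfl
  set Δ : WordFun U V R →ₗ[R] WordFun U V R :=
    wder ∘ₗ T - T ∘ₗ wder - warit E ∘ₗ T with hΔ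
  have hΔ' (Z : WordFun U V R) : Δ Z = wder (T Z) - T (wder Z) - warit E (T Z) := rfl
  have hTmul (Y Z : WordFun U V R) : T (Y * Z) = T Y * T Z := subst_mul _ _ _
  have hTone : T 1 = 1 := subst_one _
  have hloc : IsLocal T := isLocal_subst Y Y'
  have key : Δ Z w = 0 := by
    refine eq_zero_of_dir hG.left hG.right T Δ ?_ ?_ ?_ ?_ Z w hw
    · exact ((isLocal_wder.comp hloc).sub (hloc.comp isLocal_wder)).sub
        ((isLocal_warit E).comp hloc)
    · intro Y Z
      simp only [hΔ', hTmul, warit_mul, wder_mul, map_add]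
      noncomm_ring
    · simp only [hΔ', wder_one, map_zero, hTone, warit_one, sub_zero]
    · intro v w hw
      set P := wder Y - (warit E Y + Y * E) with hP
      have hPG : ∀ w, G w → P w = 0 := fun w hw => by rw [hP, sub_apply, hE w hw, sub_self]
      have e1 : tau v Y * tau v Y' = 1 := by rw [← tau_mul, h, tau_one]
      have e2 : tau v Y' * tau v Y = 1 := by rw [← tau_mul, h', tau_one]
      have hder : wder (tau v Y') = -(tau v Y' * wder (tau v Y) * tau v Y') :=
        derivation_inv wder_mul wder_one e1 e2
      have hari : warit E (tau v Y') = -(tau v Y' * warit E (tau v Y) * tau v Y') :=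
        derivation_inv (warit_mul E) (warit_one E) e1 e2
      have hTd : T (dir v) = tau v Y * dir v * tau v Y' := subst_dir _ _ _
      have hτP : tau v P = wder (tau v Y) - (warit E (tau v Y) + tau v Y * tau v E) := by
        rw [hP, map_sub, map_add, tau_mul, tau_wder, warit_tau]
      -- With `P` the defect in the equation for `Y`, the defect on `dir v` is a difference of two
      -- triple products, each containing `P`. By `ker_dir` these are kernel values, and they vanish
      -- wherever `P` vanishes on the words satisfying `G`.
      have e3 : Δ (dir v) = tau v P * dir v * tau v Y' -
          tau v Y * dir v * tau v (Y' * P * Y') := by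
        have e4 : tau v Y' * (tau v Y * tau v E) * tau v Y' = tau v E * tau v Y' := by
          rw [← mul_assoc, e2, one_mul]
        rw [tau_mul, tau_mul, hτP]
        simp only [mul_sub, sub_mul, mul_add, add_mul, e4]
        rw [hΔ', wder_dir, hTd, wder_mul, wder_mul, wder_dir, warit_mul, warit_mul, warit_dir,
          hder, hari]
        noncomm_ring
      rw [e3, sub_apply, ← ker_dir, ← ker_dir, ker_vanish hG (Or.inl hPG) w hw,
        ker_vanish hG (Or.inr fun w hw => mul_vanish hG.left (vanish_mul hG.right hPG Y') Y' w hw)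
          w hw, sub_zero]
  rw [hΔ', sub_apply, sub_apply, sub_sub, sub_eq_zero] at key
  exact key

/-! ### Leading terms -/

/-- Merging blocks never lengthens a word. -/
theorem subst_vanish (κ : Kernel U V R) (Z : WordFun U V R) (w : List (U × V))
    (h : ∀ a : List (U × V), a.length ≤ w.length → Z a = 0) : subst κ Z w = 0 := by
  induction hn : w.length using Nat.strong_induction_on generalizing w Z with
  | _ n ih =>
    rw [subst_eq, add_apply, smul_apply, h [] (by simp), zero_mul, zero_add]
    have := conv_congr κ (G := fun l => subst κ (tail l Z)) (H := fun _ => (0 : R) • 1) w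
      fun l q hq => by
        rw [ih _ (hn ▸ hq) (tail l Z) q (fun a ha => h _ (by simp; omega)) rfl, zero_smul, zero_apply]
    rw [this, conv_smul, zero_smul, zero_apply]

/-- If `Z` vanishes on shorter words, every block must be a single letter, and it is then unchanged
because `A` and `B` are `1` at the empty word. -/
theorem subst_leading {A B : WordFun U V R} (hA : A [] = 1) (hB : B [] = 1) (Z : WordFun U V R)
    (w : List (U × V)) (h : ∀ a : List (U × V), a.length < w.length → Z a = 0) :
    subst (ker A B) Z w = Z w := by
  induction w generalizing Z with
  | nil => rfl
  | cons x w ih =>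
    rw [subst_eq, add_apply, conv_cons]
    have e1 : ker A B [x] (fun l => subst (ker A B) (tail l Z) w) =
        subst (ker A B) (tail x Z) w := by
      simp [ker_apply, splits, hA, hB, usum]
    have e2 : conv (fun p => ker A B (x :: p)) (fun l => subst (ker A B) (tail l Z)) w = 0 := by
      rw [conv_congr _ (H := fun _ => (0 : R) • 1) w fun l q hq => by
        rw [subst_vanish _ (tail l Z) q fun a ha => h _ (by simp; omega), zero_smul, zero_apply]]
      rw [conv_smul, zero_smul, zero_apply]
    rw [e1, e2, ih (tail x Z) fun a ha => h _ (by simp; omega)]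
    simp

/-! ### Inverses -/

theorem mk_winv_mul {X : WordFun U V R} (hX : X [] = 1) :
    (⟨winv X⟩ : WordFun U V R) * X = 1 := by
  ext w
  cases w with
  | nil => simp [mul_nil, winv, hX]
  | cons x w =>
    rw [mul_apply, Finset.sum_range_succ]
    rw [mk_apply, List.take_length, List.drop_length, winv.eq_1 X (x :: w), hX, one_cons,
      if_neg (List.cons_ne_nil x w), Finset.sum_range]
    simp

theorem winv_nil (X : List (U × V) → R) : winv X [] = 1 := by
  rw [winv, if_pos rfl]

/-- The left inverse `N` has itself a left inverse, which forces it to be two-sided. -/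
theorem mul_mk_winv {X : WordFun U V R} (hX : X [] = 1) :
    X * (⟨winv X⟩ : WordFun U V R) = 1 := by
  set N : WordFun U V R := ⟨winv X⟩ with hN
  have h1 : N * X = 1 := mk_winv_mul hX
  have h2 : (⟨winv N⟩ : WordFun U V R) * N = 1 := mk_winv_mul (winv_nil _)
  calc X * N = (⟨winv N⟩ * N) * (X * N) := by rw [h2, one_mul]
    _ = ⟨winv N⟩ * (N * X) * N := by noncomm_ring
    _ = 1 := by rw [h1, mul_one, h2]

end WordFun

end

end Flexion

/-! ### Identification of `amit`, `anit` and `gaxit` with the block operators -/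

namespace Flexion

noncomputable section

set_option linter.unusedSectionVars false

variable {U V R : Type*} [AddCommGroup U] [AddCommGroup V] [CommRing R]

namespace WordFun

/-- The factor `1` forces the distinguished letter to be the first of its block: the last letter of
`a` followed by `b`, as in `anit`. -/
theorem ker_one_left (B : WordFun U V R) (x : U × V) (c : List (U × V)) (f : U × V → R) :
    ker 1 B (x :: c) f = B (lsub x.2 c) * f (usum (x :: c), x.2) := by
  simp only [ker_apply, splits, List.map_cons, List.map_map, List.sum_cons]
  rw [list_sum_eq_zero fun t _ => by simp]
  simp

theorem splits_append_singleton {L : Type*} (a : List L) (x : L) :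
    splits (a ++ [x]) = (splits a).map (fun t => (t.1, t.2.1, t.2.2 ++ [x])) ++ [(a, x, [])] := by
  induction a with
  | nil => rfl
  | cons y a ih => simp [splits, ih, Function.comp_def]

theorem one_append_singleton (a : List (U × V)) (x : U × V) :
    (1 : WordFun U V R) (a ++ [x]) = 0 := by
  cases a <;> rfl

/-- Here the distinguished letter is the last of its block: `b` followed by the first letter of `c`,
as in `amit`. -/
theorem ker_one_right (A : WordFun U V R) (a : List (U × V)) (x : U × V) (f : U × V → R) :
    ker A 1 (a ++ [x]) f = A (lsub x.2 a) * f (usum (a ++ [x]), x.2) := by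
  simp only [ker_apply, splits_append_singleton, List.map_append, List.map_map, List.sum_append,
    List.map_cons, List.map_nil]
  rw [list_sum_eq_zero fun t _ => by simp [lsub, one_append_singleton]]
  simp

theorem wamit_eq (X Z : WordFun U V R) (w : List (U × V)) :
    wamit X Z w = deriv (ker X 1) Z w := by
  induction w generalizing Z with
  | nil => simp [wamit, deriv_nil]
  | cons x w ih =>
    rw [deriv_cons, ← ih]
    simp only [conv, mk_apply]
    rw [cuts_sum_eq fun p q => ker X 1 p fun l => tail l Z q, wamit, List.length_cons,
      Finset.sum_range_succ']
    -- The summands with `a ≠ ∅` keep the first letter and form the recursive term; those with `a =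
    -- ∅` replace a prefix and form the convolution.
    congr 1
    · simp [wamit, add_right_comm _ 1]
    · refine Finset.sum_congr rfl fun j hj => ?_
      have hj' : j < (x :: w).length := Finset.mem_range.1 hj
      generalize x :: w = w at hj'
      rw [List.take_succ_eq_append_getElem hj', ker_one_right]
      simp only [List.take_zero, List.drop_zero, zero_add, List.nil_append,
        List.drop_eq_getElem_cons hj']
      have hu : usum (w.take (j + 1)) = usum (w.take j) + w[j].1 := by
        rw [List.take_succ_eq_append_getElem hj', usum_append, usum_cons, usum_nil, add_zero]
      simp [ful, flr, lsub, hu, mul_comm]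

theorem fll_cons (x : U × V) {a : List (U × V)} (ha : a ≠ []) (b : List (U × V)) :
    fll (x :: a) b = fll a b := by
  obtain ⟨y, a, rfl⟩ := List.exists_cons_of_ne_nil ha
  simp [fll]

theorem fur_cons (x : U × V) {a : List (U × V)} (ha : a ≠ []) (b : List (U × V)) :
    fur (x :: a) b = x :: fur a b := by
  obtain ⟨y, a, rfl⟩ := List.exists_cons_of_ne_nil ha
  rfl

theorem wanit_eq (X Z : WordFun U V R) (w : List (U × V)) :
    wanit X Z w = deriv (ker 1 X) Z w := by
  induction w generalizing Z with
  | nil => simp [wanit, deriv_nil]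
  | cons x w ih =>
    rw [deriv_cons, ← ih]
    simp only [conv, mk_apply]
    rw [cuts_sum_eq fun p q => ker 1 X p fun l => tail l Z q, wanit, List.length_cons,
      Finset.sum_range_succ']
    congr 1
    · rw [wanit]
      refine Finset.sum_congr rfl fun i hi => ?_
      have hi' : w.take (i + 1) ≠ [] := by
        have := Finset.mem_range.1 hi
        rw [← List.length_pos_iff, List.length_take]
        omega
      simp only [List.take_succ_cons, fll_cons x hi', fur_cons x hi', Nat.add_sub_add_right,
        add_right_comm _ 1, List.drop_succ_cons, tail_apply, List.cons_append]
    · refine Finset.sum_congr rfl fun j hj => ?_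
      rw [List.take_succ_cons (i := j), ker_one_left]
      simp [fur, fll, lsub, usum_cons, mul_comm, add_comm _ 1]

/-! ### The sum over decompositions -/

section Decompositions

/-- The contribution of a decomposition to `wgaxit`. -/
def decompTerm (X Y Z : WordFun U V R)
    (D : List (List (U × V) × List (U × V) × List (U × V))) : R :=
  Z (D.map fun t => ful t.1 (fur t.2.1 t.2.2)).flatten *
    (D.map fun t => X (flr t.1 t.2.1)).prod * (D.map fun t => Y (fll t.2.1 t.2.2)).prod

/-- The decomposition of `a x c q` obtained from the triple `(a, x, c)` and a decomposition of
`q`. -/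
def glue (a : List (U × V)) (x : U × V) (c : List (U × V)) :
    List (List (U × V) × List (U × V) × List (U × V)) →
      List (List (U × V) × List (U × V) × List (U × V))
  | [] => [(a, [x], c)]
  | t :: D => if c = [] ∧ t.1 = [] then (a, x :: t.2.1, t.2.2) :: D else (a, [x], c) :: t :: D

/-- A middle factor `b` is read as a run of blocks: its first letter carries `a`, its last carries
`c`, the others stand alone. `glue` restores the run, merging exactly when `c` and the next `a` are
both empty, the case excluded by the chain condition. -/
theorem isDecomp_glue {a c q : List (U × V)} {x : U × V}
    {D : List (List (U × V) × List (U × V) × List (U × V))} (hD : IsDecomp q D) :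
    IsDecomp (a ++ x :: c ++ q) (glue a x c D) := by
  obtain ⟨rfl, h2, h3⟩ := hD
  rcases D with _ | ⟨t, D⟩
  · simp [glue, IsDecomp]
  · rw [glue]
    split_ifs with h
    · obtain ⟨rfl, ht⟩ := h
      refine ⟨by simp [ht], ?_, ?_⟩
      · intro s hs
        rcases List.mem_cons.1 hs with rfl | hs
        · simp
        · exact h2 s (List.mem_cons_of_mem _ hs)
      · rcases D with _ | ⟨s, D⟩
        · exact List.isChain_singleton _
        · rw [List.isChain_cons_cons] at h3 ⊢
          exact h3
    · refine ⟨by simp, ?_, ?_⟩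
      · intro s hs
        rcases List.mem_cons.1 hs with rfl | hs
        · simp
        · exact h2 s hs
      · rw [List.isChain_cons_cons]
        refine ⟨fun e => h ?_, h3⟩
        simpa using e

/-- The first letter of the first middle factor is split off. If letters remain in that factor, the
block gets `c = []` and the remaining triple starts with an empty `a`. -/
theorem exists_glue {w : List (U × V)} (hw : w ≠ [])
    {D : List (List (U × V) × List (U × V) × List (U × V))} (hD : IsDecomp w D) :
    ∃ a x c q D', w = a ++ x :: c ++ q ∧ IsDecomp q D' ∧ glue a x c D' = D := by
  obtain ⟨rfl, h2, h3⟩ := hD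
  rcases D with _ | ⟨⟨a, b, c⟩, D⟩
  · simp at hw
  have hb : b ≠ [] := h2 (a, b, c) (by simp)
  obtain ⟨x, b, rfl⟩ := List.exists_cons_of_ne_nil hb
  by_cases hb' : b = []
  · subst hb'
    refine ⟨a, x, c, (D.map fun t => t.1 ++ t.2.1 ++ t.2.2).flatten, D, by simp, ⟨rfl, fun s hs => h2 s (List.mem_cons_of_mem _ hs),
      h3.tail⟩, ?_⟩
    rcases D with _ | ⟨t, D⟩
    · rfl
    · rw [glue, if_neg]
      rintro ⟨rfl, ht⟩
      exact (List.isChain_cons_cons.1 h3).1 (by simp [ht])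
  · refine ⟨a, x, [], b ++ c ++ (D.map fun t => t.1 ++ t.2.1 ++ t.2.2).flatten, ([], b, c) :: D, by simp,
      ⟨by simp, ?_, ?_⟩, by simp [glue]⟩
    · intro s hs
      rcases List.mem_cons.1 hs with rfl | hs
      · exact hb'
      · exact h2 s (List.mem_cons_of_mem _ hs)
    · rcases D with _ | ⟨s, D⟩
      · exact List.isChain_singleton _
      · rw [List.isChain_cons_cons] at h3 ⊢
        exact h3

/-- Middle factors of `D` are nonempty, so a merged one has at least two letters and cannot be
confused with the singleton of the unmerged case. -/
theorem glue_injective {a a' c c' q q' : List (U × V)} {x x' : U × V}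
    {D D' : List (List (U × V) × List (U × V) × List (U × V))} (hD : IsDecomp q D)
    (hD' : IsDecomp q' D') (h : glue a x c D = glue a' x' c' D') :
    a = a' ∧ x = x' ∧ c = c' ∧ D = D' := by
  have h1 := hD.2.1
  have h2 := hD'.2.1
  rcases D with _ | ⟨⟨a1, b1, c1⟩, D⟩ <;> rcases D' with _ | ⟨⟨a2, b2, c2⟩, D'⟩
  · simpa [glue] using h
  · have := h2 _ List.mem_cons_self
    simp only [glue] at h
    split_ifs at h with e <;> simp_all
  · have := h1 _ List.mem_cons_self
    simp only [glue] at h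
    split_ifs at h with e <;> simp_all
  · have := h1 _ List.mem_cons_self
    have := h2 _ List.mem_cons_self
    simp only [glue] at h
    split_ifs at h with e e' <;> simp_all

/-- A merged pair of triples omits one factor `Y(∅)` and one factor `X(∅)`; both are `1`. -/
theorem decompTerm_glue {X Y Z : WordFun U V R} (hX : X [] = 1) (hY : Y [] = 1)
    {a c q : List (U × V)} {x : U × V}
    {D : List (List (U × V) × List (U × V) × List (U × V))} (hD : IsDecomp q D) :
    decompTerm X Y Z (glue a x c D) = X (lsub x.2 a) * Y (lsub x.2 c) *
      decompTerm X Y (tail (usum (a ++ x :: c), x.2) Z) D := by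
  have h1 : flr a [x] = lsub x.2 a := rfl
  have h2 : fll [x] c = lsub x.2 c := rfl
  have h3 : ful a (fur [x] c) = [(usum (a ++ x :: c), x.2)] := by
    simp [ful, fur, usum_append, usum_cons]
  rcases D with _ | ⟨⟨a', b, c'⟩, D⟩
  · simp [glue, decompTerm, h1, h2, h3]
    ring
  · rw [glue]
    split_ifs with h
    · obtain ⟨rfl, h⟩ := h
      obtain rfl : a' = [] := h
      have hb : b ≠ [] := hD.2.1 _ List.mem_cons_self
      have h4 : ful a (fur (x :: b) c') = (usum (a ++ [x]), x.2) :: fur b c' := by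
        rw [fur_cons x hb]
        simp [ful, usum_append, usum_cons, usum_nil]
      have h5 : ful [] (fur b c') = fur b c' := by
        cases fur b c' <;> simp [ful, usum_nil]
      have h6 : flr a (x :: b) = lsub x.2 a := rfl
      have h7 : flr [] b = [] := by cases b <;> rfl
      simp [decompTerm, h4, h5, h6, h7, fll_cons x hb, hX, hY]
      ring
    · simp [decompTerm, h1, h2, h3]
      ring

theorem wgaxit_eq {X Y : WordFun U V R} (hX : X [] = 1) (hY : Y [] = 1) (Z : WordFun U V R)
    (w : List (U × V)) : wgaxit X Y Z w = subst (ker X Y) Z w := by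
  change ∑ D ∈ decomps w, decompTerm X Y Z D = _
  induction hn : w.length using Nat.strong_induction_on generalizing w Z with
  | _ n ih =>
    by_cases h0 : w = []
    · subst h0
      have : decomps ([] : List (U × V)) = {[]} := by
        ext D
        rw [mem_decomps, Finset.mem_singleton]
        constructor
        · intro hD; simpa using hD.length_le
        · rintro rfl; simp [IsDecomp]
      rw [this]
      simp [decompTerm, subst_nil]
    have e1 : subst (ker X Y) Z w = conv (ker X Y)
        (fun l => ⟨fun q => ∑ D ∈ decomps q, decompTerm X Y (tail l Z) D⟩) w := by
      rw [subst_eq, add_apply, conv_congr (H := fun l =>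
        ⟨fun q => ∑ D ∈ decomps q, decompTerm X Y (tail l Z) D⟩) _ _ fun l q hq =>
          (ih _ (hn ▸ hq) (tail l Z) q rfl).symm]
      obtain ⟨x, w, rfl⟩ := List.exists_cons_of_ne_nil h0
      simp
    rw [e1]
    simp only [conv, mk_apply, ker_apply]
    rw [cuts_sum_eq fun p q => ((splits p).map fun t => X (lsub t.2.1.2 t.1) *
      Y (lsub t.2.1.2 t.2.2) * ∑ D ∈ decomps q, decompTerm X Y (tail (usum p, t.2.1.2) Z) D).sum]
    have e2 (j : ℕ) := splits_sum_eq (fun a x c => X (lsub x.2 a) * Y (lsub x.2 c) *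
      ∑ D ∈ decomps (w.drop (j + 1)),
        decompTerm X Y (tail (usum (w.take (j + 1)), x.2) Z) D) (w.take (j + 1)) 0
    rw [Finset.sum_congr rfl fun j _ => e2 j]
    simp only [Finset.mul_sum]
    rw [Finset.sum_congr rfl fun j _ => Finset.sum_sigma' _ _ _, Finset.sum_sigma']
    have hp (j i : ℕ) (hi : i < (w.take (j + 1)).length) : w.take (j + 1) =
        (w.take (j + 1)).take i ++ (w.take (j + 1)).getD i 0 :: (w.take (j + 1)).drop (i + 1) := by
      rw [List.getD_eq_getElem _ _ hi, ← List.drop_eq_getElem_cons hi, List.take_append_drop]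
    symm
    -- The index consists of `j`, where `j + 1` is the length of the first block, the position `i`
    -- of its distinguished letter, and a decomposition of the rest.
    refine Finset.sum_bij (fun z _ => glue ((w.take (z.1 + 1)).take z.2.1)
      ((w.take (z.1 + 1)).getD z.2.1 0) ((w.take (z.1 + 1)).drop (z.2.1 + 1)) z.2.2) ?_ ?_ ?_ ?_
    · rintro ⟨j, i, D⟩ h
      simp only [Finset.mem_sigma, Finset.mem_range, mem_decomps] at h ⊢
      have := isDecomp_glue (a := (w.take (j + 1)).take i) (x := (w.take (j + 1)).getD i 0)
        (c := (w.take (j + 1)).drop (i + 1)) h.2.2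
      rwa [← hp j i h.2.1, List.take_append_drop] at this
    · rintro ⟨j, i, D⟩ h ⟨j', i', D'⟩ h' e
      simp only [Finset.mem_sigma, Finset.mem_range, mem_decomps] at h h'
      obtain ⟨e1, -, e3, rfl⟩ := glue_injective h.2.2 h'.2.2 e
      replace e1 := congrArg List.length e1
      replace e3 := congrArg List.length e3
      simp only [List.length_take, List.length_drop] at e1 e3 h h'
      obtain rfl : i = i' := by omega
      obtain rfl : j = j' := by omega
      rfl
    · intro D hD
      obtain ⟨a, x, c, q, D', rfl, hD', rfl⟩ := exists_glue h0 (mem_decomps.1 hD)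
      have e3 : (a ++ x :: c ++ q).take (a.length + c.length + 1) = a ++ x :: c := by
        rw [List.take_left' (by simp; omega)]
      have e4 : (a ++ x :: c ++ q).drop (a.length + c.length + 1) = q := by
        rw [List.drop_left' (by simp; omega)]
      refine ⟨⟨a.length + c.length, a.length, D'⟩, ?_, ?_⟩
      · simp only [Finset.mem_sigma, Finset.mem_range, mem_decomps, e3, e4]
        exact ⟨by simp, by simp, hD'⟩
      · simp only [e3]
        simp
    · rintro ⟨j, i, D⟩ h
      simp only [Finset.mem_sigma, Finset.mem_range, mem_decomps] at h
      rw [decompTerm_glue hX hY h.2.2, ← hp j i h.2.1]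

end Decompositions

end WordFun

end

end Flexion

/-! ### Words with independent layers, and representation of bimould operations by functions on
words -/

namespace Flexion

noncomputable section

set_option linter.unusedSectionVars false

/-! ### Words of independent letters -/

/-- Every list of integers of the right length is the list of values of an additive map. -/
def Independent {M : Type*} [AddCommGroup M] (l : List M) : Prop :=
  ∀ t : List ℤ, t.length = l.length → ∃ f : M →+ ℤ, l.map f = t

theorem exists_eq_append {α : Type*} {t : List α} {m n : ℕ} (h : t.length = m + n) :
    ∃ t₁ t₂, t = t₁ ++ t₂ ∧ t₁.length = m ∧ t₂.length = n :=
  ⟨t.take m, t.drop m, (List.take_append_drop m t).symm, by simp; omega, by simp; omega⟩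

namespace Independent

variable {M : Type*} [AddCommGroup M]

/-- A functional with values `t'` on `l'` is obtained by prescribing values `t` on `l` that force
them. -/
theorem of_transfer {l l' : List M} (h : Independent l)
    (H : ∀ t' : List ℤ, t'.length = l'.length → ∃ t : List ℤ, t.length = l.length ∧
      ∀ f : M →+ ℤ, l.map f = t → l'.map f = t') : Independent l' := by
  intro t' ht'
  obtain ⟨t, ht, h'⟩ := H t' ht'
  obtain ⟨f, hf⟩ := h t ht
  exact ⟨f, h' f hf⟩

theorem left {a b : List M} (h : Independent (a ++ b)) : Independent a :=
  h.of_transfer fun t ht => ⟨t ++ List.replicate b.length 0, by simp [ht], fun f hf => by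
    rw [List.map_append] at hf
    exact List.append_inj_left hf (by simp [ht])⟩

theorem right {a b : List M} (h : Independent (a ++ b)) : Independent b :=
  h.of_transfer fun t ht => ⟨List.replicate a.length 0 ++ t, by simp [ht], fun f hf => by
    rw [List.map_append] at hf
    exact List.append_inj_right hf (by simp)⟩

theorem sum_eq_zero_of_map {a : List M} {f : M →+ ℤ} {n : ℕ}
    (h : a.map f = List.replicate n 0) : f a.sum = 0 := by
  rw [map_list_sum, h]
  simp

theorem merge {s a c q : List M} {x y : M} (h : Independent (s ++ (a ++ x :: c ++ q)))
    (hy : y = x ∨ y = (a ++ x :: c).sum) : Independent (s ++ y :: q) := by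
  refine h.of_transfer fun t ht => ?_
  obtain ⟨t₁, t₂, rfl, h1, h2⟩ := exists_eq_append (ht.trans (List.length_append))
  obtain ⟨k, t₂, rfl⟩ := List.exists_cons_of_length_eq_add_one h2
  -- Giving `x` the value `k` and its neighbours in the block the value `0` makes both `x` and the
  -- sum of the block take the value `k`. The two alternatives serve the lower and the upper layer.
  refine ⟨t₁ ++ (List.replicate a.length 0 ++ k :: List.replicate c.length 0 ++ t₂), ?_, ?_⟩
  · simp at h2 ⊢
    omega
  · intro f hf
    simp only [List.map_append, List.map_cons] at hf ⊢
    obtain ⟨e1, e2⟩ := List.append_inj hf (by simp [h1])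
    obtain ⟨e2, e3⟩ := List.append_inj e2 (by simp)
    obtain ⟨e4, e5⟩ := List.append_inj e2 (by simp)
    obtain ⟨e5, e6⟩ := List.cons_eq_cons.1 e5
    have : f y = k := by
      rcases hy with rfl | rfl
      · exact e5
      · rw [List.sum_append, List.sum_cons, map_add, map_add, sum_eq_zero_of_map e4,
          sum_eq_zero_of_map e6, e5]
        simp
    rw [e1, e3, this]

theorem sub_left {a c : List M} {x : M} (h : Independent (a ++ x :: c)) :
    Independent (a.map fun y => y - x) := by
  -- With value `0` on `x`, subtracting `x` does not change the values on `a`.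
  refine h.of_transfer fun t ht => ⟨t ++ 0 :: List.replicate c.length 0, by simpa using ht, ?_⟩
  intro f hf
  simp only [List.map_append, List.map_cons] at hf
  obtain ⟨e1, e2⟩ := List.append_inj hf (by simpa using ht.symm)
  rw [List.map_map, ← e1]
  refine List.map_congr_left fun y _ => ?_
  simp [(List.cons_eq_cons.1 e2).1]

theorem sub_right {a c : List M} {x : M} (h : Independent (a ++ x :: c)) :
    Independent (c.map fun y => y - x) := by
  refine h.of_transfer fun t ht => ⟨List.replicate a.length 0 ++ 0 :: t, by simpa using ht, ?_⟩
  intro f hf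
  simp only [List.map_append, List.map_cons] at hf
  obtain ⟨e1, e2⟩ := List.append_inj hf (by simp)
  obtain ⟨e2, e3⟩ := List.cons_eq_cons.1 e2
  rw [List.map_map, ← e3]
  refine List.map_congr_left fun y _ => ?_
  simp [e2]

theorem map {N : Type*} [AddCommGroup N] {l : List M} (h : Independent l) (g : M →+ N)
    (g' : N →+ M) (hg : ∀ x, g' (g x) = x) : Independent (l.map g) := by
  intro t ht
  obtain ⟨f, hf⟩ := h t (by simpa using ht)
  exact ⟨f.comp g', by simpa [Function.comp_def, hg] using hf⟩

end Independent

/-- The columns of a right inverse are functionals dual to the rows of `P`; conversely such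
functionals, evaluated on the standard basis, form a right inverse. -/
theorem isSplit_iff {r n : ℕ} (P : Matrix (Fin r) (Fin n) ℤ) :
    IsSplit P ↔ ∀ t : Fin r → ℤ, ∃ f : (Fin n → ℤ) →+ ℤ, ∀ i, f (P i) = t i := by
  constructor
  · rintro ⟨P', h⟩ t
    refine ⟨AddMonoidHom.mk' (fun v => v ⬝ᵥ P'.mulVec t) fun v w => add_dotProduct v w _,
      fun i => ?_⟩
    change (P.mulVec (P'.mulVec t)) i = t i
    rw [Matrix.mulVec_mulVec, h, Matrix.one_mulVec]
  · intro h
    choose f hf using fun k : Fin r => h (Pi.single k 1)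
    refine ⟨Matrix.of fun j k => f k (Pi.single j 1), ?_⟩
    ext i k
    have h1 : P i = ∑ j, P i j • (Pi.single j 1 : Fin n → ℤ) := pi_eq_sum_univ' (P i)
    have h2 : f k (P i) = ∑ j, P i j * f k (Pi.single j 1) := by
      conv_lhs => rw [h1]
      simp only [map_sum, map_zsmul, smul_eq_mul]
    have h3 := hf k i
    rw [Pi.single_apply] at h3
    rw [Matrix.mul_apply, Matrix.one_apply, ← h3, h2]
    rfl

theorem isSplit_iff_independent {n r : ℕ} (l : List (Fin n → ℤ)) (P : Matrix (Fin r) (Fin n) ℤ)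
    (hr : l.length = r) (h : ∀ i : Fin r, l.get (i.cast hr.symm) = P i) :
    IsSplit P ↔ Independent l := by
  subst hr
  rw [isSplit_iff]
  constructor
  · intro H t ht
    obtain ⟨f, hf⟩ := H fun i => t.get (i.cast ht.symm)
    refine ⟨f, List.ext_get (by simp [ht]) fun i h1 h2 => ?_⟩
    have := hf ⟨i, by simpa using h1⟩
    rw [← h] at this
    simpa using this
  · intro H t
    obtain ⟨f, hf⟩ := H (List.ofFn t) (by simp)
    refine ⟨f, fun i => ?_⟩
    have h1 : (l.map f)[(i : ℕ)]? = (List.ofFn t)[(i : ℕ)]? := by rw [hf]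
    rw [← h]
    simpa using h1

/-- Both layers of the word consist of independent vectors. -/
def Good {U V : Type*} [AddCommGroup U] [AddCommGroup V] (w : List (U × V)) : Prop :=
  Independent (w.map Prod.fst) ∧ Independent (w.map Prod.snd)

theorem flexClosed_good {U V : Type*} [AddCommGroup U] [AddCommGroup V] :
    FlexClosed (Good : List (U × V) → Prop) where
  left a b h := by
    simp only [Good, List.map_append] at h
    exact ⟨h.1.left, h.2.left⟩
  right a b h := by
    simp only [Good, List.map_append] at h
    exact ⟨h.1.right, h.2.right⟩
  merge s a x c q h := by
    simp only [Good, List.map_append, List.map_cons] at h ⊢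
    exact ⟨h.1.merge (Or.inr (by simp [usum])), h.2.merge (Or.inl rfl)⟩
  lsub_left a x c h := by
    simp only [Good, List.map_append, List.map_cons, WordFun.lsub, List.map_map] at h ⊢
    refine ⟨h.1.left, ?_⟩
    have := h.2.sub_left
    rwa [List.map_map] at this
  lsub_right a x c h := by
    simp only [Good, List.map_append, List.map_cons, WordFun.lsub, List.map_map] at h ⊢
    refine ⟨(h.1.right).right (a := [x.1]), ?_⟩
    have := h.2.sub_right
    rwa [List.map_map] at this

theorem good_iff {n : ℕ} (w : Word n) : Good w ↔ IsSplit (umat w) ∧ IsSplit (vmat w) := by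
  rw [Good, isSplit_iff_independent (w.map Prod.fst) (umat w) (by simp) (by simp [umat]; intro; rfl),
    isSplit_iff_independent (w.map Prod.snd) (vmat w) (by simp) (by simp [vmat]; intro; rfl)]

theorem good_gen (r : ℕ) : Good (gen r) := by
  have h : Independent (List.ofFn fun i : Fin r => (Pi.single i 1 : Fin r → ℤ)) := by
    rw [← isSplit_iff_independent _ (1 : Matrix (Fin r) (Fin r) ℤ) (by simp) fun i => ?_]
    · exact isSplit_one r
    · ext j
      simp [Matrix.one_apply, Pi.single_apply, eq_comm]
  constructor <;> · rw [gen, List.map_ofFn]; exact h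

/-- Multiplication of row vectors by a matrix. -/
def rowMul {r n : ℕ} (P : Matrix (Fin r) (Fin n) ℤ) : (Fin r → ℤ) →+ (Fin n → ℤ) where
  toFun x := Matrix.vecMul x P
  map_zero' := Matrix.zero_vecMul P
  map_add' x y := Matrix.add_vecMul P x y

theorem exists_rowMul_inverse {r n : ℕ} {P : Matrix (Fin r) (Fin n) ℤ} (hP : IsSplit P) :
    ∃ g : (Fin n → ℤ) →+ (Fin r → ℤ), ∀ x, g (rowMul P x) = x := by
  obtain ⟨P', h⟩ := hP
  exact ⟨rowMul P', fun x => by simp [rowMul, Matrix.vecMul_vecMul, h]⟩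

/-- The substitution of letters given by a pair of matrices. -/
abbrev wordMap {r n : ℕ} (P Q : Matrix (Fin r) (Fin n) ℤ) :
    (Fin r → ℤ) × (Fin r → ℤ) → (Fin n → ℤ) × (Fin n → ℤ) :=
  letterMap (rowMul P) (rowMul Q) 0

theorem good_map {r n : ℕ} {P Q : Matrix (Fin r) (Fin n) ℤ} (hP : IsSplit P) (hQ : IsSplit Q)
    {w : Word r} (hw : Good w) : Good (w.map (wordMap P Q)) := by
  obtain ⟨g, hg⟩ := exists_rowMul_inverse hP
  obtain ⟨g', hg'⟩ := exists_rowMul_inverse hQ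
  have h1 := hw.1.map (rowMul P) g hg
  have h2 := hw.2.map (rowMul Q) g' hg'
  simp only [Good, List.map_map] at h1 h2 ⊢
  refine ⟨h1, ?_⟩
  convert h2 using 2
  ext x : 1
  simp [letterMap]

theorem gen_map {n : ℕ} (w : Word n) : (gen w.length).map (wordMap (umat w) (vmat w)) = w := by
  rw [gen, List.map_ofFn]
  conv_rhs => rw [← List.ofFn_get w]
  congr 1
  ext i j
  · simp [letterMap, rowMul, umat]
  · simp [letterMap, rowMul, vmat]

section Values

variable {K : Type*} [Field K] {F : Deck K}

/-- On good words the default value in `Bimould.val` does not occur, and this is functoriality of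
the deck. -/
theorem val_map (M : Bimould F) {r n : ℕ} {P Q : Matrix (Fin r) (Fin n) ℤ} (hP : IsSplit P)
    (hQ : IsSplit Q) {w : Word r} (hw : Good w) :
    F.subst P Q hP hQ (M.val w) = M.val (w.map (wordMap P Q)) := by
  have hw' := (good_iff w).1 hw
  have h1 (P₁ : Matrix (Fin w.length) (Fin r) ℤ) (P₂ : Matrix (Fin r) (Fin n) ℤ)
      (h₁ : IsSplit P₁) (h₂ : IsSplit P₂) : IsSplit (P₁ * P₂) := by
    obtain ⟨A, hA⟩ := h₁
    obtain ⟨B, hB⟩ := h₂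
    exact ⟨B * A, by rw [Matrix.mul_assoc, ← Matrix.mul_assoc P₂, hB, Matrix.one_mul, hA]⟩
  rw [val_eq_of_length M (w.map (wordMap P Q)) (r := w.length) (by simp) (umat w * P) (vmat w * Q)
    (h1 _ _ hw'.1 hP) (h1 _ _ hw'.2 hQ), F.subst_mul _ _ _ _ hw'.1 hw'.2 hP hQ, Bimould.val,
    dif_pos hw']
  · rfl
  · intro i
    ext j
    simp [letterMap, rowMul, umat, Matrix.mul_apply, Matrix.vecMul, dotProduct]
  · intro i
    ext j
    simp [letterMap, rowMul, vmat, Matrix.mul_apply, Matrix.vecMul, dotProduct]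

/-- Functions on words in `n` pairs of variables. -/
abbrev DeckFun (F : Deck K) (n : ℕ) : Type _ := WordFun (Fin n → ℤ) (Fin n → ℤ) (F.F n)

/-- The bimould `M` takes the values `f` on good words. -/
def Represents (M : Bimould F) {n : ℕ} (f : DeckFun F n) : Prop := ∀ w : Word n, Good w → M.val w = f w

/-- The function on words defined by a bimould. -/
def valFun (M : Bimould F) (n : ℕ) : DeckFun F n := ⟨M.val⟩

theorem represents_valFun (M : Bimould F) (n : ℕ) : Represents M (valFun M n) := fun _ _ => rfl

/-- The generic word `gen r` is good and recovers `M r`, so equality of representing functions on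
good words is enough. -/
theorem eq_of_represents {M N : Bimould F} {f g : ∀ n, DeckFun F n}
    (hM : ∀ n, Represents M (f n)) (hN : ∀ n, Represents N (g n))
    (h : ∀ n, ∀ w : Word n, Good w → f n w = g n w) : M = N := by
  ext r
  rw [← val_gen M r, ← val_gen N r, hM r _ (good_gen r), hN r _ (good_gen r),
    h r _ (good_gen r)]

variable {n : ℕ}

/-- Every good word is the image of a generic word under its own coefficient matrices. -/
theorem represents_of_natural {M : Bimould F} {f : DeckFun F n}
    (h : ∀ (r : ℕ) (P Q : Matrix (Fin r) (Fin n) ℤ) (hP : IsSplit P) (hQ : IsSplit Q),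
      F.subst P Q hP hQ (M r) = f ((gen r).map (wordMap P Q))) : Represents M f := by
  intro w hw
  have hw' := (good_iff w).1 hw
  rw [Bimould.val, dif_pos hw', h, gen_map]

namespace Represents

variable {A B : Bimould F} {a b : DeckFun F n}

theorem natural (hA : Represents A a) {r : ℕ} {P Q : Matrix (Fin r) (Fin n) ℤ}
    (hP : IsSplit P) (hQ : IsSplit Q) (w : Word r) (hw : Good w) :
    (F.subst P Q hP hQ : F.F r →+* F.F n) (valFun A r w) = a (w.map (wordMap P Q)) := by
  rw [← hA _ (good_map hP hQ hw), ← val_map A hP hQ hw]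
  rfl

theorem one_natural {r : ℕ} {P Q : Matrix (Fin r) (Fin n) ℤ} (φ : F.F r →+* F.F n) (w : Word r) :
    φ ((1 : DeckFun F r) w) = (1 : DeckFun F n) (w.map (wordMap P Q)) := by
  cases w <;> simp

theorem mu (hA : Represents A a) (hB : Represents B b) : Represents (mu A B) (a * b) :=
  represents_of_natural fun r _ _ hP hQ =>
    WordFun.mul_natural _ flexClosed_good.left flexClosed_good.right (hA.natural hP hQ)
      (hB.natural hP hQ) (gen r) (good_gen r)

theorem amit (hA : Represents A a) (hB : Represents B b) :
    Represents (amit A B) (WordFun.deriv (WordFun.ker a 1) b) :=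
  represents_of_natural fun r _ _ hP hQ => by
    rw [Flexion.amit]
    rw [show wamit A.val B.val (gen r) = _ from
      WordFun.wamit_eq (valFun A r) (valFun B r) (gen r)]
    exact WordFun.deriv_natural flexClosed_good (hA.natural hP hQ)
      (fun w _ => one_natural _ w) (hB.natural hP hQ) (gen r) (good_gen r)

theorem anit (hA : Represents A a) (hB : Represents B b) :
    Represents (anit A B) (WordFun.deriv (WordFun.ker 1 a) b) :=
  represents_of_natural fun r _ _ hP hQ => by
    rw [Flexion.anit]
    rw [show wanit A.val B.val (gen r) = _ from
      WordFun.wanit_eq (valFun A r) (valFun B r) (gen r)]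
    exact WordFun.deriv_natural flexClosed_good (fun w _ => one_natural _ w)
      (hA.natural hP hQ) (hB.natural hP hQ) (gen r) (good_gen r)

theorem add (hA : Represents A a) (hB : Represents B b) : Represents (A + B) (a + b) :=
  fun w hw => by rw [val_add, hA w hw, hB w hw]; rfl

theorem sub (hA : Represents A a) (hB : Represents B b) : Represents (A - B) (a - b) :=
  fun w hw => by
    have h : A - B = A + (-1 : K) • B := by rw [neg_one_smul, sub_eq_add_neg]
    rw [h, val_add, val_smul, hA w hw, hB w hw, neg_one_smul, ← sub_eq_add_neg]
    rfl

theorem arit (hA : Represents A a) (hB : Represents B b) :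
    Represents (arit A B) (WordFun.warit a b) :=
  (hA.amit hB).sub (hA.anit hB)

theorem preari (hA : Represents A a) (hB : Represents B b) :
    Represents (preari A B) (WordFun.warit b a + a * b) :=
  (hB.arit hA).add (hA.mu hB)

theorem ari (hA : Represents A a) (hB : Represents B b) :
    Represents (ari A B) (WordFun.wari a b) :=
  (hA.preari hB).sub (hB.preari hA)

theorem der (hA : Represents A a) : Represents (der A) (WordFun.wder a) :=
  represents_of_natural fun r P Q hP hQ => by
    have h := hA.natural hP hQ (gen r) (good_gen r)
    rw [WordFun.wder_apply, ← h, Flexion.der, map_nsmul, nsmul_eq_mul, List.length_map, gen_length]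
    congr 1
    change _ = F.subst P Q hP hQ (A.val (gen r))
    rw [val_gen]

theorem invmu (hA : Represents A a) : Represents (invmu A) (⟨winv a⟩ : DeckFun F n) :=
  represents_of_natural fun r _ _ hP hQ =>
    WordFun.winv_natural _ flexClosed_good.left flexClosed_good.right (hA.natural hP hQ)
      (gen r) (good_gen r)

theorem nil (hA : Represents A a) (h : A 0 = 1) : a [] = 1 := by
  rw [← hA [] (flexClosed_good.left [] _ (good_gen n)), val_nil_of_eq_one h]

theorem garit (hA : Represents A a) (h : A 0 = 1) (hB : Represents B b) :
    Represents (garit A B) (WordFun.subst (WordFun.ker a ⟨winv a⟩) b) :=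
  represents_of_natural fun r _ _ hP hQ => by
    have h1 : valFun A r [] = 1 := val_nil_of_eq_one h r
    have h2 : valFun (Flexion.invmu A) r [] = 1 :=
      val_nil_of_eq_one (by rw [Flexion.invmu, gen, List.ofFn_zero, WordFun.winv_nil]) r
    rw [Flexion.garit, gaxit]
    rw [show wgaxit A.val (Flexion.invmu A).val B.val (gen r) = _ from
      WordFun.wgaxit_eq h1 h2 (valFun B r) (gen r)]
    exact WordFun.subst_natural flexClosed_good (hA.natural hP hQ)
      (hA.invmu.natural hP hQ) (hB.natural hP hQ) (gen r) (good_gen r)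

end Represents

theorem represents_unit (n : ℕ) : Represents (unit F) (1 : DeckFun F n) :=
  represents_of_natural fun r P Q hP hQ => by
    cases r with
    | zero => simp [unit, gen]
    | succ r => simp [unit, gen]

end Values

end

end Flexion

/-! ### The two structural identities for bimoulds, and the length grading -/

namespace Flexion

noncomputable section

set_option linter.unusedSectionVars false

variable {K : Type*} [Field K] {F : Deck K}

-- Expanding with the Leibniz rule for `warit` leaves exactly the commutator of the two derivations,
-- which is `warit_commutator`.
open WordFun in
theorem preari_preari_sub (X A D : Bimould F) :
    preari (preari X D) A - preari (preari X A) D = preari X (ari D A) := by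
  refine eq_of_represents
    (fun n => (((represents_valFun X n).preari (represents_valFun D n)).preari
      (represents_valFun A n)).sub (((represents_valFun X n).preari (represents_valFun A n)).preari
      (represents_valFun D n)))
    (fun n => (represents_valFun X n).preari ((represents_valFun D n).ari (represents_valFun A n)))
    fun n w _ => ?_
  generalize valFun X n = x
  generalize valFun A n = a
  generalize valFun D n = d
  congr 1
  rw [← warit_commutator]
  simp only [map_add, warit_mul, wari]
  noncomm_ring

theorem preari_unit (A : Bimould F) : preari (unit F) A = A := by
  refine eq_of_represents (fun n => (represents_unit n).preari (represents_valFun A n))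
    (fun n => represents_valFun A n) fun n w _ => ?_
  rw [WordFun.warit_one, one_mul, zero_add]

-- By `wder_subst`, `garit(Y)` commutes with `der` up to `arit(E)`. Multiplying by `Y` and using the
-- equation for `Y`, the two contributions of `arit(E)` combine by the Leibniz rule into `arit(E)`
-- of the product.
open WordFun in
theorem der_gari {X Y E : Bimould F} (h : Y 0 = 1) (hE : der Y = preari Y E) :
    der (gari X Y) = gari (der X) Y + preari (gari X Y) E := by
  have rX n := represents_valFun X n
  have rY n := represents_valFun Y n
  have rE n := represents_valFun E n
  have rG n := ((rY n).garit h (rX n)).mu (rY n)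
  refine eq_of_represents (fun n => (rG n).der)
    (fun n => (((rY n).garit h (rX n).der).mu (rY n)).add ((rG n).preari (rE n))) fun n w hw => ?_
  have hy : valFun Y n [] = 1 := (rY n).nil h
  have hEG : ∀ w : Word n, Good w →
      wder (valFun Y n) w = (warit (valFun E n) (valFun Y n) + valFun Y n * valFun E n) w := by
    intro w hw
    rw [← (rY n).der w hw, ← ((rY n).preari (rE n)) w hw, hE]
  have key := wder_subst flexClosed_good (mul_mk_winv hy) (mk_winv_mul hy) hEG (valFun X n)
  set T := subst (ker (valFun Y n) ⟨winv (valFun Y n)⟩) with hT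
  generalize valFun Y n = y at *
  generalize valFun E n = e at *
  generalize valFun X n = x at *
  -- Both equations are known only on good words, so they are multiplied in the form of defects:
  -- factors of good words are good, and a product containing a defect still vanishes there.
  have h1 : ∀ w, Good w → (wder (T x) - (T (wder x) + warit e (T x))) w = 0 := fun w hw => by
    rw [WordFun.sub_apply, key w hw, sub_self]
  have h2 : ∀ w, Good w → (wder y - (warit e y + y * e)) w = 0 := fun w hw => by
    rw [WordFun.sub_apply, hEG w hw, sub_self]
  have h3 := mul_vanish flexClosed_good.left h1 y w hw
  have h4 := vanish_mul flexClosed_good.right h2 (T x) w hw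
  rw [← sub_eq_zero, ← WordFun.sub_apply, ← add_zero (0 : F.F n)]
  nth_rw 1 [← h3]
  rw [← h4, ← WordFun.add_apply, wder_mul, warit_mul]
  congr 1
  noncomm_ring

/-! ### The grading -/

theorem val_eq_zero {M : Bimould F} {n : ℕ} {w : Word n} (h : M w.length = 0) : M.val w = 0 := by
  unfold Bimould.val
  split_ifs
  · rw [h, map_zero]
  · rfl

theorem fur_length {U V : Type*} [AddCommGroup U] [AddCommGroup V] (a b : List (U × V)) :
    (fur a b).length = a.length := by
  induction a with
  | nil => rfl
  | cons x a ih =>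
    cases a with
    | nil => rfl
    | cons y a => rw [fur, List.length_cons, ih]; rfl

theorem mul_val_eq_zero {A B : Bimould F} {n m : ℕ} {v w : Word n}
    (h : ∀ i j, i + j = m → A i = 0 ∨ B j = 0) (hvw : v.length + w.length = m) :
    A.val v * B.val w = 0 := by
  rcases h _ _ hvw with h | h
  · rw [val_eq_zero h, zero_mul]
  · rw [val_eq_zero h, mul_zero]

/-- Flexions preserve lengths, so every summand at length `n` pairs components of complementary
lengths. -/
theorem preari_eq_zero {A B : Bimould F} {n : ℕ} (h : ∀ i j, i + j = n → A i = 0 ∨ B j = 0) :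
    preari A B n = 0 := by
  have h1 : mu A B n = 0 := by
    rw [mu, wmu]
    refine Finset.sum_eq_zero fun i hi => mul_val_eq_zero h ?_
    rw [← List.length_append, List.take_append_drop, gen_length]
  have h2 : amit B A n = 0 := by
    rw [amit, wamit]
    refine Finset.sum_eq_zero fun i hi => Finset.sum_eq_zero fun j hj => mul_val_eq_zero h ?_
    simp only [Finset.mem_range, gen_length] at hi hj
    simp only [List.length_append, ful_length, flr_length, List.length_take, List.length_drop,
      gen_length]
    omega
  have h3 : anit B A n = 0 := by
    rw [anit, wanit]
    refine Finset.sum_eq_zero fun i hi => Finset.sum_eq_zero fun j hj => mul_val_eq_zero h ?_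
    simp only [Finset.mem_range, gen_length] at hi hj
    simp only [List.length_append, fur_length, fll_length, List.length_take, List.length_drop,
      gen_length]
    omega
  simp only [preari, arit, Pi.add_apply, Pi.sub_apply, h1, h2, h3, sub_self, add_zero]

theorem gari_leading {X Y : Bimould F} (hY : Y 0 = 1) {n : ℕ} (h : ∀ k < n, X k = 0) :
    gari X Y n = X n := by
  have rG := (((represents_valFun Y n).garit hY (represents_valFun X n)).mu
    (represents_valFun Y n)) (gen n) (good_gen n)
  rw [val_gen] at rG
  have hy : valFun Y n [] = 1 := (represents_valFun Y n).nil hY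
  rw [gari, rG, WordFun.mul_apply, Finset.sum_range_succ, Finset.sum_eq_zero, List.take_length,
    List.drop_length, hy, WordFun.subst_leading hy (WordFun.winv_nil _), zero_add, mul_one]
  · exact val_gen X n
  · intro a ha
    rw [gen_length] at ha
    exact val_eq_zero (h _ ha)
  · intro i hi
    rw [WordFun.subst_vanish, zero_mul]
    intro a ha
    refine val_eq_zero (h _ ?_)
    rw [Finset.mem_range, gen_length] at hi
    rw [List.length_take] at ha
    omega

end

end Flexion

/-! ### Differential equations for graded operators and the adjoint action -/

namespace Flexion

noncomputable section

set_option linter.unusedSectionVars false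

open Finset.HasAntidiagonal (antidiagonal mem_antidiagonal)

/-! ### Linear differential equations for power series -/

section Series

open PowerSeries

variable {E : Type*} [Ring E]

/-- The derivation `t d/dt` of power series with coefficients in a noncommutative ring. -/
def euler (f : PowerSeries E) : PowerSeries E := PowerSeries.mk fun n => n • PowerSeries.coeff n f

theorem coeff_euler (n : ℕ) (f : PowerSeries E) : PowerSeries.coeff n (euler f) = n • PowerSeries.coeff n f := by
  rw [euler, coeff_mk]

theorem euler_mul (f g : PowerSeries E) : euler (f * g) = euler f * g + f * euler g := by
  ext n
  rw [map_add, coeff_euler, coeff_mul, coeff_mul, coeff_mul, Finset.smul_sum, ← Finset.sum_add_distrib]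
  refine Finset.sum_congr rfl fun p hp => ?_
  rw [coeff_euler, coeff_euler, ← mem_antidiagonal.1 hp, add_smul, smul_mul_assoc, mul_smul_comm]

theorem euler_sub (f g : PowerSeries E) : euler (f - g) = euler f - euler g := by
  ext n
  simp only [map_sub, coeff_euler, smul_sub]

theorem euler_C (a : E) : euler (C a) = 0 := by
  ext n
  rw [coeff_euler, coeff_C]
  split_ifs with h
  · simp [h]
  · simp

variable (K : Type*) [Field K] [CharZero K]

theorem eq_zero_of_nsmul {M : Type*} [AddCommGroup M] [Module K M] {n : ℕ} (hn : n ≠ 0) {x : M}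
    (h : n • x = 0) : x = 0 := by
  rw [← Nat.cast_smul_eq_nsmul K, smul_eq_zero] at h
  exact h.resolve_left (Nat.cast_ne_zero.2 hn)

theorem nsmul_left_cancel {M : Type*} [AddCommGroup M] [Module K M] {n : ℕ} (hn : n ≠ 0)
    {x y : M} (h : n • x = n • y) : x = y :=
  sub_eq_zero.1 (eq_zero_of_nsmul K hn (by rw [smul_sub, h, sub_self]))

variable [Algebra K E]

-- Since `e` has no constant term, the coefficient of index `n` of `e * f` involves only earlier
-- coefficients of `f`, and `n` can be divided out in characteristic `0`.
include K in
theorem eq_zero_of_euler {e f : PowerSeries E} (he : PowerSeries.coeff 0 e = 0) (h : euler f = e * f)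
    (h0 : PowerSeries.coeff 0 f = 0) : f = 0 := by
  ext n
  induction n using Nat.strong_induction_on with
  | _ n ih =>
    by_cases hn : n = 0
    · rw [hn, h0, map_zero]
    · refine eq_zero_of_nsmul K hn ?_
      rw [← coeff_euler, h, coeff_mul]
      refine Finset.sum_eq_zero fun p hp => ?_
      have hp' := mem_antidiagonal.1 hp
      by_cases hp1 : p.1 = 0
      · rw [hp1, he, zero_mul]
      · rw [ih p.2 (by omega), map_zero, mul_zero]

include K in
/-- If `P' = e P` and `ρ' = [e, ρ]`, then `P ρ(0) = ρ P`. -/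
theorem mul_C_eq_mul {e P ρ : PowerSeries E} (he : PowerSeries.coeff 0 e = 0) (hP : euler P = e * P)
    (hP0 : PowerSeries.coeff 0 P = 1) (hρ : euler ρ = e * ρ - ρ * e) : P * C (PowerSeries.coeff 0 ρ) = ρ * P := by
  rw [← sub_eq_zero]
  -- Both `P ρ(0)` and `ρ P` solve `f' = e f` with the same constant term.
  refine eq_zero_of_euler K he ?_ ?_
  · rw [euler_sub, euler_mul, euler_mul, euler_C, hP, hρ]
    noncomm_ring
  · rw [coeff_zero_eq_constantCoeff_apply] at hP0
    simp [hP0]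

end Series

/-! ### Operators on bimoulds -/

variable {K : Type*} [Field K] {F : Deck K}

/-- The projection to the component of length `k`. -/
def hom (k : ℕ) : Bimould F →ₗ[K] Bimould F where
  toFun A := Pi.single k (A k)
  map_add' A B := by simp [Pi.single_add]
  map_smul' c A := by simp [Pi.single_smul]

theorem hom_apply (k : ℕ) (A : Bimould F) : hom k A = Pi.single k (A k) := rfl

theorem hom_apply_self (k : ℕ) (A : Bimould F) : hom k A k = A k := Pi.single_eq_same _ _

theorem hom_apply_of_ne {k n : ℕ} (h : n ≠ k) (A : Bimould F) : hom k A n = 0 :=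
  Pi.single_eq_of_ne h _

theorem hom_eq_zero {k : ℕ} {A : Bimould F} (h : A k = 0) : hom k A = 0 := by
  rw [hom_apply, h, Pi.single_zero]

theorem sum_hom_apply (A : Bimould F) {k n : ℕ} (h : k ≤ n) :
    (∑ i ∈ Finset.range (n + 1), hom i A) k = A k := by
  rw [Finset.sum_apply, Finset.sum_eq_single k, hom_apply_self]
  · intro i _ hi
    exact hom_apply_of_ne hi.symm A
  · intro h'
    exact absurd (Finset.mem_range.2 (by omega)) h'

/-- The operator `X ↦ preari(X, A)`. -/
def rop : Bimould F →ₗ[K] Module.End K (Bimould F) :=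
  LinearMap.mk₂ K (fun A X => preari X A) (fun A B X => preari_add_right X A B)
    (fun c A X => preari_smul_right c X A) (fun A X Y => preari_add_left X Y A)
    (fun c A X => preari_smul_left c X A)

@[simp] theorem rop_apply (A X : Bimould F) : rop A X = preari X A := rfl

/-- The operator `X ↦ ari(A, X)`. -/
def adop : Bimould F →ₗ[K] Module.End K (Bimould F) := rop.flip - rop

theorem adop_apply (A X : Bimould F) : adop A X = ari A X := rfl

theorem end_neg_mul (S T : Module.End K (Bimould F)) : (-S) * T = -(S * T) := rfl

theorem end_mul_neg (S T : Module.End K (Bimould F)) : S * (-T) = -(S * T) := by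
  ext1 X
  simp

theorem rop_ari (A D : Bimould F) : rop (ari D A) = rop A * rop D - rop D * rop A := by
  ext1 X
  exact (preari_preari_sub X A D).symm

/-- `A` is recovered by evaluating `rop A` at the unit. -/
theorem rop_injective : Function.Injective (rop : Bimould F → _) := fun A B h => by
  rw [← preari_unit A, ← preari_unit B]
  exact congrArg (fun f => f (unit F)) h

/-- The Jacobi identity for `ari`, inherited from the commutator of operators through the injective
map `rop`. -/
theorem adop_ari (A B : Bimould F) : adop (ari A B) = adop A * adop B - adop B * adop A := by
  ext1 X
  apply rop_injective
  simp only [LinearMap.sub_apply, Module.End.mul_apply, adop_apply, map_sub, rop_ari]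
  simp only [mul_sub, sub_mul, mul_assoc]
  abel

/-! ### The grading of operators -/

/-- The operator raises the length by `m`. -/
structure HasDegree (m : ℕ) (T : Module.End K (Bimould F)) : Prop where
  map_hom : ∀ k X, T (hom k X) = hom (k + m) (T X)
  low : ∀ X n, n < m → T X n = 0

theorem hasDegree_one : HasDegree 0 (1 : Module.End K (Bimould F)) :=
  ⟨fun _ _ => rfl, fun _ _ h => absurd h (Nat.not_lt_zero _)⟩

theorem HasDegree.mul {m m' : ℕ} {S T : Module.End K (Bimould F)} (hS : HasDegree m S)
    (hT : HasDegree m' T) : HasDegree (m + m') (S * T) := by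
  refine ⟨fun k X => ?_, fun X n hn => ?_⟩
  · rw [Module.End.mul_apply, hT.map_hom, hS.map_hom, Module.End.mul_apply, add_assoc, add_comm m']
  · rw [Module.End.mul_apply]
    by_cases h : n < m
    · exact hS.low _ _ h
    · have h1 : hom n (S (T X)) = 0 := by
        obtain ⟨k, rfl⟩ := Nat.exists_eq_add_of_le' (not_lt.1 h)
        rw [← hS.map_hom, hom_eq_zero (hT.low X k (by omega)), map_zero]
      have h2 := congrFun h1 n
      rwa [hom_apply_self] at h2

theorem HasDegree.smul {m : ℕ} {T : Module.End K (Bimould F)} (hT : HasDegree m T) (c : K) :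
    HasDegree m (c • T) := by
  refine ⟨fun k X => ?_, fun X n hn => ?_⟩
  · rw [LinearMap.smul_apply, LinearMap.smul_apply, hT.map_hom, map_smul]
  · rw [LinearMap.smul_apply, Pi.smul_apply, hT.low X n hn, smul_zero]

theorem HasDegree.add {m : ℕ} {S T : Module.End K (Bimould F)} (hS : HasDegree m S)
    (hT : HasDegree m T) : HasDegree m (S + T) := by
  refine ⟨fun k X => ?_, fun X n hn => ?_⟩
  · rw [LinearMap.add_apply, LinearMap.add_apply, hS.map_hom, hT.map_hom, map_add]
  · rw [LinearMap.add_apply, Pi.add_apply, hS.low X n hn, hT.low X n hn, add_zero]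

theorem hasDegree_zero (m : ℕ) : HasDegree m (0 : Module.End K (Bimould F)) :=
  ⟨fun k X => by simp, fun X n hn => rfl⟩

theorem HasDegree.sum {m : ℕ} {ι : Type*} {s : Finset ι} {T : ι → Module.End K (Bimould F)}
    (hT : ∀ i ∈ s, HasDegree m (T i)) : HasDegree m (∑ i ∈ s, T i) :=
  Finset.sum_induction T (HasDegree m) (fun _ _ => HasDegree.add) (hasDegree_zero m) hT

theorem hom_ext {A B : Bimould F} {k : ℕ} (h : ∀ n, n ≠ k → A n = B n) (h' : A k = B k) : A = B := by
  ext n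
  by_cases hn : n = k
  · rw [hn, h']
  · exact h n hn

theorem preari_hom_eq_zero {k r n : ℕ} (X A : Bimould F) (h : k + r ≠ n) :
    preari (hom k X) (hom r A) n = 0 := by
  refine preari_eq_zero fun i j hij => ?_
  by_cases hi : i = k
  · right
    exact hom_apply_of_ne (by omega) A
  · left
    exact hom_apply_of_ne hi X

theorem preari_congr {X X' A A' : Bimould F} {n : ℕ} (hX : ∀ k ≤ n, X k = X' k)
    (hA : ∀ k ≤ n, A k = A' k) : preari X A n = preari X' A' n := by
  have e1 : preari (X - X') A n = 0 := preari_eq_zero fun i j hij =>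
    Or.inl (by rw [Pi.sub_apply, hX i (by omega), sub_self])
  have e2 : preari X' (A - A') n = 0 := preari_eq_zero fun i j hij =>
    Or.inr (by rw [Pi.sub_apply, hA j (by omega), sub_self])
  rw [← rop_apply, map_sub, Pi.sub_apply, sub_eq_zero] at e1
  rw [← rop_apply, map_sub, LinearMap.sub_apply, Pi.sub_apply, sub_eq_zero] at e2
  exact e1.trans e2

theorem preari_hom_congr {X X' : Bimould F} {r n : ℕ} (A : Bimould F) (h : X n = X' n) :
    preari X (hom r A) (n + r) = preari X' (hom r A) (n + r) := by
  have : preari (X - X') (hom r A) (n + r) = 0 := preari_eq_zero fun i j hij => by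
    by_cases hj : j = r
    · left
      obtain rfl : i = n := by omega
      rw [Pi.sub_apply, h, sub_self]
    · right
      exact hom_apply_of_ne hj A
  rwa [← rop_apply, map_sub, Pi.sub_apply, sub_eq_zero] at this

theorem preari_hom_low {X : Bimould F} {r n m : ℕ} (A : Bimould F) (h : ∀ k < m, X k = 0)
    (hn : n < m + r) : preari X (hom r A) n = 0 := by
  refine preari_eq_zero fun i j hij => ?_
  by_cases hj : j = r
  · left
    exact h i (by omega)
  · right
    exact hom_apply_of_ne hj A

theorem hasDegree_rop (r : ℕ) (A : Bimould F) : HasDegree r (rop (hom r A)) := by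
  refine ⟨fun k X => hom_ext (k := k + r) (fun n hn => ?_) ?_, fun X n hn =>
    preari_hom_low (m := 0) A (by simp) (by omega)⟩
  · rw [rop_apply, hom_apply_of_ne hn, preari_hom_eq_zero X A hn.symm]
  · rw [hom_apply_self]
    exact preari_hom_congr A (hom_apply_self k X)

theorem preari_hom_left_congr {A A' : Bimould F} {r n : ℕ} (X : Bimould F) (h : A n = A' n) :
    preari (hom r X) A (n + r) = preari (hom r X) A' (n + r) := by
  have : preari (hom r X) (A - A') (n + r) = 0 := preari_eq_zero fun i j hij => by
    by_cases hj : i = r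
    · right
      obtain rfl : j = n := by omega
      rw [Pi.sub_apply, h, sub_self]
    · left
      exact hom_apply_of_ne hj X
  rwa [← rop_apply, map_sub, LinearMap.sub_apply, Pi.sub_apply, sub_eq_zero] at this

theorem hasDegree_rop_flip (r : ℕ) (A : Bimould F) : HasDegree r (rop.flip (hom r A)) := by
  refine ⟨fun k X => hom_ext (k := k + r) (fun n hn => ?_) ?_, fun X n hn => ?_⟩
  · rw [LinearMap.flip_apply, rop_apply, hom_apply_of_ne hn, preari_hom_eq_zero A X (by omega)]
  · rw [hom_apply_self]
    exact preari_hom_left_congr A (hom_apply_self k X)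
  · exact preari_eq_zero fun i j hij => Or.inl (hom_apply_of_ne (by omega) A)

theorem hasDegree_adop (r : ℕ) (A : Bimould F) : HasDegree r (adop (hom r A)) := by
  have h := (hasDegree_rop_flip r A).add ((hasDegree_rop r A).smul (-1))
  convert h using 1
  ext1 X
  simp [adop, sub_eq_add_neg]

theorem HasDegree.apply_eq {m : ℕ} {T : Module.End K (Bimould F)} (hT : HasDegree m T)
    (X : Bimould F) (n : ℕ) : hom (n + m) (T X) = T (hom n X) := (hT.map_hom n X).symm

/-- The component of degree `m` of an operator. -/
def degPart (T : Module.End K (Bimould F)) (m : ℕ) : Module.End K (Bimould F) where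
  toFun X n := if m ≤ n then T (hom (n - m) X) n else 0
  map_add' X Y := by
    ext n
    simp only [map_add, Pi.add_apply]
    split_ifs <;> simp
  map_smul' c X := by
    ext n
    simp only [map_smul, Pi.smul_apply, RingHom.id_apply]
    split_ifs <;> simp

theorem degPart_apply_add (T : Module.End K (Bimould F)) (m n : ℕ) (X : Bimould F) :
    degPart T m X (n + m) = T (hom n X) (n + m) := by
  change (if m ≤ n + m then _ else _) = _
  rw [if_pos (by omega), Nat.add_sub_cancel]

theorem degPart_low (T : Module.End K (Bimould F)) {m n : ℕ} (h : n < m) (X : Bimould F) :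
    degPart T m X n = 0 :=
  if_neg (by omega)

/-- If `T` never lowers the length, its value at length `n` sees only the finitely many components
of `X` of length at most `n`. -/
theorem eq_sum_degPart {T : Module.End K (Bimould F)}
    (hT : ∀ X n, (∀ k ≤ n, X k = 0) → T X n = 0) (X : Bimould F) (n : ℕ) :
    T X n = ∑ m ∈ Finset.range (n + 1), degPart T m X n := by
  have h := hT (X - ∑ i ∈ Finset.range (n + 1), hom i X) n fun k hk => by
    rw [Pi.sub_apply, sum_hom_apply X hk, sub_self]
  rw [map_sub, Pi.sub_apply, sub_eq_zero, map_sum, Finset.sum_apply] at h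
  rw [h, ← Finset.sum_range_reflect]
  refine Finset.sum_congr rfl fun m hm => ?_
  have hm' : m ≤ n := Nat.lt_succ_iff.1 (Finset.mem_range.1 hm)
  obtain ⟨k, rfl⟩ := Nat.exists_eq_add_of_le' hm'
  have hk : k + m + 1 - 1 - m = k := by omega
  rw [degPart_apply_add, hk]

/-- The operator `X ↦ gari(X, Y)`. -/
def gop (Y : Bimould F) : Module.End K (Bimould F) where
  toFun X := gari X Y
  map_add' A B := gari_add_left A B Y
  map_smul' c A := gari_smul_left c A Y

theorem gop_low {Y : Bimould F} (hY : Y 0 = 1) {X : Bimould F} {n : ℕ} (h : ∀ k ≤ n, X k = 0) :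
    gop Y X n = 0 := by
  change gari X Y n = 0
  rw [gari_leading hY fun k hk => h k hk.le, h n le_rfl]

theorem degPart_gop_zero {Y : Bimould F} (hY : Y 0 = 1) : degPart (gop Y) 0 = 1 := by
  ext X n
  have := degPart_apply_add (gop Y) 0 n X
  rw [add_zero] at this
  rw [this, Module.End.one_apply, ← hom_apply_self n X]
  exact gari_leading hY fun k hk => hom_apply_of_ne hk.ne X

theorem preari_eq_sum_right (X A : Bimould F) (n : ℕ) :
    preari X A n = ∑ r ∈ Finset.range (n + 1), preari X (hom r A) n := by
  rw [preari_congr (X' := X) (A' := ∑ r ∈ Finset.range (n + 1), hom r A) (fun _ _ => rfl)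
    fun k hk => (sum_hom_apply A hk).symm, ← rop_apply, map_sum, LinearMap.sum_apply,
    Finset.sum_apply]
  rfl

/-- For `X` of pure length `k` one has `der X = k X`. At length `k + m`, `der_gari` gives a factor
`k + m` on the left and `k` on the right, leaving `m`. -/
theorem nsmul_degPart_gop {Y E : Bimould F} (hY : Y 0 = 1) (hE : der Y = preari Y E) (m : ℕ) :
    m • degPart (gop Y) m =
      ∑ p ∈ antidiagonal m, rop (hom p.1 E) * degPart (gop Y) p.2 := by
  ext X n
  rw [LinearMap.smul_apply, Pi.smul_apply, LinearMap.sum_apply, Finset.sum_apply]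
  by_cases hn : n < m
  · rw [degPart_low _ hn, smul_zero, Finset.sum_eq_zero]
    intro p hp
    have hp' := mem_antidiagonal.1 hp
    exact preari_hom_low (m := p.2) E (fun k hk => degPart_low _ hk X) (by omega)
  · obtain ⟨k, rfl⟩ := Nat.exists_eq_add_of_le' (not_lt.1 hn)
    rw [degPart_apply_add]
    set W := gop Y (hom k X) with hW
    have hWlow : ∀ i < k, W i = 0 := fun i hi =>
      gop_low hY fun j hj => hom_apply_of_ne (by omega) X
    have h := congrFun (der_gari (X := hom k X) hY hE) (k + m)
    have h1 : der (hom k X) = k • hom k X := by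
      refine hom_ext (k := k) (fun n hn => ?_) ?_
      · simp only [der, Pi.smul_apply, hom_apply_of_ne hn, smul_zero]
      · rfl
    have h2 : gari (k • hom k X) Y = k • W := map_nsmul (gop Y) k (hom k X)
    have h3 : (k + m) • W (k + m) = k • W (k + m) + preari W E (k + m) := by
      rw [h1, h2] at h
      exact h
    rw [add_smul, add_right_inj] at h3
    rw [h3, preari_eq_sum_right, Finset.Nat.sum_antidiagonal_eq_sum_range_succ_mk]
    symm
    -- The terms with `r > m` vanish, because `W` has no component of length below `k`.
    rw [← Finset.sum_subset (Finset.range_subset_range.2 (by omega : m + 1 ≤ k + m + 1))]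
    · refine Finset.sum_congr rfl fun r hr => ?_
      have hr' : r ≤ m := Nat.lt_succ_iff.1 (Finset.mem_range.1 hr)
      obtain ⟨j, rfl⟩ := Nat.exists_eq_add_of_le' hr'
      rw [Module.End.mul_apply, rop_apply, Nat.add_sub_cancel, ← add_assoc]
      exact preari_hom_congr E (degPart_apply_add _ _ _ _)
    · intro r hr hr'
      rw [Finset.mem_range] at hr hr'
      exact preari_hom_low E hWlow (by omega)

/-! ### The adjoint action -/

section Adjoint

-- The coefficient form of `mul_C_eq_mul`, the exponent recording the degree of the operator.
open PowerSeries in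
theorem mul_eq_sum_of_recursion [CharZero K] {P e : ℕ → Module.End K (Bimould F)}
    (he : e 0 = 0) (hP0 : P 0 = 1)
    (hP : ∀ m, m • P m = ∑ p ∈ antidiagonal m, e p.1 * P p.2)
    {ρ : ℕ → Module.End K (Bimould F)}
    (hρ : ∀ m, m • ρ m = ∑ p ∈ antidiagonal m, (e p.1 * ρ p.2 - ρ p.2 * e p.1)) (m : ℕ) :
    P m * ρ 0 = ∑ p ∈ antidiagonal m, ρ p.1 * P p.2 := by
  have h := mul_C_eq_mul K (e := PowerSeries.mk e) (P := PowerSeries.mk P) (ρ := PowerSeries.mk ρ)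
    (by simp [he]) (by ext n : 1; simp [coeff_euler, coeff_mul, hP]) (by simp [hP0]) (by
      ext n : 1
      rw [coeff_euler, map_sub, coeff_mul, coeff_mul,
        ← Finset.Nat.sum_antidiagonal_swap (f := fun p => PowerSeries.coeff p.1 (PowerSeries.mk ρ) * _),
        ← Finset.sum_sub_distrib]
      simp [hρ])
  have h' := congrArg (PowerSeries.coeff m) h
  rw [coeff_mul_C, coeff_mul] at h'
  simpa using h'

variable [CharZero K] {E : Bimould F} {C : ℕ → Module.End K (Bimould F)}

/-- Uniqueness of solutions moves `rop A` past `gop Y`, turning `A` into the sum of the `C i A`. At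
`S` the factor `gop Y S` is the unit, on which `rop` is evaluation. -/
theorem gari_preari_eq_sum {S Y : Bimould F} (hY : Y 0 = 1) (hE : der Y = preari Y E)
    (hE0 : E 0 = 0) (hSY : gari S Y = unit F) (hC0 : C 0 = 1)
    (hC : ∀ m, m • C m = -∑ p ∈ antidiagonal m, adop (hom p.1 E) * C p.2)
    (hlow : ∀ m X n, n < m → C m X n = 0) (A : Bimould F) (n : ℕ) :
    gari (preari S A) Y n = ∑ i ∈ Finset.range (n + 1), C i A n := by
  have key := mul_eq_sum_of_recursion (P := degPart (gop Y)) (e := fun r => rop (hom r E))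
    (ρ := fun i => rop (C i A)) (by simp [hom_eq_zero hE0]) (degPart_gop_zero hY)
    (nsmul_degPart_gop hY hE) (fun m => by
      rw [← map_nsmul, ← LinearMap.smul_apply, hC, LinearMap.neg_apply, LinearMap.sum_apply,
        map_neg, map_sum, ← Finset.sum_neg_distrib]
      refine Finset.sum_congr rfl fun p _ => ?_
      rw [Module.End.mul_apply, adop_apply, rop_ari, neg_sub])
  change gop Y (rop A S) n = _
  rw [eq_sum_degPart (T := gop Y) (fun X n h => gop_low hY h)]
  simp only [hC0, Module.End.one_apply] at key
  have e1 (m : ℕ) : degPart (gop Y) m (rop A S) n =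
      ∑ p ∈ antidiagonal m, preari (degPart (gop Y) p.2 S) (C p.1 A) n := by
    rw [← Module.End.mul_apply, key, LinearMap.sum_apply, Finset.sum_apply]
    rfl
  -- Since `C i A` has no component below length `i`, only lengths up to `n - i` of the left
  -- argument matter; there the truncated sum already equals the unit.
  have e2 (i : ℕ) (hi : i ≤ n) : C i A n =
      ∑ j ∈ Finset.range (n - i + 1), preari (degPart (gop Y) j S) (C i A) n := by
    have h : preari (∑ j ∈ Finset.range (n - i + 1), degPart (gop Y) j S - unit F) (C i A) n = 0 := by
      refine preari_eq_zero fun a b hab => ?_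
      by_cases hb : b < i
      · exact Or.inr (hlow i A b hb)
      · left
        have h1 : unit F a = ∑ m ∈ Finset.range (a + 1), degPart (gop Y) m S a := by
          rw [← eq_sum_degPart (T := gop Y) (fun X n h => gop_low hY h), ← hSY]
          rfl
        rw [Pi.sub_apply, Finset.sum_apply, h1, sub_eq_zero]
        symm
        refine Finset.sum_subset (Finset.range_subset_range.2 (by omega)) fun m _ hm => ?_
        exact degPart_low _ (by rw [Finset.mem_range] at hm; omega) S
    rw [← rop_apply, map_sub, map_sum, Pi.sub_apply, Finset.sum_apply, sub_eq_zero, rop_apply,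
      preari_unit] at h
    exact h.symm
  rw [Finset.sum_congr rfl fun m _ => e1 m, Finset.sum_congr rfl fun i hi =>
    e2 i (Nat.lt_succ_iff.1 (Finset.mem_range.1 hi)), Finset.sum_sigma', Finset.sum_sigma']
  refine Finset.sum_bij' (fun x _ => ⟨x.2.1, x.2.2⟩) (fun x _ => ⟨x.1 + x.2, (x.1, x.2)⟩) ?_ ?_ ?_ ?_ ?_
  · rintro ⟨m, i, j⟩ h
    simp only [Finset.mem_sigma, Finset.mem_range, mem_antidiagonal] at h ⊢
    omega
  · rintro ⟨i, j⟩ h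
    simp only [Finset.mem_sigma, Finset.mem_range, mem_antidiagonal] at h ⊢
    exact ⟨by omega, trivial⟩
  · rintro ⟨m, i, j⟩ h
    simp only [Finset.mem_sigma, Finset.mem_range, mem_antidiagonal] at h ⊢
    rw [h.2]
  · rintro ⟨i, j⟩ h
    rfl
  · rintro ⟨m, i, j⟩ h
    rfl

/-- Says that the sum of the `C m` respects `ari`. It is the same uniqueness argument, with `-adop`
in place of `rop`. -/
theorem mul_adop_eq_sum (hE0 : E 0 = 0) (hC0 : C 0 = 1)
    (hC : ∀ m, m • C m = -∑ p ∈ antidiagonal m, adop (hom p.1 E) * C p.2)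
    (A : Bimould F) (m : ℕ) :
    C m * adop A = ∑ p ∈ antidiagonal m, adop (C p.1 A) * C p.2 := by
  have key := mul_eq_sum_of_recursion (P := C) (e := fun r => -adop (hom r E))
    (ρ := fun i => adop (C i A)) (by simp [hom_eq_zero hE0]) hC0
    (fun m => by rw [hC, ← Finset.sum_neg_distrib]; simp only [end_neg_mul]) (fun m => by
      rw [← map_nsmul, ← LinearMap.smul_apply, hC, LinearMap.neg_apply, LinearMap.sum_apply,
        map_neg, map_sum, ← Finset.sum_neg_distrib]
      refine Finset.sum_congr rfl fun p _ => ?_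
      rw [Module.End.mul_apply, adop_apply, adop_ari, end_neg_mul, end_mul_neg]
      abel) m
  simpa only [hC0, Module.End.one_apply] using key

/-- Converts the left recursion driven by `E` into a right recursion driven by `D`, using `E = -C D`
and then `ad(C D) C = C ad(D)`. -/
theorem nsmul_eq_sum_mul_adop {S Y D : Bimould F} (hY : Y 0 = 1) (hE : der Y = preari Y E)
    (hE0 : E 0 = 0) (hSY : gari S Y = unit F) (hD : der S = preari S D) (hC0 : C 0 = 1)
    (hC : ∀ m, m • C m = -∑ p ∈ antidiagonal m, adop (hom p.1 E) * C p.2)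
    (hdeg : ∀ m, HasDegree m (C m)) (m : ℕ) :
    m • C m = ∑ p ∈ antidiagonal m, C p.1 * adop (hom p.2 D) := by
  -- This is `der_gari` at `X = S`: the left side is `der` of the unit, which is zero.
  have h1 : E = -gari (preari S D) Y := by
    have h := der_gari (X := S) hY hE
    rw [hSY, hD, preari_unit] at h
    have h0 : der (unit F) = 0 := by
      ext r
      cases r with
      | zero => simp [der]
      | succ r => simp [der, unit]
    rw [h0] at h
    exact eq_neg_of_add_eq_zero_right h.symm
  have h2 (r : ℕ) : hom r E = -∑ p ∈ antidiagonal r, C p.1 (hom p.2 D) := by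
    have h3 : hom r E = -∑ i ∈ Finset.range (r + 1), hom r (C i D) := by
      refine hom_ext (k := r) (fun n hn => ?_) ?_
      · rw [hom_apply_of_ne hn, Pi.neg_apply, Finset.sum_apply, Finset.sum_eq_zero, neg_zero]
        exact fun i _ => hom_apply_of_ne hn _
      · rw [hom_apply_self, Pi.neg_apply, Finset.sum_apply, h1, Pi.neg_apply,
          gari_preari_eq_sum hY hE hE0 hSY hC0 hC (fun m => (hdeg m).low)]
        simp only [hom_apply_self]
    rw [h3, Finset.Nat.sum_antidiagonal_eq_sum_range_succ_mk]
    congr 1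
    refine Finset.sum_congr rfl fun i hi => ?_
    have hi' : i ≤ r := Nat.lt_succ_iff.1 (Finset.mem_range.1 hi)
    obtain ⟨j, rfl⟩ := Nat.exists_eq_add_of_le' hi'
    rw [(hdeg i).apply_eq, Nat.add_sub_cancel]
  rw [hC, ← Finset.sum_neg_distrib]
  have h4 (p : ℕ × ℕ) : -(adop (hom p.1 E) * C p.2) =
      ∑ q ∈ antidiagonal p.1, adop (C q.1 (hom q.2 D)) * C p.2 := by
    rw [h2, map_neg, map_sum, end_neg_mul, neg_neg, Finset.sum_mul]
  rw [Finset.sum_congr rfl fun p _ => h4 p]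
  conv_rhs => rw [Finset.sum_congr rfl fun p _ => mul_adop_eq_sum hE0 hC0 hC (hom p.2 D) p.1]
  rw [Finset.sum_sigma', Finset.sum_sigma']
  -- Both sides sum over triples of degrees with total `m`; they differ only in which two are
  -- grouped, and the regrouping is an involution.
  refine Finset.sum_bij' (fun x _ => ⟨(x.2.1 + x.1.2, x.2.2), (x.2.1, x.1.2)⟩)
    (fun x _ => ⟨(x.2.1 + x.1.2, x.2.2), (x.2.1, x.1.2)⟩) ?_ ?_ ?_ ?_ ?_
  all_goals
    rintro ⟨⟨a, b⟩, c, d⟩ h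
    simp only [Finset.mem_sigma, mem_antidiagonal] at h ⊢
  · exact ⟨by omega, trivial⟩
  · exact ⟨by omega, trivial⟩
  · rw [h.2]
  · rw [h.2]

end Adjoint

end

end Flexion

/-! ### Unfolding the recursions into sums over sequences -/

namespace Flexion

noncomputable section

set_option linter.unusedSectionVars false

open Finset.HasAntidiagonal (antidiagonal mem_antidiagonal)

/-! ### Sums over sequences of positive integers -/

/-- The sum of a list of positive integers. -/
def weight (l : List ℕ+) : ℕ := (l.map fun r : ℕ+ => (r : ℕ)).sum

theorem weight_cons (r : ℕ+) (l : List ℕ+) : weight (r :: l) = r + weight l := by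
  simp [weight]

theorem length_le_weight (l : List ℕ+) : l.length ≤ weight l := by
  induction l with
  | nil => simp [weight]
  | cons r l ih =>
    have := r.pos
    rw [weight_cons, List.length_cons]
    omega

theorem le_weight {l : List ℕ+} {r : ℕ+} (h : r ∈ l) : (r : ℕ) ≤ weight l := by
  induction l with
  | nil => simp at h
  | cons s l ih =>
    rw [weight_cons]
    rcases List.mem_cons.1 h with rfl | h
    · omega
    · have := ih h
      omega

theorem finite_weight_eq (m : ℕ) : {l | weight l = m}.Finite := by
  have h : {r : ℕ+ | (r : ℕ) ≤ m}.Finite :=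
    (Set.finite_Iic m).preimage PNat.coe_injective.injOn
  refine (finite_lists h m).subset ?_
  rintro l rfl
  exact ⟨length_le_weight l, fun r hr => le_weight hr⟩

/-- The finite set of sequences with sum `m`. -/
def ofWeight (m : ℕ) : Finset (List ℕ+) := (finite_weight_eq m).toFinset

theorem mem_ofWeight {m : ℕ} {l : List ℕ+} : l ∈ ofWeight m ↔ weight l = m := by
  simp [ofWeight]

theorem ofWeight_zero : ofWeight 0 = {[]} := by
  ext l
  rw [mem_ofWeight, Finset.mem_singleton]
  cases l with
  | nil => simp [weight]
  | cons r l => simp [weight_cons]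

section Terms

variable {K M : Type*} [Field K] [AddCommGroup M] [Module K M] (Φ : ℕ → M →ₗ[K] M) (x : M)

/-- The iterated application of the operators `Φ r` to `x`, divided by the partial sums. -/
def term : List ℕ+ → M
  | [] => x
  | r :: l => (weight (r :: l) : K)⁻¹ • Φ r (term l)

variable [CharZero K]

/-- All sequences of weight `m` share the outermost denominator `m`, which cancels. Removing the
head then matches them with the right side, whose terms with `p.1 = 0` vanish by `h0`. -/
theorem nsmul_sum_term (h0 : Φ 0 = 0) (m : ℕ) :
    m • ∑ l ∈ ofWeight m, term Φ x l =
      ∑ p ∈ antidiagonal m, Φ p.1 (∑ l ∈ ofWeight p.2, term Φ x l) := by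
  by_cases hm : m = 0
  · subst hm
    simp [h0]
  simp only [map_sum, Finset.smul_sum]
  rw [Finset.sum_sigma']
  -- The value at the empty list is arbitrary, since that list has weight `0 ≠ m`.
  refine Finset.sum_of_injOn (fun l : List ℕ+ => match l with
    | [] => ⟨(0, 0), []⟩
    | r :: l => ⟨(r, weight l), l⟩) ?_ ?_ ?_ ?_
  · intro l hl l' hl' h
    rcases l with _ | ⟨r, l⟩
    · exact absurd (mem_ofWeight.1 hl).symm hm
    rcases l' with _ | ⟨r', l'⟩
    · exact absurd (mem_ofWeight.1 hl').symm hm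
    simp only [Sigma.mk.injEq, Prod.mk.injEq, PNat.coe_inj, heq_eq_eq] at h
    rw [h.1.1, h.2]
  · intro l hl
    rcases l with _ | ⟨r, l⟩
    · exact absurd (mem_ofWeight.1 hl).symm hm
    have := mem_ofWeight.1 hl
    rw [weight_cons] at this
    simp [mem_ofWeight, this]
  · rintro ⟨⟨r, j⟩, l⟩ h h'
    simp only [Finset.mem_sigma, mem_antidiagonal, mem_ofWeight] at h
    rcases Nat.eq_zero_or_pos r with rfl | hr
    · simp [h0]
    · obtain ⟨r, rfl⟩ : ∃ r' : ℕ+, (r' : ℕ) = r := ⟨⟨r, hr⟩, rfl⟩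
      refine absurd ⟨r :: l, ?_, ?_⟩ h'
      · rw [Finset.mem_coe, mem_ofWeight, weight_cons, h.2]
        exact h.1
      · simp only [h.2]
  · intro l hl
    rcases l with _ | ⟨r, l⟩
    · exact absurd (mem_ofWeight.1 hl).symm hm
    rw [term, mem_ofWeight.1 hl, ← Nat.cast_smul_eq_nsmul K, smul_smul,
      mul_inv_cancel₀ (Nat.cast_ne_zero.2 hm), one_smul]

end Terms

/-- The list `rₛ, …, r₁`. -/
def revList (x : Σ s : ℕ, (Fin s → ℕ+)) : List ℕ+ := (List.ofFn x.2).reverse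

theorem revList_bijective : Function.Bijective revList :=
  List.reverse_involutive.bijective.comp
    (List.equivSigmaTuple (α := ℕ+)).symm.bijective

/-- The head of the reversed list is `rₛ`, so the head's weight in `term` is the full sum `r₁ + ⋯ +
rₛ`. Steps on the right and on the left then produce the two orders of composition. -/
theorem revList_succ {s : ℕ} (r : Fin (s + 1) → ℕ+) :
    revList ⟨s + 1, r⟩ = r (Fin.last s) :: revList ⟨s, fun i => r i.castSucc⟩ := by
  simp only [revList, List.ofFn_succ', List.concat_eq_append, List.reverse_append,
    List.reverse_cons, List.reverse_nil, List.nil_append, List.cons_append]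

theorem weight_revList {s : ℕ} (r : Fin s → ℕ+) : weight (revList ⟨s, r⟩) = ∑ i, (r i : ℕ) := by
  rw [weight, revList, List.map_reverse, List.sum_reverse, List.map_ofFn, List.sum_ofFn]
  rfl

theorem coeff_succ {K : Type*} [Field K] {s : ℕ} (r : Fin (s + 1) → ℕ+) :
    coeff K r = (weight (revList ⟨s + 1, r⟩) : K)⁻¹ * coeff K fun i => r i.castSucc := by
  have h (j : Fin s) : ∑ i ∈ Finset.Iic j.castSucc, ((r i : ℕ) : K) =
      ∑ i ∈ Finset.Iic j, ((r i.castSucc : ℕ) : K) := by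
    rw [← Fin.map_castSuccEmb_Iic, Finset.sum_map]
    rfl
  have h' : Finset.Iic (Fin.last s) = Finset.univ := by
    ext i; simp [Fin.le_last]
  rw [coeff, coeff, Fin.prod_univ_castSucc, weight_revList, h']
  simp only [h, Nat.cast_sum]
  rw [one_div, one_div, mul_inv, mul_comm]

/-! ### The expansions of the adjoint action -/

section Expansion

variable {K : Type*} [Field K] {F : Deck K}

/-- Right multiplication by `ari(leng_r D)`. -/
def stepRight (D : Bimould F) (r : ℕ) :
    Module.End K (Bimould F) →ₗ[K] Module.End K (Bimould F) :=
  LinearMap.mulRight K (adop (hom r D))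

/-- Left multiplication by `-ari(leng_r D)`. -/
def stepLeft (D : Bimould F) (r : ℕ) :
    Module.End K (Bimould F) →ₗ[K] Module.End K (Bimould F) :=
  -LinearMap.mulLeft K (adop (hom r D))

theorem stepRight_apply (D : Bimould F) (r : ℕ) (T : Module.End K (Bimould F)) :
    stepRight D r T = T * adop (hom r D) := rfl

theorem stepLeft_apply (D : Bimould F) (r : ℕ) (T : Module.End K (Bimould F)) :
    stepLeft D r T = -(adop (hom r D) * T) := rfl

theorem hasDegree_term {Φ : ℕ → Module.End K (Bimould F) →ₗ[K] Module.End K (Bimould F)}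
    (hΦ : ∀ r m T, HasDegree m T → HasDegree (r + m) (Φ r T)) (l : List ℕ+) :
    HasDegree (weight l) (term Φ 1 l) := by
  induction l with
  | nil => exact hasDegree_one
  | cons r l ih =>
    rw [term]
    nth_rw 1 [weight_cons]
    exact (hΦ _ _ _ ih).smul _

theorem hasDegree_stepRight (D : Bimould F) (r m : ℕ) (T : Module.End K (Bimould F))
    (hT : HasDegree m T) : HasDegree (r + m) (stepRight D r T) := by
  rw [add_comm]
  exact hT.mul (hasDegree_adop r D)

theorem hasDegree_stepLeft (D : Bimould F) (r m : ℕ) (T : Module.End K (Bimould F))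
    (hT : HasDegree m T) : HasDegree (r + m) (stepLeft D r T) := by
  rw [stepLeft_apply, ← neg_one_smul K]
  exact ((hasDegree_adop r D).mul hT).smul (-1)

theorem term_stepRight (D : LU F) (x : Σ s : ℕ, (Fin s → ℕ+)) (A : LU F) :
    ((coeff K x.2 • (List.ofFn fun i => uari (leng (x.2 i) D)).prod) A : LU F).1 =
      term (stepRight D.1) 1 (revList x) A.1 := by
  obtain ⟨s, r⟩ := x
  induction s generalizing A with
  | zero => simp [coeff, revList, term]
  | succ s ih =>
    rw [revList_succ, term, ← revList_succ, stepRight_apply]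
    change _ = (weight (revList ⟨s + 1, r⟩) : K)⁻¹ •
      term (stepRight D.1) 1 (revList ⟨s, fun i => r i.castSucc⟩)
        (adop (hom (r (Fin.last s)) D.1) A.1)
    have h := ih (uari (leng (r (Fin.last s)) D) A) (fun i => r i.castSucc)
    have e : (uari (leng (r (Fin.last s)) D) A : LU F).1 = adop (hom (r (Fin.last s)) D.1) A.1 :=
      rfl
    rw [e] at h
    rw [← h, coeff_succ]
    simp only [List.ofFn_succ', List.concat_eq_append, List.prod_append, List.prod_singleton,
      LinearMap.smul_apply, Module.End.mul_apply, mul_smul, Submodule.coe_smul]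

theorem term_stepLeft (D : LU F) (x : Σ s : ℕ, (Fin s → ℕ+)) (A : LU F) :
    ((((-1) ^ x.1 * coeff K x.2) •
      (List.ofFn fun i => uari (leng (x.2 i) D)).reverse.prod) A : LU F).1 =
      term (stepLeft D.1) 1 (revList x) A.1 := by
  obtain ⟨s, r⟩ := x
  induction s generalizing A with
  | zero => simp [coeff, revList, term]
  | succ s ih =>
    rw [revList_succ, term, ← revList_succ, stepLeft_apply]
    change _ = (weight (revList ⟨s + 1, r⟩) : K)⁻¹ • -(adop (hom (r (Fin.last s)) D.1)
      (term (stepLeft D.1) 1 (revList ⟨s, fun i => r i.castSucc⟩) A.1))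
    rw [← ih]
    have e (B : LU F) : adop (hom (r (Fin.last s)) D.1) B.1 =
      (uari (leng (r (Fin.last s)) D) B : LU F).1 := rfl
    rw [e, coeff_succ]
    simp only [List.ofFn_succ', List.concat_eq_append, List.reverse_append, List.reverse_cons,
      List.reverse_nil, List.nil_append, List.cons_append, List.prod_cons,
      LinearMap.smul_apply, Module.End.mul_apply, Submodule.coe_smul, map_smul, pow_succ,
      ← smul_neg, smul_smul]
    rw [mul_neg_one, neg_mul, neg_smul, smul_neg, mul_left_comm]

/-- An operator of degree `weight l` contributes to length `n` only if `weight l ≤ n`, which leaves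
finitely many sequences. -/
theorem hasOperatorSum_of_term {τ : List ℕ+ → Module.End K (Bimould F)}
    (hτ : ∀ l, HasDegree (weight l) (τ l)) {Ti : (Σ s : ℕ, (Fin s → ℕ+)) → Module.End K (LU F)}
    (hTi : ∀ x A, (Ti x A : LU F).1 = τ (revList x) A.1) {T : Module.End K (LU F)}
    (hT : ∀ (A : LU F) (n : ℕ), (T A : LU F).1 n =
      ∑ m ∈ Finset.range (n + 1), (∑ l ∈ ofWeight m, τ l) A.1 n) : HasOperatorSum Ti T := by
  intro A n
  have hsupp : (Function.support fun l => τ l A.1 n) ⊆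
      ((Finset.range (n + 1)).biUnion ofWeight : Finset (List ℕ+)) := by
    intro l hl
    rw [Finset.mem_coe, Finset.mem_biUnion]
    refine ⟨weight l, ?_, mem_ofWeight.2 rfl⟩
    by_contra h
    rw [Finset.mem_range] at h
    exact hl ((hτ l).low _ _ (by omega))
  constructor
  · have h : (Function.support fun x => (Ti x A : LU F).1 n) =
        revList ⁻¹' (Function.support fun l => τ l A.1 n) := by
      ext x
      simp [hTi]
    rw [h]
    exact ((Finset.finite_toSet _).subset hsupp).preimage revList_bijective.injective.injOn
  · rw [finsum_eq_of_bijective (g := fun l => τ l A.1 n) revList revList_bijective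
      (fun x => by rw [hTi]), finsum_eq_sum_of_support_subset _ hsupp, Finset.sum_biUnion, hT]
    · refine Finset.sum_congr rfl fun m _ => ?_
      rw [LinearMap.sum_apply, Finset.sum_apply]
    · intro m _ m' _ hne
      rw [Function.onFun, Finset.disjoint_left]
      intro l hl hl'
      exact hne ((mem_ofWeight.1 hl).symm.trans (mem_ofWeight.1 hl'))

end Expansion

end

end Flexion

/-! ### The two expansions -/

theorem theorem3 {K : Type*} [Field K] [CharZero K] (F : Flexion.Deck K) (S : Flexion.MU F) :
    Flexion.HasOperatorSum
      (fun x : Σ s : ℕ, (Fin s → ℕ+) =>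
        Flexion.coeff K x.2 •
          (List.ofFn fun i => Flexion.uari (Flexion.leng (x.2 i) (Flexion.di S))).prod)
      (Flexion.adari S) ∧
    Flexion.HasOperatorSum
      (fun x : Σ s : ℕ, (Fin s → ℕ+) =>
        ((-1) ^ x.1 * Flexion.coeff K x.2) •
          (List.ofFn fun i =>
            Flexion.uari (Flexion.leng (x.2 i) (Flexion.di (Flexion.ri S)))).reverse.prod)
      (Flexion.adari S) := by
  open Flexion Finset.HasAntidiagonal in
  set E := di (ri S) with hE
  set D := di S with hD
  have hE0 : E.1 0 = 0 := E.2
  have hD0 : D.1 0 = 0 := D.2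
  set C : ℕ → Module.End K (Bimould F) := fun m => ∑ l ∈ ofWeight m, term (stepLeft E.1) 1 l with hC
  set B : ℕ → Module.End K (Bimould F) := fun m => ∑ l ∈ ofWeight m, term (stepRight D.1) 1 l with hB
  have hC0 : C 0 = 1 := by simp [hC, ofWeight_zero, term]
  have hB0 : B 0 = 1 := by simp [hB, ofWeight_zero, term]
  have hCrec (m : ℕ) : m • C m = -∑ p ∈ antidiagonal m, adop (hom p.1 E.1) * C p.2 := by
    rw [← Finset.sum_neg_distrib]
    refine nsmul_sum_term (stepLeft E.1) 1 ?_ m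
    ext1 T
    simp [stepLeft_apply, hom_eq_zero hE0]
  have hBrec (m : ℕ) : m • B m = ∑ p ∈ antidiagonal m, B p.2 * adop (hom p.1 D.1) := by
    refine nsmul_sum_term (stepRight D.1) 1 ?_ m
    ext1 T
    simp [stepRight_apply, hom_eq_zero hD0]
  have hCdeg (m : ℕ) : HasDegree m (C m) := HasDegree.sum fun l hl => by
    rw [← mem_ofWeight.1 hl]
    exact hasDegree_term (hasDegree_stepLeft E.1) l
  have hCrec' := nsmul_eq_sum_mul_adop (ri S).2 (di_spec (ri S)) hE0 (ri_spec S) (di_spec S) hC0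
    hCrec hCdeg
  -- Both families satisfy the same right recursion with the same initial value. The term with `p.2
  -- = 0` drops out since `D` has no component of length `0`, so the recursion determines index `m`
  -- from smaller ones.
  have hBC (m : ℕ) : B m = C m := by
    induction m using Nat.strong_induction_on with
    | _ m ih =>
      by_cases hm : m = 0
      · rw [hm, hB0, hC0]
      · refine nsmul_left_cancel K hm ?_
        rw [hBrec, hCrec', ← Finset.Nat.sum_antidiagonal_swap]
        refine Finset.sum_congr rfl fun p hp => ?_
        have hp' := mem_antidiagonal.1 hp
        by_cases h2 : p.2 = 0
        · simp [h2, hom_eq_zero hD0, ← hD]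
        · simp only [Prod.fst_swap, Prod.snd_swap]
          rw [ih p.1 (by omega)]
  have hsum (A : LU F) (n : ℕ) :
      (adari S A : LU F).1 n = ∑ m ∈ Finset.range (n + 1), C m A.1 n :=
    gari_preari_eq_sum (ri S).2 (di_spec (ri S)) hE0 (ri_spec S) hC0 hCrec
      (fun m => (hCdeg m).low) A.1 n
  refine ⟨hasOperatorSum_of_term (hasDegree_term (hasDegree_stepRight D.1))
    (term_stepRight D) fun A n => ?_, hasOperatorSum_of_term
    (hasDegree_term (hasDegree_stepLeft E.1)) (term_stepLeft E) hsum⟩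
  rw [hsum]
  exact Finset.sum_congr rfl fun m _ => by rw [← hBC]
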